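/- Let $e\ge 1$ and $n\ge 2$, and let $B$ be the braid group of the complex reflection group $G(e,e,n)$, given by its Corran–Picantin presentation: generators $t_i$ ($i\in\mathbb Z/e$) and $s_3,\dots,s_n$; relations $t_it_{i+1}=t_jt_{j+1}$ for all $i,j$; $s_3t_is_3=t_is_3t_i$ for all $i$; $s_kt_i=t_is_k$ for $k\ge4$ and all $i$; $s_ks_{k+1}s_k=s_{k+1}s_ks_{k+1}$ for $3\le k<n$; $s_ks_l=s_ls_k$ for $|k-l|\ge2$. Let $B^+\subset B$ be the image of the monoid with the same presentation, and write $a\preccurlyeq b$ if $a^{-1}b\in B^+$ (prefix) and $b\succcurlyeq a$ if $ba^{-1}\in B^+$ (suffix). For $e\ge2$ let $\Delta=\Lambda_2\Lambda_3\cdots\Lambda_n$, where $\Lambda_k=s_k\cdots s_3\,t_0t_1\,s_3\cdots s_k$; for $e=1$ let $\Delta=t_0(s_3t_0)(s_4s_3t_0)\cdots(s_n\cdots s_3t_0)$. Definitions. $(G,G^+,\Delta)$ is a Garside structure on a group $G$ if $G^+$ is a submonoid without nontrivial invertible elements, $\preccurlyeq$ and $\succcurlyeq$ are lattice orders on $G$,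 the lengths of the factorizations of any $x\in G^+$ into nontrivial elements of $G^+$ are bounded, and $\Delta\in G^+$ is balanced (its positive prefixes are the same as its positive suffixes) with a finite set $\mathrm{Div}(\Delta)$ of positive prefixes, which generates $G^+$ as a monoid and $G$ as a group. The atoms are the nontrivial elements of $\mathrm{Div}(\Delta)$ without proper nontrivial positive prefixes; $\mathcal A$ is the set of atoms. For $X\subset\mathcal A$ let $\Delta_X$ be the join of $X$ for $\preccurlyeq$ ($\Delta_\varnothing=1$), let $\overline X=\mathcal A\cap\mathrm{Div}(\Delta_X)$, let $G_X=\langle\overline X\rangle$, and call $X$ saturated if $\overline X=X$. The structure is LCM-Garside if $\Delta=\Delta_{\mathcal A}$ and, for all $X\subset\mathcal A$, $\Delta_X$ is balanced and $\mathrm{Div}(\Delta_X)=\mathrm{Div}(\Delta)\cap G_X\cap G^+$ (that is, $G_X$ is a standard parabolic subgroup). The support $\mathrm{Supp}(x)$ of $x\in G$ is $\overline X$, where $X$ is the set of atoms that appear in any expressions of $a$ and $b$ as products of atoms, $x=a^{-1}b$ being the decomposition with $a,b\in G^+$, $a\wedge b=1$. An LCM-Garside structure is support-preserving if $\alpha^{-1}G_{\mathrm{Supp}(y)}\alpha=G_{\mathrm{Supp}(z)}$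 whenever $y,z\in G^+$, $\alpha\in G$ and $\alpha^{-1}y\alpha=z$. A minimal positive conjugator for $x\in G^+$ is a nontrivial $c\in G^+$ with $c^{-1}xc\in G^+$ such that $h^{-1}xh\notin G^+$ whenever $1\prec h\prec c$. For an atom $u$, $\rho_u(x)$ is the $\preccurlyeq$-least $c$ with $u\preccurlyeq c$ and $c^{-1}xc\in G^+$. The ribbon $r_{X,u}$ is $\Delta_X^{-1}\Delta_{X\cup\{u\}}$. Theorem. The monoid with the above presentation embeds in $B$, and $(B,B^+,\Delta)$ is an LCM-Garside structure. Its atoms are the generators $t_i$ ($i\in\mathbb Z/e$), $s_3,\dots,s_n$, which are pairwise distinct in $B$. A set $X$ of atoms is saturated if and only if $\#(X\cap\{t_0,\dots,t_{e-1}\})\in\{0,1,e\}$. The structure is support-preserving. Moreover, if $x\in B^+$, $X=\mathrm{Supp}(x)$, $u$ is an atom with $u\notin X$, and $c$ is a minimal positive conjugator for $x$ with $u\preccurlyeq c$, then $c=\rho_u(x)=r_{X,u}$. -/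

import Mathlib

/-! Part 1: Garside structures `(G, P, Δ)` on a group `G`, where `P` is the submonoid of
positive elements. -/

noncomputable section

namespace Garside

variable {G : Type*} [Group G]

/-- `a ≼ b`: `a` is a prefix of `b`. -/
def IsPrefix (P : Submonoid G) (a b : G) : Prop := a⁻¹ * b ∈ P

/-- `b ≽ a`: `a` is a suffix of `b`. -/
def IsSuffix (P : Submonoid G) (a b : G) : Prop := b * a⁻¹ ∈ P

/-- `m` is the join of `a` and `b` for the relation `r`. -/
def IsJoin (r : G → G → Prop) (a b m : G) : Prop :=
  r a m ∧ r b m ∧ ∀ c, r a c → r b c → r m c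

/-- `m` is the meet of `a` and `b` for the relation `r`. -/
def IsMeet (r : G → G → Prop) (a b m : G) : Prop :=
  r m a ∧ r m b ∧ ∀ c, r c a → r c b → r c m

/-- The positive prefixes of `d`. -/
def Div (P : Submonoid G) (d : G) : Set G := {a | a ∈ P ∧ IsPrefix P a d}

/-- The positive suffixes of `d`. -/
def SuffixDiv (P : Submonoid G) (d : G) : Set G := {a | a ∈ P ∧ IsSuffix P a d}

/-- A positive element whose positive prefixes and positive suffixes coincide. -/
def IsBalanced (P : Submonoid G) (d : G) : Prop := d ∈ P ∧ Div P d = SuffixDiv P d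

/-- `(G, P, Δ)` is a Garside structure (of finite type). -/
structure IsGarside (P : Submonoid G) (Δ : G) : Prop where
  /-- `1` is the only invertible positive element, so that `≼` and `≽` are orders. -/
  eq_one_of_inv_mem : ∀ a ∈ P, a⁻¹ ∈ P → a = 1
  prefix_join : ∀ a b : G, ∃ m, IsJoin (IsPrefix P) a b m
  prefix_meet : ∀ a b : G, ∃ m, IsMeet (IsPrefix P) a b m
  suffix_join : ∀ a b : G, ∃ m, IsJoin (IsSuffix P) a b m
  suffix_meet : ∀ a b : G, ∃ m, IsMeet (IsSuffix P) a b m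
  /-- the lengths of the factorizations of a positive element into nontrivial positive
  elements are bounded -/
  atomic : ∀ x ∈ P, ∃ N : ℕ, ∀ l : List G, (∀ a ∈ l, a ∈ P ∧ a ≠ 1) → l.prod = x →
    l.length ≤ N
  balanced : IsBalanced P Δ
  finite_simples : (Div P Δ).Finite
  simples_generate_monoid : Submonoid.closure (Div P Δ) = P
  simples_generate_group : Subgroup.closure (Div P Δ) = ⊤

/-- The atoms: nontrivial simple elements without proper nontrivial positive prefixes. -/
def atoms (P : Submonoid G) (Δ : G) : Set G :=
  {a | a ∈ Div P Δ ∧ a ≠ 1 ∧ ∀ b ∈ Div P a, b = 1 ∨ b = a}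

/-- `d` is the least common multiple of a set `X` of positive elements, i.e. the least positive
element having all elements of `X` as prefixes. (For nonempty `X` every common upper bound is
positive, so `d` is the join of `X` for `≼`; for `X = ∅` one gets `d = 1`.) -/
def IsLcm (P : Submonoid G) (X : Set G) (d : G) : Prop :=
  d ∈ P ∧ (∀ x ∈ X, IsPrefix P x d) ∧ ∀ m ∈ P, (∀ x ∈ X, IsPrefix P x m) → IsPrefix P d m

open Classical in
/-- `Δ_X`, the least common multiple of `X`. (In a Garside structure it exists for every set of
atoms, and is unique.) -/
def deltaSet (P : Submonoid G) (X : Set G) : G :=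
  if h : ∃ d, IsLcm P X d then h.choose else 1

/-- The support of a balanced element `d`: the atoms that divide `d`. -/
def suppBalanced (P : Submonoid G) (Δ d : G) : Set G := Div P d ∩ atoms P Δ

/-- `G_δ`, the subgroup generated by the support of `δ`. -/
def subgroupOf (P : Submonoid G) (Δ d : G) : Subgroup G := Subgroup.closure (suppBalanced P Δ d)

/-- `δ` is a balanced simple element such that `G_δ` is a standard parabolic subgroup:
`Div(δ) = Div(Δ) ∩ G_δ⁺`, where `G_δ⁺ = G_δ ∩ G⁺`. -/
def IsStandardParabolic (P : Submonoid G) (Δ d : G) : Prop :=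
  IsBalanced P d ∧ d ∈ Div P Δ ∧
    Div P d = Div P Δ ∩ ((subgroupOf P Δ d : Set G) ∩ (P : Set G))

/-- LCM-Garside structures. -/
structure IsLCMGarside (P : Submonoid G) (Δ : G) : Prop where
  garside : IsGarside P Δ
  delta_eq : Δ = deltaSet P (atoms P Δ)
  balanced : ∀ X ⊆ atoms P Δ, IsBalanced P (deltaSet P X)
  standard : ∀ X ⊆ atoms P Δ, IsStandardParabolic P Δ (deltaSet P X)

/-- The closure of a set `X` of atoms: the atoms that divide `Δ_X`. -/
def satClosure (P : Submonoid G) (Δ : G) (X : Set G) : Set G :=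
  suppBalanced P Δ (deltaSet P X)

/-- A set of atoms is saturated if it equals its closure. -/
def IsSaturated (P : Submonoid G) (Δ : G) (X : Set G) : Prop := satClosure P Δ X = X

/-- `G_X = G_{Δ_X}`. -/
def parabolic (P : Submonoid G) (Δ : G) (X : Set G) : Subgroup G :=
  subgroupOf P Δ (deltaSet P X)

/-- `S` is the support of `x`: if `x = a⁻¹ b` is the reduced left-fraction decomposition of `x`,
and `a`, `b` are written as products of atoms, then `S` is the closure of the set of atoms that
appear in these two products. -/
def IsSupport (P : Submonoid G) (Δ x : G) (S : Set G) : Prop :=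
  ∃ a ∈ P, ∃ b ∈ P, x = a⁻¹ * b ∧ IsMeet (IsPrefix P) a b 1 ∧
    ∃ la lb : List G, (∀ y ∈ la, y ∈ atoms P Δ) ∧ (∀ y ∈ lb, y ∈ atoms P Δ) ∧
      la.prod = a ∧ lb.prod = b ∧ S = satClosure P Δ {y | y ∈ la ∨ y ∈ lb}

/-- `H^g = g⁻¹ H g`. -/
def conjSubgroup (H : Subgroup G) (g : G) : Subgroup G :=
  H.map (MulAut.conj g⁻¹).toMonoidHom

/-- Support-preservation: if `y, z` are positive and `α⁻¹ y α = z`, then `α` conjugates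
`G_{Supp(y)}` to `G_{Supp(z)}`. -/
def IsSupportPreserving (P : Submonoid G) (Δ : G) : Prop :=
  ∀ y ∈ P, ∀ z ∈ P, ∀ α : G, α⁻¹ * y * α = z →
    ∀ S T : Set G, IsSupport P Δ y S → IsSupport P Δ z T →
      conjSubgroup (parabolic P Δ S) α = parabolic P Δ T

/-- `c` is a minimal positive conjugator for the positive element `x`. -/
def IsMinimalPositiveConjugator (P : Submonoid G) (x c : G) : Prop :=
  c ∈ P ∧ c ≠ 1 ∧ c⁻¹ * x * c ∈ P ∧
    ∀ h ∈ P, h ≠ 1 → IsPrefix P h c → h ≠ c → h⁻¹ * x * h ∉ P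

/-- `c = ρ_a(x)`: the `≼`-least element among the `α` with `a ≼ α` and `α⁻¹ x α` positive. -/
def IsRho (P : Submonoid G) (a x c : G) : Prop :=
  IsPrefix P a c ∧ c⁻¹ * x * c ∈ P ∧
    ∀ d : G, IsPrefix P a d → d⁻¹ * x * d ∈ P → IsPrefix P c d

/-- The ribbon `r_{X,u} = Δ_X⁻¹ Δ_{X ∪ {u}}`. -/
def ribbon (P : Submonoid G) (X : Set G) (u : G) : G :=
  (deltaSet P X)⁻¹ * deltaSet P (X ∪ {u})

end Garside

/-! Part 2: the Corran–Picantin monoid and group of type `G(e,e,n)`, for `e ≥ 1`, `n ≥ 2`. -/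

namespace CorranPicantin

/-- The generators `t_i` (`i` modulo `e`) and `s_3, …, s_n`. -/
inductive Gen (e n : ℕ) : Type
  | t (i : ZMod e) : Gen e n
  | s (k : ℕ) (h3 : 3 ≤ k) (hn : k ≤ n) : Gen e n

/-- A generator as a word of length one. -/
def w {e n : ℕ} (g : Gen e n) : FreeMonoid (Gen e n) := FreeMonoid.of g

/-- The defining relations, as pairs of positive words. -/
inductive Rel (e n : ℕ) : FreeMonoid (Gen e n) → FreeMonoid (Gen e n) → Prop
  | tt (i j : ZMod e) :
      Rel e n (w (.t i) * w (.t (i + 1))) (w (.t j) * w (.t (j + 1)))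
  | s3t (hn : 3 ≤ n) (i : ZMod e) :
      Rel e n (w (.s 3 le_rfl hn) * w (.t i) * w (.s 3 le_rfl hn))
        (w (.t i) * w (.s 3 le_rfl hn) * w (.t i))
  | st (k : ℕ) (h3 : 3 ≤ k) (hn : k ≤ n) (h4 : 4 ≤ k) (i : ZMod e) :
      Rel e n (w (.s k h3 hn) * w (.t i)) (w (.t i) * w (.s k h3 hn))
  | braid (k : ℕ) (h3 : 3 ≤ k) (hn : k ≤ n) (h3' : 3 ≤ k + 1) (hn' : k + 1 ≤ n) :
      Rel e n (w (.s k h3 hn) * w (.s (k + 1) h3' hn') * w (.s k h3 hn))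
        (w (.s (k + 1) h3' hn') * w (.s k h3 hn) * w (.s (k + 1) h3' hn'))
  | comm (k l : ℕ) (h3 : 3 ≤ k) (hn : k ≤ n) (h3' : 3 ≤ l) (hn' : l ≤ n) (hkl : k + 2 ≤ l) :
      Rel e n (w (.s k h3 hn) * w (.s l h3' hn')) (w (.s l h3' hn') * w (.s k h3 hn))

/-- The Corran–Picantin (standard) monoid of type `G(e,e,n)`. -/
abbrev StdMonoid (e n : ℕ) : Type := PresentedMonoid (Rel e n)

/-- The relators `u v⁻¹` of the group, one for each relation `u = v`. -/
def relators (e n : ℕ) : Set (FreeGroup (Gen e n)) :=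
  {r | ∃ u v, Rel e n u v ∧
    r = FreeMonoid.lift FreeGroup.of u * (FreeMonoid.lift FreeGroup.of v)⁻¹}

/-- The braid group `B` of type `G(e,e,n)`, given by the same presentation. -/
abbrev Braid (e n : ℕ) : Type := PresentedGroup (relators e n)

/-- A generator, as an element of `B`. -/
def gen {e n : ℕ} (g : Gen e n) : Braid e n := PresentedGroup.of g

theorem lift_gen_eq {e n : ℕ} (u v : FreeMonoid (Gen e n)) (h : Rel e n u v) :
    FreeMonoid.lift (gen (e := e) (n := n)) u = FreeMonoid.lift gen v := by
  have key : ∀ x : FreeMonoid (Gen e n), FreeMonoid.lift (gen (e := e) (n := n)) x =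
      PresentedGroup.mk (relators e n) (FreeMonoid.lift FreeGroup.of x) := by
    intro x
    have : FreeMonoid.lift (gen (e := e) (n := n)) =
        (PresentedGroup.mk (relators e n)).comp (FreeMonoid.lift FreeGroup.of) :=
      FreeMonoid.hom_eq fun _ => rfl
    rw [this]; rfl
  rw [key, key, ← mul_inv_eq_one, ← map_inv, ← map_mul]
  exact PresentedGroup.one_of_mem ⟨u, v, h, rfl⟩

/-- The natural homomorphism from the standard monoid to `B`. -/
def toBraid (e n : ℕ) : StdMonoid e n →* Braid e n :=
  PresentedMonoid.lift gen lift_gen_eq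

/-- `B⁺`, the submonoid of positive elements: the image of the standard monoid in `B`. -/
def pos (e n : ℕ) : Submonoid (Braid e n) := MonoidHom.mrange (toBraid e n)

/-- `s_k` in `B` (meaningful for `3 ≤ k ≤ n` only). -/
def sElt (e n k : ℕ) : Braid e n :=
  if h : 3 ≤ k ∧ k ≤ n then gen (.s k h.1 h.2) else 1

/-- `T_e = {t_0, …, t_{e-1}}`, as a subset of `B`. -/
def tSet (e n : ℕ) : Set (Braid e n) := Set.range fun i : ZMod e => gen (.t i)

/-- The set `{t_0, …, t_{e-1}, s_3, …, s_n}`, as a subset of `B`. -/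
def genSet (e n : ℕ) : Set (Braid e n) := Set.range gen

/-- `s_3 s_4 ⋯ s_k` (equal to `1` for `k = 2`). -/
def sUp (e n k : ℕ) : Braid e n := ((List.range' 3 (k - 2)).map (sElt e n)).prod

/-- `s_k ⋯ s_4 s_3` (equal to `1` for `k = 2`). -/
def sDown (e n k : ℕ) : Braid e n := ((List.range' 3 (k - 2)).reverse.map (sElt e n)).prod

/-- `Λ_k = s_k ⋯ s_3 τ s_3 ⋯ s_k`, where `τ = t_0 t_1`. -/
def Lam (e n k : ℕ) : Braid e n :=
  sDown e n k * (gen (.t 0) * gen (.t 1)) * sUp e n k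

/-- The Garside element: `Λ_2 Λ_3 ⋯ Λ_n` for `e ≥ 2`. For `e = 1` the monoid is the classical
braid monoid on the `n` strands, with Artin generators `t_0, s_3, …, s_n`, and the Garside element
is the half twist `t_0 (s_3 t_0) (s_4 s_3 t_0) ⋯ (s_n ⋯ s_3 t_0)`. -/
def garsideElt (e n : ℕ) : Braid e n :=
  ((List.range' 2 (n - 1)).map fun k =>
    if e = 1 then sDown e n k * gen (.t 0) else Lam e n k).prod

end CorranPicantin

end

/-!
The generators are ordered by a rank, which is `2` for each `t_i` and `k` for `s_k`. Letters whose
ranks differ by at least two commute, letters whose ranks differ by one satisfy the braid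
relation, and any two of the `t_i` have the least common multiple `t_i t_{i+1} = t_j t_{j+1}`. So
the presentation is complemented: there is one relation `a (a \ b) = b (b \ a)` for every pair of
letters, and `cube` checks Garside's cube condition for it. By induction on length (`compUpTo`)
the monoid is left cancellative, and two elements with a common multiple have a least one
(`exists_lcm_of_common`). An anti-automorphism gives right cancellation. The product of the
factors in the definition of `Δ` is a common multiple of the letters; hence a power of their least
common multiple is central, and the monoid embeds into its localization at this element and thus
into the braid group (`toBraid_injective`).

Everything else is derived from the properties collected in `System`. A set of letters is closed
if it contains all of the `t_i` once it contains two of them; these are the saturated sets. For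
closed `Y`, the set of words in `Y` is stable under the relations, so that the submonoid generated
by `Y` is closed under factors and least common multiples, and `Δ_Y` permutes `Y` by conjugation.
This yields lattices and balanced elements. To see that `Div(Δ_Y)` consists of all simple elements
of the parabolic subgroup (`isPrefix_delta_of_mem`), it suffices that no square of a letter
divides `Δ` (`squareFree`). This is proved from the factorization of `Δ` into its explicit
factors.

The main point is that a minimal positive conjugator `c` of `x`, divisible by a letter `u` outside
the closed set `Y` generated by the letters of `x`, is the ribbon `r = Δ_Y⁻¹ Δ_{Y ∪ {u}}`
(`eq_ribbon_of_minimal`). The ribbon conjugates `Y` to letters and is divisible by no letter in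
`Y`. The meet `d` of `c` and `r` is a positive conjugator of `x`, hence `d ≼ x d`. Reading `x`
letter by letter, the joins of the letters with prefixes of `r` get longer at each step, while the
total length is bounded by that of `d`; so each step adds exactly one letter, and a version of
Deodhar's lemma (`mul_eq_of_isJoin`) shows that `d` itself conjugates each letter of `x` to a
letter (`eq_and_conj_of_isPrefix`). Then `d` so conjugates all of `Y`, whence `u ≼ d ≼ Δ_Y d`, and
so `r ≼ d`. A letter `u = t_j` need not divide `r` if `Y` contains exactly one `t_i`; this case is
reduced to that of the letter `t_{i+1}`, which has the same ribbon (`ribbon_isPrefix_of_conj`).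

The conjugate of `Y` by a ribbon is again closed (`exists_conj_ribbon`), and a minimal positive
conjugator that is divisible by a letter in `Y` lies in the submonoid generated by `Y`. As every
positive conjugator is a product of minimal ones, and every conjugator becomes positive when
multiplied by a central element, supports are preserved (`conjSubgroup_closure`).
-/

namespace CorranPicantin

/-! ### The generators: rank, shift and complement -/

namespace Gen

variable {e n : ℕ}

/-- The rank of a generator: its index for the `s_k`, and `2` for each of the `t_i`. Two distinct
generators commute if their ranks differ by at least two, braid if they differ by one, and have
equal ranks exactly when both are among the `t_i`. -/
def rk : Gen e n → ℕ
  | t _ => 2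
  | s k _ _ => k

/-- The permutation `t_i ↦ t_{i+1}` of the generators, which fixes every `s_k`. -/
def shift : Gen e n → Gen e n
  | t i => t (i + 1)
  | s k h3 hn => s k h3 hn

@[simp] theorem rk_t (i : ZMod e) : (t i : Gen e n).rk = 2 := rfl
@[simp] theorem rk_s (k : ℕ) (h3 : 3 ≤ k) (hn : k ≤ n) : (s k h3 hn : Gen e n).rk = k := rfl

@[simp] theorem rk_shift (a : Gen e n) : a.shift.rk = a.rk := by cases a <;> rfl

theorem shift_injective : Function.Injective (shift : Gen e n → Gen e n) := by
  intro a b h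
  cases a <;> cases b <;> simp_all [shift]

theorem two_le_rk (a : Gen e n) : 2 ≤ a.rk := by
  cases a <;> simp only [rk_t, rk_s] <;> omega

theorem rk_eq_two_of_ne {a b : Gen e n} (h : a ≠ b) (hr : a.rk = b.rk) : a.rk = 2 := by
  cases a <;> cases b <;> simp_all

theorem exists_t_of_rk {a : Gen e n} (h : a.rk = 2) : ∃ i, a = t i := by
  cases a with
  | t i => exact ⟨i, rfl⟩
  | s k h3 hn => simp at h; omega

theorem eq_of_rk_eq {a b : Gen e n} (h : a.rk = b.rk) (h2 : a.rk ≠ 2) : a = b := by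
  by_contra hne
  exact h2 (rk_eq_two_of_ne hne h)

/-- If there are at least two different `t_i`, then no `t_i` is fixed by the shift. -/
theorem shift_ne {a b : Gen e n} (h : a ≠ b) (hr : a.rk = b.rk) : a.shift ≠ a := by
  obtain ⟨i, rfl⟩ := exists_t_of_rk (rk_eq_two_of_ne h hr)
  obtain ⟨j, rfl⟩ := exists_t_of_rk (hr ▸ rk_eq_two_of_ne h hr)
  intro hs
  have h1 : (1 : ZMod e) = 0 := by simpa [shift] using hs
  have : Subsingleton (ZMod e) := subsingleton_of_zero_eq_one h1.symm
  exact h (by rw [Subsingleton.elim i j])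

end Gen

/-- The defining relations in terms of ranks, for a family `g` of elements of a monoid. -/
structure Satisfies {e n : ℕ} {N : Type*} [Monoid N] (g : Gen e n → N) : Prop where
  comm : ∀ a b : Gen e n, a.rk + 2 ≤ b.rk ∨ b.rk + 2 ≤ a.rk → g a * g b = g b * g a
  braid : ∀ a b : Gen e n, a.rk + 1 = b.rk ∨ b.rk + 1 = a.rk →
    g a * (g b * g a) = g b * (g a * g b)
  shift : ∀ a b : Gen e n, a.rk = b.rk → a.rk = 2 → g a * g a.shift = g b * g b.shift

open Classical in
/-- The complement `a \ b` of two distinct generators: `g a * comp g a b` is the least common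
multiple of `g a` and `g b`. (The value for `a = b` is irrelevant.) -/
def comp {e n : ℕ} {N : Type*} [Monoid N] (g : Gen e n → N) (a b : Gen e n) : N :=
  if a.rk = b.rk then g a.shift
  else if a.rk + 1 = b.rk ∨ b.rk + 1 = a.rk then g b * g a else g b

section comp

variable {e n : ℕ} {N : Type*} [Monoid N] (g : Gen e n → N) {a b : Gen e n}

theorem comp_of_eq (h : a.rk = b.rk) : comp g a b = g a.shift := by simp [comp, h]

theorem comp_of_adj (h : a.rk + 1 = b.rk ∨ b.rk + 1 = a.rk) : comp g a b = g b * g a := by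
  have : a.rk ≠ b.rk := by omega
  simp [comp, h, this]

theorem comp_of_far (h : a.rk + 2 ≤ b.rk ∨ b.rk + 2 ≤ a.rk) : comp g a b = g b := by
  have h1 : a.rk ≠ b.rk := by omega
  have h2 : ¬ (a.rk + 1 = b.rk ∨ b.rk + 1 = a.rk) := by omega
  simp [comp, h1, h2]

variable {g} in
theorem Satisfies.mul_comp (hg : Satisfies g) (hab : a ≠ b) :
    g a * comp g a b = g b * comp g b a := by
  rcases lt_trichotomy a.rk b.rk with h | h | h
  · by_cases h1 : a.rk + 1 = b.rk
    · rw [comp_of_adj g (.inl h1), comp_of_adj g (.inr h1), hg.braid a b (.inl h1)]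
    · rw [comp_of_far g (by omega), comp_of_far g (by omega), hg.comm a b (by omega)]
  · rw [comp_of_eq g h, comp_of_eq g h.symm, hg.shift a b h (Gen.rk_eq_two_of_ne hab h)]
  · by_cases h1 : b.rk + 1 = a.rk
    · rw [comp_of_adj g (.inl h1), comp_of_adj g (.inr h1), hg.braid a b (.inr h1)]
    · rw [comp_of_far g (by omega), comp_of_far g (by omega), hg.comm a b (by omega)]

end comp

/-- The image of a generator in the standard monoid. -/
def mgen {e n : ℕ} (a : Gen e n) : StdMonoid e n := PresentedMonoid.of (Rel e n) a

/-- Every defining relation is of the form `a (a \ b) = b (b \ a)`. -/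
theorem Rel.exists_comp {e n : ℕ} {u v : FreeMonoid (Gen e n)} (h : Rel e n u v) :
    ∃ a b, u = w a * comp w a b ∧ v = w b * comp w b a := by
  cases h with
  | tt i j => exact ⟨.t i, .t j, by rw [comp_of_eq _ (by simp)]; rfl, by
      rw [comp_of_eq _ (by simp)]; rfl⟩
  | s3t hn i => exact ⟨.s 3 le_rfl hn, .t i, by
      rw [comp_of_adj _ (by simp), mul_assoc], by rw [comp_of_adj _ (by simp), mul_assoc]⟩
  | st k h3 hn h4 i => exact ⟨.s k h3 hn, .t i, by
      rw [comp_of_far _ (by simp; omega)], by rw [comp_of_far _ (by simp; omega)]⟩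
  | braid k h3 hn h3' hn' => exact ⟨.s k h3 hn, .s (k + 1) h3' hn', by
      rw [comp_of_adj _ (by simp), mul_assoc], by rw [comp_of_adj _ (by simp), mul_assoc]⟩
  | comm k l h3 hn h3' hn' hkl => exact ⟨.s k h3 hn, .s l h3' hn', by
      rw [comp_of_far _ (by simp; omega)], by rw [comp_of_far _ (by simp; omega)]⟩

/-- A family of elements satisfying the relations of the presentation satisfies them in the form
that only refers to ranks. -/
theorem satisfies_of_rel {e n : ℕ} {N : Type*} [Monoid N] (g : Gen e n → N)
    (h : ∀ u v, Rel e n u v → FreeMonoid.lift g u = FreeMonoid.lift g v) : Satisfies g := by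
  have tt : ∀ i j, g (.t i) * g (.t (i + 1)) = g (.t j) * g (.t (j + 1)) := fun i j => by
    simpa [w] using h _ _ (.tt i j)
  have s3t : ∀ hn i, g (.s 3 le_rfl hn) * (g (.t i) * g (.s 3 le_rfl hn)) =
      g (.t i) * (g (.s 3 le_rfl hn) * g (.t i)) := fun hn i => by
    simpa [w, mul_assoc] using h _ _ (.s3t hn i)
  have st : ∀ k h3 hn, 4 ≤ k → ∀ i, g (.s k h3 hn) * g (.t i) = g (.t i) * g (.s k h3 hn) :=
    fun k h3 hn h4 i => by simpa [w] using h _ _ (.st k h3 hn h4 i)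
  have br : ∀ k h3 hn h3' hn', g (.s k h3 hn) * (g (.s (k + 1) h3' hn') * g (.s k h3 hn)) =
      g (.s (k + 1) h3' hn') * (g (.s k h3 hn) * g (.s (k + 1) h3' hn')) :=
    fun k h3 hn h3' hn' => by simpa [w, mul_assoc] using h _ _ (.braid k h3 hn h3' hn')
  have cm : ∀ k l h3 hn h3' hn', k + 2 ≤ l → g (.s k h3 hn) * g (.s l h3' hn') =
      g (.s l h3' hn') * g (.s k h3 hn) :=
    fun k l h3 hn h3' hn' hkl => by simpa [w] using h _ _ (.comm k l h3 hn h3' hn' hkl)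
  refine ⟨fun a b hab => ?_, fun a b hab => ?_, fun a b hab ha => ?_⟩
  · cases a with
    | t i => cases b with
      | t j => simp at hab
      | s l h3 hn => exact (st l h3 hn (by simp at hab; omega) i).symm
    | s k h3 hn => cases b with
      | t j => exact st k h3 hn (by simp at hab; omega) j
      | s l h3' hn' =>
        simp only [Gen.rk_s] at hab
        rcases hab with hab | hab
        · exact cm _ _ _ _ _ _ hab
        · exact (cm _ _ _ _ _ _ hab).symm
  · cases a with
    | t i => cases b with
      | t j => simp at hab
      | s l h3 hn =>
        simp only [Gen.rk_s, Gen.rk_t] at hab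
        obtain rfl : l = 3 := by omega
        exact (s3t _ _).symm
    | s k h3 hn => cases b with
      | t j =>
        simp only [Gen.rk_s, Gen.rk_t] at hab
        obtain rfl : k = 3 := by omega
        exact s3t _ _
      | s l h3' hn' =>
        simp only [Gen.rk_s] at hab
        rcases hab with hab | hab
        · subst hab; exact br _ _ _ _ _
        · subst hab; exact (br _ _ _ _ _).symm
  · obtain ⟨i, rfl⟩ := Gen.exists_t_of_rk ha
    obtain ⟨j, rfl⟩ := Gen.exists_t_of_rk (hab ▸ ha)
    exact tt i j

theorem satisfies_mgen (e n : ℕ) : Satisfies (mgen (e := e) (n := n)) :=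
  satisfies_of_rel _ fun u v h => by
    have key : FreeMonoid.lift (mgen (e := e) (n := n)) = PresentedMonoid.mk (Rel e n) :=
      FreeMonoid.hom_eq fun _ => rfl
    rw [key]; exact PresentedMonoid.mk_eq_mk_of_rel h

theorem satisfies_gen (e n : ℕ) : Satisfies (gen (e := e) (n := n)) :=
  satisfies_of_rel _ fun u v h => lift_gen_eq u v h

/-! ### Length -/

theorem Rel.length_eq {e n : ℕ} {u v : FreeMonoid (Gen e n)} (h : Rel e n u v) :
    u.length = v.length := by
  cases h <;> simp [w, FreeMonoid.length_mul]

/-- Word length, which is well defined on the standard monoid as the relations are homogeneous. -/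
def mlenHom (e n : ℕ) : StdMonoid e n →* Multiplicative ℕ :=
  PresentedMonoid.lift (fun _ => Multiplicative.ofAdd 1) fun u v h => by
    have key : ∀ x : FreeMonoid (Gen e n), FreeMonoid.lift
        (fun _ : Gen e n => Multiplicative.ofAdd 1) x = Multiplicative.ofAdd x.length := by
      intro x
      induction x using FreeMonoid.inductionOn' with
      | one => simp
      | of_mul a x ih => simp [ih, FreeMonoid.length_mul, ofAdd_add]
    rw [key, key, h.length_eq]

/-- The length of an element of the standard monoid. -/
def mlen {e n : ℕ} (x : StdMonoid e n) : ℕ := (mlenHom e n x).toAdd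

section monoid

variable {e n : ℕ}

@[simp] theorem mlen_one : mlen (1 : StdMonoid e n) = 0 := by simp [mlen]
@[simp] theorem mlen_mul (x y : StdMonoid e n) : mlen (x * y) = mlen x + mlen y := by simp [mlen]
@[simp] theorem mlen_mgen (a : Gen e n) : mlen (mgen a) = 1 := by
  simp [mlen, mlenHom, mgen]

theorem exists_mgen_mul (x : StdMonoid e n) : x = 1 ∨ ∃ a y, x = mgen a * y := by
  induction x using PresentedMonoid.inductionOn with
  | h u =>
    induction u using FreeMonoid.inductionOn' with
    | one => left; simp
    | of_mul a x _ => right; exact ⟨a, PresentedMonoid.mk _ x, by rw [map_mul]; rfl⟩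

theorem exists_mgen_mul_of_mlen {x : StdMonoid e n} (h : mlen x ≠ 0) :
    ∃ a y, x = mgen a * y := by
  rcases exists_mgen_mul x with rfl | h'
  · simp at h
  · exact h'

theorem eq_one_of_mlen {x : StdMonoid e n} (h : mlen x = 0) : x = 1 := by
  rcases exists_mgen_mul x with rfl | ⟨a, y, rfl⟩
  · rfl
  · simp at h

end monoid

section letters

variable {e n : ℕ}

/-! ### The letters of an element -/

/-- A set of generators which contains all of the `t_i` as soon as it contains two of them. The
defining relations preserve the set of words whose letters lie in such a set. -/
def IsClosed (X : Set (Gen e n)) : Prop :=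
  ∀ a ∈ X, ∀ b ∈ X, a ≠ b → a.rk = b.rk → ∀ c : Gen e n, c.rk = a.rk → c ∈ X

theorem IsClosed.univ : IsClosed (Set.univ : Set (Gen e n)) := fun _ _ _ _ _ _ _ _ => trivial

/-- A relation whose left-hand side is written in a closed set of letters has its right-hand side
written in that set. -/
theorem IsClosed.letters_of_rel {X : Set (Gen e n)} (hX : IsClosed X) {a b : Gen e n}
    (h : ∀ c ∈ (w a * comp w a b : FreeMonoid (Gen e n)).toList, c ∈ X) :
    ∀ c ∈ (w b * comp w b a : FreeMonoid (Gen e n)).toList, c ∈ X := by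
  rcases lt_trichotomy a.rk b.rk with h1 | h1 | h1
  · by_cases h2 : a.rk + 1 = b.rk
    · rw [comp_of_adj _ (.inl h2)] at h
      rw [comp_of_adj _ (.inr h2)]
      simp [w] at h ⊢; tauto
    · rw [comp_of_far _ (by omega)] at h
      rw [comp_of_far _ (by omega)]
      simp [w] at h ⊢; tauto
  · rw [comp_of_eq _ h1] at h
    rw [comp_of_eq _ h1.symm]
    by_cases hab : a = b
    · subst hab; exact h
    · have := Gen.shift_ne hab h1
      simp [w] at h ⊢
      exact ⟨hX _ h.1 _ h.2 this.symm (by simp) _ h1.symm,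
        hX _ h.1 _ h.2 this.symm (by simp) _ (by simp [h1])⟩
  · by_cases h2 : b.rk + 1 = a.rk
    · rw [comp_of_adj _ (.inr h2)] at h
      rw [comp_of_adj _ (.inl h2)]
      simp [w] at h ⊢; tauto
    · rw [comp_of_far _ (by omega)] at h
      rw [comp_of_far _ (by omega)]
      simp [w] at h ⊢; tauto

theorem IsClosed.letters_iff {X : Set (Gen e n)} (hX : IsClosed X) {u v : FreeMonoid (Gen e n)}
    (h : ConGen.Rel (Rel e n) u v) : (∀ c ∈ u.toList, c ∈ X) ↔ ∀ c ∈ v.toList, c ∈ X := by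
  induction h with
  | of u v h =>
    obtain ⟨a, b, rfl, rfl⟩ := h.exists_comp
    exact ⟨hX.letters_of_rel, hX.letters_of_rel⟩
  | refl => rfl
  | symm _ ih => exact ih.symm
  | trans _ _ ih ih' => exact ih.trans ih'
  | mul _ _ ih ih' =>
    simp only [FreeMonoid.toList_mul, List.mem_append, or_imp, forall_and]
    rw [ih, ih']

/-- All words for an element have their letters in a closed set `X` as soon as one of them does. -/
theorem mem_closure_mgen_iff {X : Set (Gen e n)} (hX : IsClosed X) (u : FreeMonoid (Gen e n)) :
    PresentedMonoid.mk (Rel e n) u ∈ Submonoid.closure (mgen '' X) ↔ ∀ c ∈ u.toList, c ∈ X := by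
  constructor
  · intro h
    suffices H : ∀ x ∈ Submonoid.closure (mgen (e := e) (n := n) '' X),
        ∃ v, PresentedMonoid.mk (Rel e n) v = x ∧ ∀ c ∈ v.toList, c ∈ X by
      obtain ⟨v, hv, hvX⟩ := H _ h
      exact (hX.letters_iff (PresentedMonoid.mk_eq_mk_iff.1 hv)).1 hvX
    intro x hx
    induction hx using Submonoid.closure_induction with
    | mem x hx =>
      obtain ⟨a, ha, rfl⟩ := hx
      exact ⟨FreeMonoid.of a, rfl, by simpa using ha⟩
    | one => exact ⟨1, by simp, by simp⟩
    | mul x y _ _ hx hy =>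
      obtain ⟨u, rfl, hu⟩ := hx
      obtain ⟨v, rfl, hv⟩ := hy
      refine ⟨u * v, by simp, ?_⟩
      simp only [FreeMonoid.toList_mul, List.mem_append, or_imp, forall_and]
      exact ⟨hu, hv⟩
  · induction u using FreeMonoid.inductionOn' with
    | one => intro _; rw [map_one]; exact one_mem _
    | of_mul a u ih =>
      intro h
      rw [map_mul]
      simp only [FreeMonoid.toList_mul, List.mem_append, or_imp, forall_and] at h
      exact mul_mem (Submonoid.subset_closure ⟨a, h.1 a (by simp), rfl⟩) (ih h.2)

/-- The submonoid generated by a closed set of generators contains all factors of its elements. -/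
theorem mem_closure_mgen_of_mul {X : Set (Gen e n)} (hX : IsClosed X) {x y : StdMonoid e n}
    (h : x * y ∈ Submonoid.closure (mgen '' X)) :
    x ∈ Submonoid.closure (mgen '' X) ∧ y ∈ Submonoid.closure (mgen '' X) := by
  induction x using PresentedMonoid.inductionOn with
  | h u =>
    induction y using PresentedMonoid.inductionOn with
    | h v =>
      rw [← map_mul, mem_closure_mgen_iff hX] at h
      rw [mem_closure_mgen_iff hX, mem_closure_mgen_iff hX]
      simpa only [FreeMonoid.toList_mul, List.mem_append, or_imp, forall_and] using h

theorem mem_closure_univ (x : StdMonoid e n) : x ∈ Submonoid.closure (mgen '' Set.univ) := by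
  rw [Set.image_univ]
  exact PresentedMonoid.closure_range_of (Rel e n) ▸ Submonoid.mem_top x

theorem mem_of_mgen_mem {X : Set (Gen e n)} (hX : IsClosed X) {a : Gen e n}
    (h : mgen a ∈ Submonoid.closure (mgen '' X)) : a ∈ X := by
  have := (mem_closure_mgen_iff hX (FreeMonoid.of a)).1 h
  simpa using this

theorem IsClosed.shift_mem {X : Set (Gen e n)} (hX : IsClosed X) {a b : Gen e n} (ha : a ∈ X)
    (hb : b ∈ X) (hab : a ≠ b) (hr : a.rk = b.rk) : a.shift ∈ X :=
  hX a ha b hb hab hr _ (by simp)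

theorem IsClosed.comp_mem {N : Type*} [Monoid N] (g : Gen e n → N) {X : Set (Gen e n)}
    (hX : IsClosed X) {a b : Gen e n} (ha : a ∈ X) (hb : b ∈ X) (hab : a ≠ b) :
    comp g a b ∈ Submonoid.closure (g '' X) := by
  have hmem : ∀ c ∈ X, g c ∈ Submonoid.closure (g '' X) := fun c hc =>
    Submonoid.subset_closure ⟨c, hc, rfl⟩
  unfold comp
  split_ifs with h1
  · exact hmem _ (hX.shift_mem ha hb hab h1)
  · exact mul_mem (hmem _ hb) (hmem _ ha)
  · exact hmem _ hb

end letters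

end CorranPicantin

namespace CorranPicantin

variable {e n : ℕ}

/-! ### Left cancellation and least common multiples in the standard monoid -/

/-- `a x` and `b y` are equal for the reason that `x = y` if `a = b`, and otherwise that both are
the same multiple of the least common multiple of `a` and `b`. -/
def CompRel (a : Gen e n) (x : StdMonoid e n) (b : Gen e n) (y : StdMonoid e n) : Prop :=
  (a = b ∧ x = y) ∨ (a ≠ b ∧ ∃ z, x = comp mgen a b * z ∧ y = comp mgen b a * z)

theorem CompRel.symm {a b : Gen e n} {x y : StdMonoid e n} (h : CompRel a x b y) :
    CompRel b y a x := by
  rcases h with ⟨rfl, rfl⟩ | ⟨hab, z, rfl, rfl⟩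
  · exact .inl ⟨rfl, rfl⟩
  · exact .inr ⟨hab.symm, z, rfl, rfl⟩

theorem CompRel.mul_right {a b : Gen e n} {x y : StdMonoid e n} (h : CompRel a x b y)
    (c : StdMonoid e n) : CompRel a (x * c) b (y * c) := by
  rcases h with ⟨rfl, rfl⟩ | ⟨hab, z, rfl, rfl⟩
  · exact .inl ⟨rfl, rfl⟩
  · exact .inr ⟨hab, z * c, by rw [mul_assoc], by rw [mul_assoc]⟩

/-- Two generators that begin the same element of length at most `k` do so through their
complements. -/
def CompUpTo (e n k : ℕ) : Prop :=
  ∀ (a b : Gen e n) (x y : StdMonoid e n), mlen x + 1 ≤ k → mgen a * x = mgen b * y →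
    CompRel a x b y

theorem CompUpTo.cancel {k : ℕ} (H : CompUpTo e n k) {a : Gen e n} {x y : StdMonoid e n}
    (hx : mlen x + 1 ≤ k) (h : mgen a * x = mgen a * y) : x = y := by
  rcases H a a x y hx h with ⟨_, h⟩ | ⟨h, _⟩
  · exact h
  · exact absurd rfl h

theorem CompUpTo.far {k : ℕ} (H : CompUpTo e n k) {a b : Gen e n} {x y : StdMonoid e n}
    (hab : a.rk + 2 ≤ b.rk ∨ b.rk + 2 ≤ a.rk) (hx : mlen x + 1 ≤ k)
    (h : mgen a * x = mgen b * y) : ∃ z, x = mgen b * z ∧ y = mgen a * z := by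
  rcases H a b x y hx h with ⟨rfl, _⟩ | ⟨_, z, hz⟩
  · omega
  · rw [comp_of_far _ hab, comp_of_far _ hab.symm] at hz
    exact ⟨z, hz⟩

theorem CompUpTo.adj {k : ℕ} (H : CompUpTo e n k) {a b : Gen e n} {x y : StdMonoid e n}
    (hab : a.rk + 1 = b.rk ∨ b.rk + 1 = a.rk) (hx : mlen x + 1 ≤ k)
    (h : mgen a * x = mgen b * y) :
    ∃ z, x = mgen b * (mgen a * z) ∧ y = mgen a * (mgen b * z) := by
  rcases H a b x y hx h with ⟨rfl, _⟩ | ⟨_, z, hz⟩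
  · omega
  · rw [comp_of_adj _ hab, comp_of_adj _ hab.symm, mul_assoc, mul_assoc] at hz
    exact ⟨z, hz⟩

theorem CompUpTo.level {k : ℕ} (H : CompUpTo e n k) {a b : Gen e n} {x y : StdMonoid e n}
    (hab : a.rk = b.rk) (hne : a ≠ b) (hx : mlen x + 1 ≤ k)
    (h : mgen a * x = mgen b * y) :
    ∃ z, x = mgen a.shift * z ∧ y = mgen b.shift * z := by
  rcases H a b x y hx h with ⟨h, _⟩ | ⟨_, z, hz⟩
  · exact absurd h hne
  · rw [comp_of_eq _ hab, comp_of_eq _ hab.symm] at hz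
    exact ⟨z, hz⟩

theorem far_mul {a b : Gen e n} (hab : a.rk + 2 ≤ b.rk ∨ b.rk + 2 ≤ a.rk) (x : StdMonoid e n) :
    mgen a * (mgen b * x) = mgen b * (mgen a * x) := by
  rw [← mul_assoc, (satisfies_mgen e n).comm a b hab, mul_assoc]

theorem adj_mul {a b : Gen e n} (hab : a.rk + 1 = b.rk ∨ b.rk + 1 = a.rk) (x : StdMonoid e n) :
    mgen a * (mgen b * (mgen a * x)) = mgen b * (mgen a * (mgen b * x)) := by
  simpa only [mul_assoc] using congrArg (· * x) ((satisfies_mgen e n).braid a b hab)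

theorem level_mul {a b : Gen e n} (hab : a.rk = b.rk) (ha : a.rk = 2) (x : StdMonoid e n) :
    mgen a * (mgen a.shift * x) = mgen b * (mgen b.shift * x) := by
  simpa only [mul_assoc] using congrArg (· * x) ((satisfies_mgen e n).shift a b hab ha)

/-- The cube condition for three generators, for words of bounded length: if `b (b \ a) p` equals
`b (b \ c) q`, then this element is a multiple of the least common multiple of `a` and `c`. -/
def Cube (k : ℕ) (a b c : Gen e n) : Prop :=
  ∀ p q : StdMonoid e n, mlen (comp mgen b a * p) ≤ k → comp mgen b a * p = comp mgen b c * q →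
    ∃ z, comp mgen a b * p = comp mgen a c * z ∧ comp mgen c b * q = comp mgen c a * z

theorem Cube.symm {k : ℕ} {a b c : Gen e n} (h : Cube k a b c) : Cube k c b a := by
  intro p q hk hpq
  obtain ⟨z, h1, h2⟩ := h q p (hpq ▸ hk) hpq.symm
  exact ⟨z, h2, h1⟩

/- Each of the following cases computes with two words for the same element, cancelling their common
letters by the inductive hypothesis `CompUpTo`. In the names, the relations between `a` and `b`,
between `b` and `c`, and between `a` and `c` are `far` (commuting), `adj` (braided) or `level` (both
among the `t_i`); a relation that is missing is arbitrary or determined by the others. -/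

theorem cube_far_far {k : ℕ} (H : CompUpTo e n k) {a b c : Gen e n} (hac : a ≠ c)
    (hab : a.rk + 2 ≤ b.rk ∨ b.rk + 2 ≤ a.rk) (hbc : b.rk + 2 ≤ c.rk ∨ c.rk + 2 ≤ b.rk) :
    Cube k a b c := by
  intro p q hk hpq
  rw [comp_of_far _ hab.symm, comp_of_far _ hbc] at hpq
  rw [comp_of_far _ hab.symm] at hk
  rw [comp_of_far _ hab, comp_of_far _ hbc.symm]
  simp only [mlen_mul, mlen_mgen] at hk
  have hb1 := far_mul hab
  have hb2 := far_mul hbc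
  rcases H a c p q (by omega) hpq with ⟨h, _⟩ | ⟨_, z, rfl, rfl⟩
  · exact absurd h hac
  refine ⟨mgen b * z, ?_, ?_⟩
  · rcases lt_trichotomy a.rk c.rk with h | h | h
    · by_cases h1 : a.rk + 1 = c.rk
      · rw [comp_of_adj _ (.inl h1)]; simp only [mul_assoc]; grind
      · rw [comp_of_far _ (by omega)]; grind
    · rw [comp_of_eq _ h, far_mul (by simpa using hab.symm)]
    · by_cases h1 : c.rk + 1 = a.rk
      · rw [comp_of_adj _ (.inr h1)]; simp only [mul_assoc]; grind
      · rw [comp_of_far _ (by omega)]; grind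
  · rcases lt_trichotomy a.rk c.rk with h | h | h
    · by_cases h1 : a.rk + 1 = c.rk
      · rw [comp_of_adj _ (.inr h1)]; simp only [mul_assoc]; grind
      · rw [comp_of_far _ (by omega)]; grind
    · rw [comp_of_eq _ h.symm, far_mul (by simpa using hbc)]
    · by_cases h1 : c.rk + 1 = a.rk
      · rw [comp_of_adj _ (.inl h1)]; simp only [mul_assoc]; grind
      · rw [comp_of_far _ (by omega)]; grind

theorem cube_far_adj_far {k : ℕ} (H : CompUpTo e n k) {a b c : Gen e n}
    (hab : a.rk + 2 ≤ b.rk ∨ b.rk + 2 ≤ a.rk) (hbc : b.rk + 1 = c.rk ∨ c.rk + 1 = b.rk)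
    (hac : a.rk + 2 ≤ c.rk ∨ c.rk + 2 ≤ a.rk) : Cube k a b c := by
  intro p q hk hpq
  rw [comp_of_far _ hab.symm, comp_of_adj _ hbc, mul_assoc] at hpq
  rw [comp_of_far _ hab.symm] at hk
  rw [comp_of_far _ hab, comp_of_far _ hac, comp_of_far _ hac.symm, comp_of_adj _ hbc.symm]
  simp only [mlen_mul, mlen_mgen] at hk
  have h1 := far_mul hab
  have h2 := adj_mul hbc
  have h3 := far_mul hac
  obtain ⟨u, rfl, hu⟩ := H.far hac (by omega) hpq
  simp only [mlen_mul, mlen_mgen] at hk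
  obtain ⟨v, rfl, rfl⟩ := H.far hab (by omega) hu.symm
  exact ⟨mgen b * (mgen c * v), by grind, by simp only [mul_assoc]; grind⟩

theorem cube_far_adj_adj {k : ℕ} (H : CompUpTo e n k) {a b c : Gen e n}
    (hab : a.rk + 2 ≤ b.rk ∨ b.rk + 2 ≤ a.rk) (hbc : b.rk + 1 = c.rk ∨ c.rk + 1 = b.rk)
    (hac : a.rk + 1 = c.rk ∨ c.rk + 1 = a.rk) : Cube k a b c := by
  intro p q hk hpq
  rw [comp_of_far _ hab.symm, comp_of_adj _ hbc, mul_assoc] at hpq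
  rw [comp_of_far _ hab.symm] at hk
  rw [comp_of_far _ hab, comp_of_adj _ hac, comp_of_adj _ hac.symm, comp_of_adj _ hbc.symm]
  simp only [mlen_mul, mlen_mgen] at hk
  have h1 := far_mul hab
  have h2 := adj_mul hbc
  have h3 := adj_mul hac
  obtain ⟨u, rfl, hu⟩ := H.adj hac (by omega) hpq
  simp only [mlen_mul, mlen_mgen] at hk
  obtain ⟨v, hv, rfl⟩ := H.far hab (by simp; omega) hu.symm
  have hl := congrArg mlen hv
  simp only [mlen_mul, mlen_mgen] at hl
  obtain ⟨x, rfl, rfl⟩ := H.adj hbc.symm (by omega) hv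
  exact ⟨mgen b * (mgen c * (mgen a * x)), by simp only [mul_assoc]; grind,
    by simp only [mul_assoc]; grind⟩

theorem cube_adj_adj_far {k : ℕ} (H : CompUpTo e n k) {a b c : Gen e n}
    (hab : a.rk + 1 = b.rk ∨ b.rk + 1 = a.rk) (hbc : b.rk + 1 = c.rk ∨ c.rk + 1 = b.rk)
    (hac : a.rk + 2 ≤ c.rk ∨ c.rk + 2 ≤ a.rk) : Cube k a b c := by
  intro p q hk hpq
  rw [comp_of_adj _ hab.symm, comp_of_adj _ hbc, mul_assoc, mul_assoc] at hpq
  rw [comp_of_adj _ hab.symm] at hk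
  rw [comp_of_adj _ hab, comp_of_far _ hac, comp_of_far _ hac.symm, comp_of_adj _ hbc.symm]
  simp only [mlen_mul, mlen_mgen] at hk
  have h1 := adj_mul hab
  have h2 := adj_mul hbc
  have h3 := far_mul hac
  obtain ⟨u, hu, hu'⟩ := H.far hac (by simp; omega) hpq
  have hl := congrArg mlen hu
  simp only [mlen_mul, mlen_mgen] at hl
  obtain ⟨v, rfl, rfl⟩ := H.adj hbc (by omega) hu
  have hl' := congrArg mlen hu'
  simp only [mlen_mul, mlen_mgen] at hl hl' hk
  obtain ⟨x, rfl, hx⟩ := H.adj hab.symm (by omega) hu'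
  have hx' := H.cancel (by simp; omega) hx
  simp only [mlen_mul, mlen_mgen] at hl hl' hk
  obtain ⟨y, rfl, rfl⟩ := H.far hac.symm (by omega) hx'
  exact ⟨mgen b * (mgen c * (mgen a * (mgen b * y))), by simp only [mul_assoc]; grind,
    by simp only [mul_assoc]; grind⟩

theorem cube_adj_adj_level {k : ℕ} (H : CompUpTo e n k) {a b c : Gen e n} (hne : a ≠ c)
    (hab : a.rk + 1 = b.rk ∨ b.rk + 1 = a.rk) (hac : a.rk = c.rk) : Cube k a b c := by
  have ha := Gen.rk_eq_two_of_ne hne hac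
  have hbc : b.rk + 1 = c.rk ∨ c.rk + 1 = b.rk := by omega
  intro p q hk hpq
  rw [comp_of_adj _ hab.symm, comp_of_adj _ hbc, mul_assoc, mul_assoc] at hpq
  rw [comp_of_adj _ hab.symm] at hk
  rw [comp_of_adj _ hab, comp_of_eq _ hac, comp_of_eq _ hac.symm, comp_of_adj _ hbc.symm]
  simp only [mlen_mul, mlen_mgen] at hk
  have hs1 : a.shift.rk + 1 = b.rk ∨ b.rk + 1 = a.shift.rk := by simpa using hab
  have hs2 : c.shift.rk + 1 = b.rk ∨ b.rk + 1 = c.shift.rk := by simpa using hbc.symm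
  have hs3 : a.shift.shift.rk + 1 = b.rk ∨ b.rk + 1 = a.shift.shift.rk := by simpa using hab
  have hs4 : c.shift.shift.rk + 1 = b.rk ∨ b.rk + 1 = c.shift.shift.rk := by simpa using hbc.symm
  obtain ⟨u, hu, hu'⟩ := H.level hac hne (by simp; omega) hpq
  have hl := congrArg mlen hu
  have hl' := congrArg mlen hu'
  simp only [mlen_mul, mlen_mgen] at hl hl'
  obtain ⟨v, rfl, rfl⟩ := H.adj hs1.symm (by omega) hu
  simp only [mlen_mul, mlen_mgen] at hl hl' hk
  obtain ⟨x, rfl, hx⟩ := H.adj hs2.symm (by omega) hu'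
  have hx' := H.cancel (by simp; omega) hx
  simp only [mlen_mul, mlen_mgen] at hl hl' hk
  obtain ⟨y, rfl, rfl⟩ := H.level (by simpa using hac) (Gen.shift_injective.ne hne) (by omega) hx'
  have e1 := level_mul hac ha
  have e2 := fun x => level_mul (a := a) (b := a.shift) (by simp) ha x
  have e3 := fun x => level_mul (a := c) (b := c.shift) (by simp) (by omega) x
  have e4 := adj_mul hs1
  have e5 := adj_mul hs2
  have e6 := adj_mul hs3
  have e7 := adj_mul hs4
  refine ⟨mgen b * (mgen a * (mgen a.shift * (mgen b * y))), ?_, ?_⟩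
  · simp only [mul_assoc]
    rw [e2, e6, ← e4, ← e2]
  · simp only [mul_assoc]
    rw [e3, e7, ← e5, ← e3, e1]

theorem cube_level_level {k : ℕ} (H : CompUpTo e n k) {a b c : Gen e n}
    (hab : a.rk = b.rk) (hac : a.rk = c.rk) : Cube k a b c := by
  intro p q hk hpq
  rw [comp_of_eq _ hab.symm, comp_of_eq _ (hab.symm.trans hac)] at hpq
  rw [comp_of_eq _ hab.symm] at hk
  rw [comp_of_eq _ hab, comp_of_eq _ hac, comp_of_eq _ hac.symm, comp_of_eq _ (hac.symm.trans hab)]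
  simp only [mlen_mul, mlen_mgen] at hk
  obtain rfl := H.cancel (by omega) hpq
  exact ⟨p, rfl, rfl⟩

theorem cube_level_far {k : ℕ} (H : CompUpTo e n k) {a b c : Gen e n} (hne : a ≠ b)
    (hab : a.rk = b.rk) (hac : a.rk + 2 ≤ c.rk ∨ c.rk + 2 ≤ a.rk) : Cube k a b c := by
  have hbc : b.rk + 2 ≤ c.rk ∨ c.rk + 2 ≤ b.rk := by omega
  have hb := Gen.rk_eq_two_of_ne hne hab
  intro p q hk hpq
  rw [comp_of_eq _ hab.symm, comp_of_far _ hbc] at hpq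
  rw [comp_of_eq _ hab.symm] at hk
  rw [comp_of_eq _ hab, comp_of_far _ hac, comp_of_far _ hac.symm, comp_of_far _ hbc.symm]
  simp only [mlen_mul, mlen_mgen] at hk
  obtain ⟨u, rfl, rfl⟩ := H.far (by simpa using hbc) (by omega) hpq
  exact ⟨mgen a.shift * u, far_mul (by simpa using hac) u, (level_mul hab hb u).symm⟩

theorem cube_level_adj {k : ℕ} (H : CompUpTo e n k) {a b c : Gen e n} (hne : a ≠ b)
    (hab : a.rk = b.rk) (hac : a.rk + 1 = c.rk ∨ c.rk + 1 = a.rk) : Cube k a b c := by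
  have hbc : b.rk + 1 = c.rk ∨ c.rk + 1 = b.rk := by omega
  have ha := Gen.rk_eq_two_of_ne hne hab
  intro p q hk hpq
  rw [comp_of_eq _ hab.symm, comp_of_adj _ hbc, mul_assoc] at hpq
  rw [comp_of_eq _ hab.symm] at hk
  rw [comp_of_eq _ hab, comp_of_adj _ hac, comp_of_adj _ hac.symm, comp_of_adj _ hbc.symm]
  simp only [mlen_mul, mlen_mgen] at hk
  have hs : b.shift ≠ b := Gen.shift_ne hne.symm hab.symm
  have hb1 : b.shift.rk + 1 = c.rk ∨ c.rk + 1 = b.shift.rk := by simpa using hbc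
  have hb2 : b.shift.shift.rk + 1 = c.rk ∨ c.rk + 1 = b.shift.shift.rk := by simpa using hbc
  have ha1 : a.shift.rk + 1 = c.rk ∨ c.rk + 1 = a.shift.rk := by simpa using hac
  have ha2 : a.shift.shift.rk + 1 = c.rk ∨ c.rk + 1 = a.shift.shift.rk := by simpa using hac
  have hl := congrArg mlen hpq
  simp only [mlen_mul, mlen_mgen] at hl
  obtain ⟨u, rfl, hu⟩ := H.adj hb1 (by omega) hpq
  have hl' := congrArg mlen hu
  simp only [mlen_mul, mlen_mgen] at hl hl' hk
  obtain ⟨v, rfl, hv⟩ := H.level (by simp) hs.symm (by omega) hu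
  have hl'' := congrArg mlen hv
  simp only [mlen_mul, mlen_mgen] at hl hl' hl'' hk
  obtain ⟨x, rfl, rfl⟩ := H.adj hb2.symm (by omega) hv
  have e1 := level_mul hab ha
  have e2 := fun x => level_mul (a := a) (b := a.shift) (by simp) ha x
  have e3 := fun x => level_mul (a := b) (b := b.shift) (by simp) (by omega) x
  have e4 := adj_mul hb1
  have e5 := adj_mul hb2
  have e6 := adj_mul ha1
  have e7 := adj_mul ha2
  refine ⟨mgen a.shift * (mgen c * (mgen a.shift.shift * x)), ?_, ?_⟩
  · simp only [mul_assoc]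
    rw [← e3, ← e1, e2, e6, e2, e7]
  · simp only [mul_assoc]
    rw [← e4, ← e6, ← e3, ← e1, ← e1, ← e2]

/-- The cube condition holds for any three distinct generators. -/
theorem cube {k : ℕ} (H : CompUpTo e n k) {a b c : Gen e n} (hab : a ≠ b) (hbc : b ≠ c)
    (hac : a ≠ c) : Cube k a b c := by
  by_cases h1 : a.rk = b.rk
  · by_cases h2 : a.rk = c.rk
    · exact cube_level_level H h1 h2
    · by_cases h3 : a.rk + 1 = c.rk ∨ c.rk + 1 = a.rk
      · exact cube_level_adj H hab h1 h3
      · exact cube_level_far H hab h1 (by omega)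
  by_cases h2 : b.rk = c.rk
  · by_cases h3 : a.rk + 1 = c.rk ∨ c.rk + 1 = a.rk
    · exact (cube_level_adj H hbc.symm h2.symm (by omega)).symm
    · exact (cube_level_far H hbc.symm h2.symm (by omega)).symm
  by_cases h3 : a.rk + 1 = b.rk ∨ b.rk + 1 = a.rk
  · by_cases h4 : b.rk + 1 = c.rk ∨ c.rk + 1 = b.rk
    · by_cases h5 : a.rk = c.rk
      · exact cube_adj_adj_level H hac h3 h5
      · exact cube_adj_adj_far H h3 h4 (by omega)
    · by_cases h5 : a.rk + 1 = c.rk ∨ c.rk + 1 = a.rk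
      · exact (cube_far_adj_adj H (by omega) (by omega) (by omega)).symm
      · have := Gen.rk_eq_two_of_ne hac
        exact (cube_far_adj_far H (by omega) (by omega) (by omega)).symm
  · by_cases h4 : b.rk + 1 = c.rk ∨ c.rk + 1 = b.rk
    · by_cases h5 : a.rk + 1 = c.rk ∨ c.rk + 1 = a.rk
      · exact cube_far_adj_adj H (by omega) h4 h5
      · exact cube_far_adj_far H (by omega) h4 (by omega)
    · exact cube_far_far H hac (by omega) (by omega)

/-- The relation `CompRel` is transitive by the cube condition, and by cancellation if the outer two
letters agree. -/
theorem CompRel.trans {k : ℕ} (H : CompUpTo e n k) {a b c : Gen e n} {x y z : StdMonoid e n}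
    (hy : mlen y ≤ k) (h1 : CompRel a x b y) (h2 : CompRel b y c z) : CompRel a x c z := by
  rcases h1 with ⟨rfl, rfl⟩ | ⟨hab, p, rfl, rfl⟩
  · exact h2
  rcases h2 with ⟨rfl, rfl⟩ | ⟨hbc, q, hpq, rfl⟩
  · exact .inr ⟨hab, p, rfl, rfl⟩
  by_cases hac : a = c
  · subst hac
    refine .inl ⟨rfl, ?_⟩
    suffices p = q by rw [this]
    have key : ∀ (d : Gen e n) (u v : StdMonoid e n), mlen u + 1 ≤ k →
        mgen d * u = mgen d * v → u = v := fun d u v hu h => H.cancel hu h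
    unfold comp at hpq hy
    split_ifs at hpq hy
    · exact key _ _ _ (by simp at hy; omega) hpq
    · rw [mul_assoc, mul_assoc] at hpq
      simp at hy
      exact key _ _ _ (by omega) (key _ _ _ (by simp; omega) hpq)
    · exact key _ _ _ (by simp at hy; omega) hpq
  · exact .inr ⟨hac, cube H hab hbc hac p q hy hpq⟩

/-- The relation `CompRel` on words, by their first letters. -/
def WordRel (u v : List (Gen e n)) : Prop :=
  (u = [] ∧ v = []) ∨ ∃ a x b y, u = a :: x ∧ v = b :: y ∧
    CompRel a (PresentedMonoid.mk _ (FreeMonoid.ofList x)) b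
      (PresentedMonoid.mk _ (FreeMonoid.ofList y))

theorem compUpTo (e n k : ℕ) : CompUpTo e n k := by
  induction k with
  | zero => intro a b x y hx; omega
  | succ k H =>
    have mlen_mk : ∀ u : FreeMonoid (Gen e n),
        mlen (PresentedMonoid.mk (Rel e n) u) = u.length := by
      intro u
      induction u using FreeMonoid.inductionOn' with
      | one => simp
      | of_mul a x ih =>
        rw [map_mul, mlen_mul, ih, FreeMonoid.length_mul]
        exact congrArg (· + _) (mlen_mgen a)
    have hcomp : ∀ a b : Gen e n,
        PresentedMonoid.mk (Rel e n) (comp w a b) = comp mgen a b := by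
      intro a b
      unfold comp
      split_ifs
      · rfl
      · rw [map_mul]; rfl
      · rfl
    -- The statement for words of length at most `k + 1`, by induction on the derivation of `u = v`
    -- from the defining relations; transitivity is the cube condition.
    have main : ∀ u v : FreeMonoid (Gen e n), ConGen.Rel (Rel e n) u v → u.length ≤ k + 1 →
        WordRel u.toList v.toList := by
      intro u v huv
      induction huv with
      | of u v h =>
        intro _
        obtain ⟨a, b, rfl, rfl⟩ := h.exists_comp
        refine .inr ⟨a, (comp w a b).toList, b, (comp w b a).toList, rfl, rfl, ?_⟩
        simp only [FreeMonoid.ofList_toList, hcomp]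
        by_cases hab : a = b
        · subst hab; exact .inl ⟨rfl, rfl⟩
        · exact .inr ⟨hab, 1, by simp, by simp⟩
      | refl u =>
        intro _
        cases hu : u.toList with
        | nil => exact .inl ⟨rfl, rfl⟩
        | cons a x => exact .inr ⟨a, x, a, x, rfl, rfl, .inl ⟨rfl, rfl⟩⟩
      | @symm u v h ih =>
        intro hl
        have hlen : u.length = v.length := by
          rw [← mlen_mk, ← mlen_mk, PresentedMonoid.mk_eq_mk_iff.2 h]
        rcases ih (by omega) with ⟨h1, h2⟩ | ⟨a, x, b, y, h1, h2, h3⟩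
        · exact .inl ⟨h2, h1⟩
        · exact .inr ⟨b, y, a, x, h2, h1, h3.symm⟩
      | @trans u v t h h' ih ih' =>
        intro hl
        have hlen : u.length = v.length := by
          rw [← mlen_mk, ← mlen_mk, PresentedMonoid.mk_eq_mk_iff.2 h]
        rcases ih hl with ⟨h1, h2⟩ | ⟨a, x, b, y, h1, h2, h3⟩
        · rcases ih' (by omega) with ⟨h4, h5⟩ | ⟨a', x', b', y', h4, h5, h6⟩
          · exact .inl ⟨h1, h5⟩
          · rw [h2] at h4; cases h4
        · rcases ih' (by omega) with ⟨h4, h5⟩ | ⟨a', x', b', y', h4, h5, h6⟩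
          · rw [h2] at h4; cases h4
          · rw [h2] at h4
            cases h4
            refine .inr ⟨a, x, b', y', h1, h5, h3.trans H ?_ h6⟩
            rw [mlen_mk]
            have : v.length = y.length + 1 := by
              change v.toList.length = _
              rw [h2]; rfl
            change y.length ≤ k
            omega
      | @mul u v u' v' h h' ih ih' =>
        intro hl
        rw [FreeMonoid.length_mul] at hl
        rcases ih (by omega) with ⟨h1, h2⟩ | ⟨a, x, b, y, h1, h2, h3⟩
        · have e1 : u = 1 := h1
          have e2 : v = 1 := h2
          subst e1 e2
          simpa using ih' (by omega)
        · refine .inr ⟨a, x ++ u'.toList, b, y ++ v'.toList, by simp [h1], by simp [h2], ?_⟩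
          have e1 : PresentedMonoid.mk (Rel e n) u' = PresentedMonoid.mk (Rel e n) v' :=
            PresentedMonoid.mk_eq_mk_iff.2 h'
          simp only [FreeMonoid.ofList_append, FreeMonoid.ofList_toList, map_mul, e1]
          exact h3.mul_right _
    intro a b x y hx h
    induction x using PresentedMonoid.inductionOn with
    | h x =>
      induction y using PresentedMonoid.inductionOn with
      | h y =>
        have h' : PresentedMonoid.mk (Rel e n) (w a * x) =
            PresentedMonoid.mk (Rel e n) (w b * y) := by
          rw [map_mul, map_mul]; exact h
        rw [mlen_mk] at hx
        rcases main _ _ (PresentedMonoid.mk_eq_mk_iff.1 h') (by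
          rw [FreeMonoid.length_mul]; simp [w]; omega) with ⟨h1, _⟩ | ⟨a', x', b', y', h1, h2, h3⟩
        · cases h1
        · cases h1; cases h2; exact h3

/-- Two generators that begin the same element do so through their complements: the least common
multiple of two generators is the one given by the defining relation between them. -/
theorem compRel_of_eq {a b : Gen e n} {x y : StdMonoid e n} (h : mgen a * x = mgen b * y) :
    CompRel a x b y := compUpTo e n (mlen x + 1) a b x y le_rfl h

theorem mgen_mul_left_cancel {a : Gen e n} {x y : StdMonoid e n} (h : mgen a * x = mgen a * y) :
    x = y := (compUpTo e n (mlen x + 1)).cancel le_rfl h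

theorem mul_left_cancel_std {x y z : StdMonoid e n} (h : x * y = x * z) : y = z := by
  induction hk : mlen x generalizing x with
  | zero => rw [eq_one_of_mlen hk] at h; simpa using h
  | succ k ih =>
    obtain ⟨a, x', rfl⟩ := exists_mgen_mul_of_mlen (by omega : mlen x ≠ 0)
    rw [mul_assoc, mul_assoc] at h
    exact ih (mgen_mul_left_cancel h) (by simp at hk; omega)

theorem mgen_injective : Function.Injective (mgen (e := e) (n := n)) := by
  intro a b h
  rcases compRel_of_eq (show mgen a * 1 = mgen b * 1 by simpa using h) with ⟨h, _⟩ | ⟨_, z, hz, _⟩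
  · exact h
  · exfalso
    have := congrArg mlen hz
    unfold comp at this
    split_ifs at this <;> simp at this <;> omega

/-- Two elements with a common right multiple have a least one, which is written in the same
closed set of letters as the two elements. -/
theorem exists_lcm_of_common {X : Set (Gen e n)} (hX : IsClosed X) {x y m : StdMonoid e n}
    (hxX : x ∈ Submonoid.closure (mgen '' X)) (hyX : y ∈ Submonoid.closure (mgen '' X))
    (hx : x ∣ m) (hy : y ∣ m) :
    ∃ l ∈ Submonoid.closure (mgen '' X), x ∣ l ∧ y ∣ l ∧ ∀ m', x ∣ m' → y ∣ m' → l ∣ m' := by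
  induction hk : mlen m using Nat.strong_induction_on generalizing x y m with
  | _ k ih =>
    rcases exists_mgen_mul x with rfl | ⟨a, x1, rfl⟩
    · exact ⟨y, hyX, one_dvd _, dvd_rfl, fun m' _ h => h⟩
    rcases exists_mgen_mul y with rfl | ⟨b, y1, rfl⟩
    · exact ⟨_, hxX, dvd_rfl, one_dvd _, fun m' h _ => h⟩
    obtain ⟨haX, hx1X⟩ := mem_closure_mgen_of_mul hX hxX
    obtain ⟨hbX, hy1X⟩ := mem_closure_mgen_of_mul hX hyX
    obtain ⟨p, hp⟩ := hx
    obtain ⟨q, hq⟩ := hy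
    rw [mul_assoc] at hp hq
    have hpq := hp.symm.trans hq
    by_cases hab : a = b
    · subst hab
      have h1 := mgen_mul_left_cancel hpq
      obtain ⟨l, hlX, hl1, hl2, hl3⟩ := ih (mlen (x1 * p)) (by rw [← hk, hp]; simp)
        hx1X hy1X (Dvd.intro p rfl) (Dvd.intro q h1.symm) rfl
      refine ⟨mgen a * l, mul_mem haX hlX, mul_dvd_mul_left _ hl1, mul_dvd_mul_left _ hl2, ?_⟩
      rintro m' ⟨u, rfl⟩ ⟨v, hv⟩
      rw [mul_assoc, mul_assoc] at hv
      rw [mul_assoc]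
      exact mul_dvd_mul_left _ (hl3 _ (Dvd.intro u rfl)
        (Dvd.intro v (mgen_mul_left_cancel hv).symm))
    · rcases compRel_of_eq hpq with ⟨h, _⟩ | ⟨_, z, h1, h2⟩
      · exact absurd h hab
      have haX' := mem_of_mgen_mem hX haX
      have hbX' := mem_of_mgen_mem hX hbX
      obtain ⟨l, hlX, hl1, ⟨c, rfl⟩, hl3⟩ := ih (mlen (x1 * p)) (by rw [← hk, hp]; simp)
        hx1X (hX.comp_mem _ haX' hbX' hab) (Dvd.intro p rfl) (Dvd.intro z h1.symm) rfl
      have hc : ∀ u, comp mgen a b * c ∣ comp mgen a b * u → c ∣ u := by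
        rintro u ⟨v, hv⟩
        rw [mul_assoc] at hv
        exact ⟨v, mul_left_cancel_std hv⟩
      obtain ⟨l', hlX', hl1', hl2', hl3'⟩ := ih (mlen (y1 * q)) (by rw [← hk, hq]; simp)
        (x := comp mgen b a * c) (y := y1)
        (mul_mem (hX.comp_mem _ hbX' haX' (Ne.symm hab)) (mem_closure_mgen_of_mul hX hlX).2) hy1X
        (by rw [h2]; exact mul_dvd_mul_left _ (hc _ (hl3 _ (Dvd.intro p h1)
          (Dvd.intro _ rfl)))) (Dvd.intro q rfl) rfl
      have hg := (satisfies_mgen e n).mul_comp hab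
      refine ⟨mgen b * l', mul_mem hbX hlX', ?_, mul_dvd_mul_left _ hl2', ?_⟩
      · calc mgen a * x1 ∣ mgen a * (comp mgen a b * c) := mul_dvd_mul_left _ hl1
          _ = mgen b * (comp mgen b a * c) := by rw [← mul_assoc, hg, mul_assoc]
          _ ∣ _ := mul_dvd_mul_left _ hl1'
      · rintro m' ⟨u, rfl⟩ ⟨v, hv⟩
        rw [mul_assoc, mul_assoc] at hv
        rcases compRel_of_eq hv with ⟨h, _⟩ | ⟨_, z', h1', h2'⟩
        · exact absurd h hab
        rw [mul_assoc, hv]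
        refine mul_dvd_mul_left _ (hl3' _ ?_ (Dvd.intro v rfl))
        rw [h2']
        exact mul_dvd_mul_left _ (hc _ (hl3 _ (Dvd.intro u h1') (Dvd.intro _ rfl)))

end CorranPicantin

namespace CorranPicantin

variable {e n : ℕ}

/-! ### A common multiple of the generators -/

section factors

variable {N : Type*} [Monoid N] (g : Gen e n → N)

/-- The image of `s_k`, and `1` for `k` out of range. -/
def sGen (k : ℕ) : N := if h : 3 ≤ k ∧ k ≤ n then g (.s k h.1 h.2) else 1

/-- The factor `s_k ⋯ s_3 t_0` (for `e = 1`) or `s_k ⋯ s_3 t_0 t_1 s_3 ⋯ s_k` (for `e ≥ 2`) of the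
Garside element with index `k + 2`. -/
def factor : ℕ → N
  | 0 => if e = 1 then g (.t 0) else g (.t 0) * g (.t 1)
  | k + 1 => sGen g (k + 3) * factor k * if e = 1 then 1 else sGen g (k + 3)

/-- The product of the first `k` factors of the Garside element. -/
def partialDelta : ℕ → N
  | 0 => 1
  | k + 1 => partialDelta k * factor g k

variable {g}

theorem sGen_of_mem {k : ℕ} (h3 : 3 ≤ k) (hn : k ≤ n) : sGen g k = g (.s k h3 hn) :=
  dif_pos ⟨h3, hn⟩

theorem Satisfies.t_mul_t (hg : Satisfies g) (i j : ZMod e) :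
    g (.t i) * g (.t (i + 1)) = g (.t j) * g (.t (j + 1)) := hg.shift (.t i) (.t j) rfl rfl

theorem Satisfies.sGen_mul_sGen (hg : Satisfies g) {k l : ℕ} (hkl : k + 2 ≤ l) :
    sGen g l * sGen g k = sGen g k * sGen g l := by
  unfold sGen
  split_ifs
  · exact hg.comm _ _ (by simp; omega)
  all_goals simp

theorem Satisfies.sGen_mul_t (hg : Satisfies g) {k : ℕ} (hk : 4 ≤ k) (i : ZMod e) :
    sGen g k * g (.t i) = g (.t i) * sGen g k := by
  unfold sGen
  split_ifs
  · exact hg.comm _ _ (by simp; omega)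
  · simp

theorem Satisfies.sGen_braid (hg : Satisfies g) {k : ℕ} (h3 : 3 ≤ k) (hn : k + 1 ≤ n) :
    sGen g k * (sGen g (k + 1) * sGen g k) = sGen g (k + 1) * (sGen g k * sGen g (k + 1)) := by
  rw [sGen_of_mem h3 (by omega), sGen_of_mem (by omega) hn]
  exact hg.braid _ _ (by simp)

theorem Satisfies.s3_braid (hg : Satisfies g) (hn : 3 ≤ n) (i : ZMod e) :
    sGen g 3 * (g (.t i) * sGen g 3) = g (.t i) * (sGen g 3 * g (.t i)) := by
  rw [sGen_of_mem le_rfl hn]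
  exact hg.braid _ _ (by simp)

theorem Satisfies.sGen_mul_factor (hg : Satisfies g) {j k : ℕ} (h : j + 4 ≤ k) :
    sGen g k * factor g j = factor g j * sGen g k := by
  induction j with
  | zero =>
    unfold factor
    split_ifs
    · exact hg.sGen_mul_t h _
    · rw [← mul_assoc, hg.sGen_mul_t h, mul_assoc, hg.sGen_mul_t h, mul_assoc]
  | succ j ih =>
    unfold factor
    have h1 := hg.sGen_mul_sGen (k := j + 3) (l := k) (by omega)
    have h2 := ih (by omega)
    split_ifs
    · rw [mul_one, ← mul_assoc, h1, mul_assoc, h2, mul_assoc]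
    · rw [← mul_assoc, ← mul_assoc, h1, mul_assoc (sGen g (j + 3)), h2]
      simp only [mul_assoc, h1]

theorem Satisfies.sGen_mul_partialDelta (hg : Satisfies g) {j k : ℕ} (h : j + 3 ≤ k) :
    sGen g k * partialDelta g j = partialDelta g j * sGen g k := by
  induction j with
  | zero => simp [partialDelta]
  | succ j ih =>
    rw [partialDelta, ← mul_assoc, ih (by omega), mul_assoc, hg.sGen_mul_factor (by omega),
      mul_assoc]

theorem factor_succ_of_one (he : e = 1) (k : ℕ) :
    factor g (k + 1) = sGen g (k + 3) * factor g k := by simp [factor, he]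

theorem factor_succ_of_ne (he : e ≠ 1) (k : ℕ) :
    factor g (k + 1) = sGen g (k + 3) * (factor g k * sGen g (k + 3)) := by
  simp [factor, he, mul_assoc]

/-- The product of two consecutive factors begins with the last generator of the second one. -/
theorem Satisfies.factor_mul_factor (hg : Satisfies g) {k : ℕ} (h : k + 3 ≤ n) :
    ∃ z, factor g k * factor g (k + 1) = sGen g (k + 3) * z := by
  induction k with
  | zero =>
    have hb := hg.s3_braid h
    by_cases he : e = 1
    · refine ⟨g (.t 0) * sGen g 3, ?_⟩
      rw [hb]
      simp [factor, he]
    · refine ⟨g (.t 0) * (g (.t 1) * (sGen g 3 * (g (.t 0) * g (.t 1)))), ?_⟩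
      have hb' : ∀ i x, sGen g 3 * (g (.t i) * (sGen g 3 * x)) =
          g (.t i) * (sGen g 3 * (g (.t i) * x)) := fun i x => by
        simpa only [mul_assoc] using congrArg (· * x) (hb i)
      have ht : ∀ i j x, g (.t i) * (g (.t (i + 1)) * x) = g (.t j) * (g (.t (j + 1)) * x) :=
        fun i j x => by simpa only [mul_assoc] using congrArg (· * x) (hg.t_mul_t i j)
      rw [factor_succ_of_ne he]
      simp only [factor, he, if_false, mul_assoc]
      have h01 := fun x => ht 0 1 x
      simp only [zero_add] at h01
      rw [h01 (sGen g 3), ← hb' 1, hb (1 + 1), ← h01 (sGen g 3 * _), ← hb' 0, hb' 1,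
        hg.t_mul_t 1 0, zero_add]
  | succ k ih =>
    obtain ⟨z, hz⟩ := ih (by omega)
    have hb := hg.sGen_braid (k := k + 3) (by omega) (by omega)
    have hb' : ∀ x, sGen g (k + 3) * (sGen g (k + 4) * (sGen g (k + 3) * x)) =
        sGen g (k + 4) * (sGen g (k + 3) * (sGen g (k + 4) * x)) := fun x => by
      simpa only [mul_assoc] using congrArg (· * x) hb
    have hc : ∀ x, sGen g (k + 4) * (factor g k * x) = factor g k * (sGen g (k + 4) * x) :=
      fun x => by
        rw [← mul_assoc, hg.sGen_mul_factor (by omega), mul_assoc]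
    have hz' : ∀ x, factor g k * (factor g (k + 1) * x) = sGen g (k + 3) * (z * x) := fun x => by
      rw [← mul_assoc, hz, mul_assoc]
    by_cases he : e = 1
    · refine ⟨sGen g (k + 3) * (sGen g (k + 4) * z), ?_⟩
      rw [factor_succ_of_one he (k + 1), ← hb', ← hz, factor_succ_of_one he k, hc, mul_assoc]
    · refine ⟨sGen g (k + 3) * (sGen g (k + 4) * (z * (sGen g (k + 4) * sGen g (k + 3)))), ?_⟩
      rw [factor_succ_of_ne he (k + 1), ← hb', ← hz', factor_succ_of_ne he k]
      simp only [mul_assoc]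
      rw [hb']
      simp only [hc]
      rw [hb]

/-- The last letter `s_{k+2}` divides the product of the last two factors, and commutes with the
factors before these. -/
theorem Satisfies.dvd_partialDelta (hg : Satisfies g) {k : ℕ} (a : Gen e n) (ha : a.rk ≤ k + 2) :
    g a ∣ partialDelta g (k + 1) := by
  induction k with
  | zero =>
    obtain ⟨i, rfl⟩ := Gen.exists_t_of_rk (le_antisymm ha a.two_le_rk)
    unfold partialDelta partialDelta factor
    rw [one_mul]
    split_ifs with he
    · subst he
      rw [Subsingleton.elim i 0]
    · have := hg.t_mul_t 0 i
      rw [zero_add] at this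
      rw [this]
      exact Dvd.intro _ rfl
  | succ k ih =>
    rw [partialDelta]
    by_cases h : a.rk ≤ k + 2
    · exact Dvd.dvd.mul_right (ih h) _
    · cases a with
      | t i => simp at h
      | s l h3 hn =>
        simp only [Gen.rk_s] at h ha
        obtain rfl : l = k + 3 := by omega
        obtain ⟨z, hz⟩ := hg.factor_mul_factor hn
        rw [partialDelta, mul_assoc, hz, ← mul_assoc, ← hg.sGen_mul_partialDelta (by omega),
          mul_assoc, sGen_of_mem h3 hn]
        exact Dvd.intro _ rfl

/-- For `e ≥ 2`, each factor of the Garside element conjugates the `t_i` among themselves. -/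
theorem Satisfies.t_mul_factor (hg : Satisfies g) (he : e ≠ 1) {k : ℕ} (hk : k + 2 ≤ n)
    (i : ZMod e) : ∃ j, g (.t i) * factor g k = factor g k * g (.t j) := by
  rcases k with _ | k
  · refine ⟨i + 1 + 1, ?_⟩
    simp only [factor, he, if_false]
    have h1 := hg.t_mul_t 0 i
    have h2 := hg.t_mul_t 0 (i + 1)
    rw [zero_add] at h1 h2
    rw [h2, ← mul_assoc, ← h1.symm.trans h2, mul_assoc]
  · refine ⟨i + 1, ?_⟩
    induction k with
    | zero =>
      have hb := hg.s3_braid hk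
      have ht := hg.t_mul_t 0 i
      have ht' := hg.t_mul_t i (i + 1)
      rw [zero_add] at ht
      rw [factor_succ_of_ne he]
      simp only [factor, he, if_false]
      rw [ht, mul_assoc]
      calc _ = (g (.t i) * (sGen g 3 * g (.t i))) * (g (.t (i + 1)) * sGen g 3) := by
            simp only [mul_assoc, zero_add]
        _ = sGen g 3 * (g (.t i) * (sGen g 3 * (g (.t (i + 1)) * sGen g 3))) := by
            rw [← hb]; simp only [mul_assoc]
        _ = _ := by rw [hb (i + 1)]; simp only [mul_assoc, zero_add]
    | succ k ih =>
      have hc := hg.sGen_mul_t (k := k + 4) (by omega)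
      rw [factor_succ_of_ne he (k + 1), ← mul_assoc, ← hc, mul_assoc, ← mul_assoc _ _ (sGen g _),
        ih (by omega), mul_assoc, mul_assoc, mul_assoc, hc]

end factors

end CorranPicantin

namespace CorranPicantin

variable {e n : ℕ}

/-! ### Right cancellation -/

/-- The generator `t_{-i}` for `t_i`, and `s_k` for `s_k`. -/
def Gen.neg : Gen e n → Gen e n
  | .t i => .t (-i)
  | .s k h3 hn => .s k h3 hn

theorem Gen.neg_neg (a : Gen e n) : a.neg.neg = a := by cases a <;> simp [Gen.neg]

/-- The anti-automorphism of the standard monoid with `t_i ↦ t_{-i}` and `s_k ↦ s_k`. -/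
def rev (e n : ℕ) : StdMonoid e n →* (StdMonoid e n)ᵐᵒᵖ :=
  PresentedMonoid.lift (fun a => MulOpposite.op (mgen a.neg)) fun u v h => by
    have hs := satisfies_mgen e n
    apply MulOpposite.unop_injective
    cases h with
    | tt i j =>
      have := hs.t_mul_t (-(i + 1)) (-(j + 1))
      simpa [w, Gen.neg] using this
    | s3t hn i => simpa [w, Gen.neg] using hs.braid (.s 3 le_rfl hn) (.t (-i)) (by simp)
    | st k h3 hn h4 i => simpa [w, Gen.neg] using hs.comm (.t (-i)) (.s k h3 hn) (by simp; omega)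
    | braid k h3 hn h3' hn' =>
      simpa [w, Gen.neg] using hs.braid (.s k h3 hn) (.s (k + 1) h3' hn') (by simp)
    | comm k l h3 hn h3' hn' hkl =>
      simpa [w, Gen.neg] using hs.comm (.s l h3' hn') (.s k h3 hn) (by simp; omega)

theorem rev_mgen (a : Gen e n) : rev e n (mgen a) = MulOpposite.op (mgen a.neg) := rfl

theorem rev_rev (x : StdMonoid e n) : (rev e n (rev e n x).unop).unop = x := by
  induction hk : mlen x generalizing x with
  | zero => rw [eq_one_of_mlen hk]; simp
  | succ k ih =>
    obtain ⟨a, y, rfl⟩ := exists_mgen_mul_of_mlen (by omega : mlen x ≠ 0)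
    simp only [map_mul, MulOpposite.unop_mul, rev_mgen, MulOpposite.unop_op, Gen.neg_neg]
    rw [ih y (by simp at hk; omega)]

theorem mul_right_cancel_std {x y z : StdMonoid e n} (h : x * z = y * z) : x = y := by
  have h1 := congrArg (fun x => (rev e n x).unop) h
  simp only [map_mul, MulOpposite.unop_mul] at h1
  have h2 := congrArg (fun x => (rev e n x).unop) (mul_left_cancel_std h1)
  simpa only [rev_rev] using h2

/-! ### The Garside element of the monoid, and the embedding into the braid group -/

theorem finite_gen (he : e ≠ 0) : Finite (Gen e n) := by
  have : NeZero e := ⟨he⟩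
  refine Finite.of_injective (fun a : Gen e n => (match a with
    | .t i => (Sum.inl i : ZMod e ⊕ Fin (n + 1))
    | .s k _ hn => Sum.inr ⟨k, by omega⟩)) ?_
  intro a b h
  cases a <;> cases b <;> simp_all

theorem Gen.rk_le (hn : 2 ≤ n) (a : Gen e n) : a.rk ≤ n := by
  cases a with
  | t i => exact hn
  | s k _ hk => exact hk

theorem mgen_dvd_partialDelta (hn : 2 ≤ n) (a : Gen e n) :
    mgen a ∣ partialDelta (mgen (e := e) (n := n)) (n - 1) := by
  obtain ⟨k, rfl⟩ : ∃ k, n = k + 2 := ⟨n - 2, by omega⟩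
  exact (satisfies_mgen e _).dvd_partialDelta a (a.rk_le hn)

/-- The least common multiple exists because the generators have a common multiple. -/
theorem exists_lcm_mgen (he : e ≠ 0) (hn : 2 ≤ n) : ∃ d : StdMonoid e n,
    (∀ a, mgen a ∣ d) ∧ ∀ m, (∀ a, mgen a ∣ m) → d ∣ m := by
  have := finite_gen (n := n) he
  have := Fintype.ofFinite (Gen e n)
  classical
  suffices H : ∀ S : Finset (Gen e n), ∃ d : StdMonoid e n,
      d ∣ partialDelta mgen (n - 1) ∧ (∀ a ∈ S, mgen a ∣ d) ∧
        ∀ m, (∀ a ∈ S, mgen a ∣ m) → d ∣ m by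
    obtain ⟨d, _, h1, h2⟩ := H Finset.univ
    exact ⟨d, fun a => h1 a (Finset.mem_univ a), fun m hm => h2 m fun a _ => hm a⟩
  intro S
  induction S using Finset.induction_on with
  | empty => exact ⟨1, one_dvd _, by simp, fun m _ => one_dvd _⟩
  | insert a S _ ih =>
    obtain ⟨d, h0, h1, h2⟩ := ih
    obtain ⟨l, _, h3, h4, h5⟩ := exists_lcm_of_common IsClosed.univ (mem_closure_univ _)
      (mem_closure_univ _) (mgen_dvd_partialDelta hn a) h0
    refine ⟨l, h5 _ (mgen_dvd_partialDelta hn a) h0, ?_, ?_⟩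
    · intro b hb
      rcases Finset.mem_insert.1 hb with rfl | hb
      · exact h3
      · exact (h1 b hb).trans h4
    · intro m hm
      exact h5 m (hm a (Finset.mem_insert_self _ _))
        (h2 m fun b hb => hm b (Finset.mem_insert_of_mem hb))

/-- All complements of generators divide the least common multiple `d` of the generators, so
`d` divides `a d` for every generator `a`, and conjugation by `d` permutes the generators. -/
theorem exists_quasi_central (he : e ≠ 0) (hn : 2 ≤ n) : ∃ (d : StdMonoid e n)
    (φ : Equiv.Perm (Gen e n)), (∀ a, mgen a ∣ d) ∧ ∀ a, mgen a * d = d * mgen (φ a) := by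
  have := finite_gen (n := n) he
  obtain ⟨d, h1, h2⟩ := exists_lcm_mgen he hn
  have h3 : ∀ a, ∃ b, mgen a * d = d * mgen b := by
    intro a
    have : d ∣ mgen a * d := by
      refine h2 _ fun b => ?_
      by_cases hab : a = b
      · subst hab; exact Dvd.intro _ rfl
      obtain ⟨p, hp⟩ := h1 a
      obtain ⟨q, hq⟩ := h1 b
      obtain ⟨z, hz1, hz2⟩ : ∃ z, p = comp mgen a b * z ∧ q = comp mgen b a * z := by
        rcases compRel_of_eq (hp.symm.trans hq) with ⟨h, _⟩ | ⟨_, h⟩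
        · exact absurd h hab
        · exact h
      have hc : comp mgen a b ∣ d := by
        rcases eq_or_ne a.rk b.rk with h | h
        · rw [comp_of_eq _ h]; exact h1 _
        by_cases h' : a.rk + 1 = b.rk ∨ b.rk + 1 = a.rk
        · refine ⟨mgen b * z, ?_⟩
          rw [hq, hz2, comp_of_adj _ h', comp_of_adj _ h'.symm]
          simp only [mul_assoc]
        · rw [comp_of_far _ (by omega)]; exact h1 _
      refine Dvd.dvd.trans ?_ (mul_dvd_mul_left (mgen a) hc)
      rw [(satisfies_mgen e n).mul_comp hab]
      exact Dvd.intro _ rfl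
    obtain ⟨x, hx⟩ := this
    have hl := congrArg mlen hx
    simp only [mlen_mul, mlen_mgen] at hl
    obtain ⟨b, y, rfl⟩ := exists_mgen_mul_of_mlen (by omega : mlen x ≠ 0)
    simp only [mlen_mul, mlen_mgen] at hl
    rw [eq_one_of_mlen (by omega : mlen y = 0), mul_one] at hx
    exact ⟨b, hx⟩
  choose φ hφ using h3
  have hinj : Function.Injective φ := by
    intro a b hab
    have := (hφ a).trans ((congrArg (fun c => d * mgen c) hab).trans (hφ b).symm)
    exact mgen_injective (mul_right_cancel_std this)
  exact ⟨d, Equiv.ofBijective φ (Finite.injective_iff_bijective.1 hinj), h1, hφ⟩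

/-- A suitable power of the least common multiple of the generators is central. -/
theorem exists_central (he : e ≠ 0) (hn : 2 ≤ n) : ∃ z : StdMonoid e n,
    (∀ a, mgen a ∣ z) ∧ ∀ x, x * z = z * x := by
  have := finite_gen (n := n) he
  obtain ⟨d, φ, h1, h2⟩ := exists_quasi_central he hn
  have hpow : ∀ k a, mgen a * d ^ k = d ^ k * mgen ((φ ^ k) a) := by
    intro k
    induction k with
    | zero => intro a; simp
    | succ k ih =>
      intro a
      rw [pow_succ, ← mul_assoc, ih, mul_assoc, h2, ← mul_assoc, pow_succ', Equiv.Perm.mul_apply]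
  have hpos : 0 < orderOf φ := orderOf_pos φ
  refine ⟨d ^ orderOf φ, fun a => (h1 a).trans (dvd_pow_self d hpos.ne'), fun x => ?_⟩
  induction hk : mlen x generalizing x with
  | zero => rw [eq_one_of_mlen hk]; simp
  | succ k ih =>
    obtain ⟨a, y, rfl⟩ := exists_mgen_mul_of_mlen (by omega : mlen x ≠ 0)
    rw [mul_assoc, ih y (by simp at hk; omega), ← mul_assoc, hpow, pow_orderOf_eq_one, mul_assoc]
    rfl

@[simp] theorem toBraid_mgen (a : Gen e n) : toBraid e n (mgen a) = gen a := rfl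

/-- The monoid embeds into its localization at a central element divisible by all generators,
in which all generators are invertible, so that this embedding factors through the braid group. -/
theorem toBraid_injective (he : e ≠ 0) (hn : 2 ≤ n) : Function.Injective (toBraid e n) := by
  obtain ⟨z, hz, hc⟩ := exists_central (n := n) he hn
  let S := Submonoid.powers z
  have hS : ∀ (s : S) (r : StdMonoid e n), s * r = r * s := by
    rintro ⟨_, k, rfl⟩ r
    exact (Commute.pow_right (show Commute r z from hc r) k).symm
  let _ : OreLocalization.OreSet S :=
    { ore_right_cancel := fun r1 r2 s h => ⟨s, by rw [hS, hS, h]⟩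
      oreNum := fun r _ => r
      oreDenom := fun _ s => s
      ore_eq := fun r s => hS s r }
  let ι : StdMonoid e n →* OreLocalization S (StdMonoid e n) := OreLocalization.numeratorHom
  have hι : Function.Injective ι := by
    intro x y hxy
    simp only [ι, OreLocalization.numeratorHom_apply] at hxy
    obtain ⟨u, v, h1, h2⟩ := OreLocalization.oreDiv_eq_iff.1 hxy
    simp only [OneMemClass.coe_one, mul_one] at h2
    rw [Submonoid.smul_def, smul_eq_mul, smul_eq_mul] at h1
    rw [h2] at h1
    exact (mul_left_cancel_std h1).symm
  have hu : ∀ a, IsUnit (ι (mgen a)) := by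
    intro a
    obtain ⟨y, hy⟩ := hz a
    have hy' : y * mgen a = z := by
      refine mul_right_cancel_std (z := y) ?_
      rw [mul_assoc, ← hy, hc]
    have hzu : IsUnit (ι z) := OreLocalization.numerator_isUnit (⟨z, 1, pow_one z⟩ : S)
    have h1 : ι (mgen a) * ι y = ι z := by rw [← map_mul, ← hy]
    have h2 : ι y * ι (mgen a) = ι z := by rw [← map_mul, hy']
    rw [isUnit_iff_exists_and_exists]
    obtain ⟨v, hv⟩ := hzu
    refine ⟨⟨ι y * ↑v⁻¹, ?_⟩, ⟨↑v⁻¹ * ι y, ?_⟩⟩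
    · rw [← mul_assoc, h1, ← hv, Units.mul_inv]
    · rw [mul_assoc, h2, ← hv, Units.inv_mul]
  have hcoe : ∀ u : FreeMonoid (Gen e n),
      ((FreeMonoid.lift fun a => (hu a).unit) u : OreLocalization S (StdMonoid e n)) =
        ι (PresentedMonoid.mk _ u) := by
    intro u
    induction u using FreeMonoid.inductionOn' with
    | one => simp
    | of_mul a x ih =>
      rw [map_mul, map_mul, map_mul, Units.val_mul, ih]
      rfl
  let f : Braid e n →* (OreLocalization S (StdMonoid e n))ˣ :=
    PresentedGroup.toGroup (f := fun a => (hu a).unit) (by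
      rintro _ ⟨u, v, huv, rfl⟩
      have key : ∀ x : FreeMonoid (Gen e n), FreeGroup.lift (fun a => (hu a).unit)
          (FreeMonoid.lift FreeGroup.of x) = FreeMonoid.lift (fun a => (hu a).unit) x := by
        intro x
        induction x using FreeMonoid.inductionOn' with
        | one => simp
        | of_mul a x ih => rw [map_mul, map_mul, map_mul, ih]; simp
      rw [map_mul, map_inv, key, key, mul_inv_eq_one]
      apply Units.ext
      rw [hcoe, hcoe, PresentedMonoid.mk_eq_mk_of_rel huv])
  have hf : ∀ x, (f (toBraid e n x) : OreLocalization S (StdMonoid e n)) = ι x := by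
    intro x
    induction hk : mlen x generalizing x with
    | zero => rw [eq_one_of_mlen hk]; simp
    | succ k ih =>
      obtain ⟨a, y, rfl⟩ := exists_mgen_mul_of_mlen (by omega : mlen x ≠ 0)
      rw [map_mul, map_mul, map_mul, Units.val_mul, ih y (by simp at hk; omega)]
      congr 1
      rw [toBraid_mgen]
      have : f (gen a) = (hu a).unit := PresentedGroup.toGroup.of _
      rw [this]; rfl
  intro x y hxy
  exact hι (by rw [← hf, ← hf, hxy])

end CorranPicantin

namespace CorranPicantin

open Garside

/-! ### Prefixes in a group with a submonoid of positive elements -/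

section prefixes

variable {G : Type*} [Group G] {P : Submonoid G} {a b c : G}

theorem isPrefix_refl (a : G) : IsPrefix P a a := by simp [IsPrefix, one_mem]

theorem isPrefix_trans (h : IsPrefix P a b) (h' : IsPrefix P b c) : IsPrefix P a c := by
  have := mul_mem h h'
  unfold IsPrefix
  rwa [mul_assoc, mul_inv_cancel_left] at this

theorem isPrefix_mul_left_iff : IsPrefix P (c * a) (c * b) ↔ IsPrefix P a b := by
  unfold IsPrefix
  rw [mul_inv_rev, mul_assoc, inv_mul_cancel_left]

theorem isPrefix_mul (a : G) (hb : b ∈ P) : IsPrefix P a (a * b) := by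
  simpa [IsPrefix] using hb

theorem isPrefix_iff : IsPrefix P a b ↔ ∃ p ∈ P, b = a * p :=
  ⟨fun h => ⟨_, h, by simp⟩, fun ⟨p, hp, h⟩ => h ▸ isPrefix_mul a hp⟩

theorem mem_of_isPrefix (h : IsPrefix P a b) (ha : a ∈ P) : b ∈ P := by
  obtain ⟨p, hp, rfl⟩ := isPrefix_iff.1 h
  exact mul_mem ha hp

theorem one_isPrefix : IsPrefix P 1 a ↔ a ∈ P := by simp [IsPrefix]

/-- `c` conjugates `x` to a positive element if and only if `c ≼ x c`. -/
theorem conj_mem_iff : c⁻¹ * a * c ∈ P ↔ IsPrefix P c (a * c) := by rw [IsPrefix, mul_assoc]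

theorem inv_isPrefix_inv : IsPrefix P a⁻¹ b⁻¹ ↔ IsSuffix P b a := by
  simp [IsPrefix, IsSuffix]

end prefixes

/-! ### The group with its Garside monoid -/

/-- The properties of the pair `(B, B⁺)` from which all of its Garside theory is derived: a group
`G` with a family `g` of generators satisfying the Corran–Picantin relations, such that in the
monoid `P` that they generate least common multiples exist and, for two generators, are given by
the relations. -/
structure System {e n : ℕ} {G : Type*} [Group G] (P : Submonoid G) (g : Gen e n → G)
    (len : G → ℤ) : Prop where
  finite : Finite (Gen e n)
  satisfies : Satisfies g
  closure_eq : Submonoid.closure (Set.range g) = P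
  closure_group : Subgroup.closure (Set.range g) = ⊤
  len_mul : ∀ x y, len (x * y) = len x + len y
  len_gen : ∀ a, len (g a) = 1
  mem_of_gen_mem : ∀ X : Set (Gen e n), IsClosed X → ∀ a,
    g a ∈ Submonoid.closure (g '' X) → a ∈ X
  mem_of_mul_mem : ∀ X : Set (Gen e n), IsClosed X → ∀ x ∈ P, ∀ y ∈ P,
    x * y ∈ Submonoid.closure (g '' X) →
      x ∈ Submonoid.closure (g '' X) ∧ y ∈ Submonoid.closure (g '' X)
  comp_lcm : ∀ (a b : Gen e n) (m : G), a ≠ b → IsPrefix P (g a) m → IsPrefix P (g b) m →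
    IsPrefix P (g a * comp g a b) m
  join : ∀ X : Set (Gen e n), IsClosed X → ∀ x ∈ Submonoid.closure (g '' X),
    ∀ y ∈ Submonoid.closure (g '' X), ∃ m ∈ Submonoid.closure (g '' X), IsJoin (IsPrefix P) x y m
  central : ∃ z : G, (∀ a, IsPrefix P (g a) z) ∧ ∀ x, x * z = z * x

/-- The least closed set of generators containing `Y`. -/
def cl {e n : ℕ} (Y : Set (Gen e n)) : Set (Gen e n) :=
  {c | c ∈ Y ∨ ∃ a ∈ Y, ∃ b ∈ Y, a ≠ b ∧ a.rk = b.rk ∧ c.rk = a.rk}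

theorem closure_le_group {ι G : Type*} [Group G] (g : ι → G) (Y : Set ι) {x : G}
    (hx : x ∈ Submonoid.closure (g '' Y)) :
    x ∈ Subgroup.closure (g '' Y) :=
  (Submonoid.closure_le (S := (Subgroup.closure (g '' Y)).toSubmonoid)).2
    Subgroup.subset_closure hx

section cl

variable {e n : ℕ} {Y Z : Set (Gen e n)}

theorem subset_cl (Y : Set (Gen e n)) : Y ⊆ cl Y := fun _ h => .inl h

theorem isClosed_cl (Y : Set (Gen e n)) : IsClosed (cl Y) := by
  intro a ha b hb hab hr c hc
  have h2 := Gen.rk_eq_two_of_ne hab hr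
  rcases ha with ha | ⟨x, hx, y, hy, hxy, h1, h3⟩
  · rcases hb with hb | ⟨x, hx, y, hy, hxy, h1, h3⟩
    · exact .inr ⟨a, ha, b, hb, hab, hr, hc⟩
    · exact .inr ⟨x, hx, y, hy, hxy, h1, by omega⟩
  · exact .inr ⟨x, hx, y, hy, hxy, h1, by omega⟩

theorem cl_subset (hZ : IsClosed Z) (h : Y ⊆ Z) : cl Y ⊆ Z := by
  rintro c (hc | ⟨x, hx, y, hy, hxy, h1, h3⟩)
  · exact h hc
  · exact hZ x (h hx) y (h hy) hxy h1 c h3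

theorem IsClosed.cl_eq (hY : IsClosed Y) : cl Y = Y :=
  (cl_subset hY subset_rfl).antisymm (subset_cl Y)

theorem isClosed_singleton (a : Gen e n) : IsClosed {a} := by
  rintro b rfl c rfl h
  exact absurd rfl h

end cl

namespace System

variable {e n : ℕ} {G : Type*} [Group G] {P : Submonoid G} {g : Gen e n → G} {len : G → ℤ}
  (hG : System P g len)
include hG

theorem injective : Function.Injective g := by
  intro a b h
  exact hG.mem_of_gen_mem {b} (isClosed_singleton b) a
    (Submonoid.subset_closure ⟨b, rfl, h.symm⟩)

theorem gen_mem (a : Gen e n) : g a ∈ P :=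
  hG.closure_eq ▸ Submonoid.subset_closure ⟨a, rfl⟩

theorem closure_le (X : Set (Gen e n)) : Submonoid.closure (g '' X) ≤ P :=
  hG.closure_eq ▸ Submonoid.closure_mono (Set.image_subset_range _ _)

theorem closure_univ : Submonoid.closure (g '' Set.univ) = P := by
  rw [Set.image_univ, hG.closure_eq]

theorem len_one : len 1 = 0 := by
  have := hG.len_mul 1 1
  rw [one_mul] at this
  omega

theorem len_inv (x : G) : len x⁻¹ = -len x := by
  have := hG.len_mul x x⁻¹
  rw [mul_inv_cancel, hG.len_one] at this
  omega

theorem exists_gen_mul {x : G} (hx : x ∈ P) : x = 1 ∨ ∃ a, ∃ y ∈ P, x = g a * y := by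
  rw [← hG.closure_eq] at hx
  induction hx using Submonoid.closure_induction_left with
  | one => exact .inl rfl
  | mul_left x hx y hy _ =>
    obtain ⟨a, rfl⟩ := hx
    exact .inr ⟨a, y, hG.closure_eq ▸ hy, rfl⟩

theorem len_nonneg {x : G} (hx : x ∈ P) : 0 ≤ len x := by
  rw [← hG.closure_eq] at hx
  induction hx using Submonoid.closure_induction_left with
  | one => exact hG.len_one.ge
  | mul_left x hx y hy ih =>
    obtain ⟨a, rfl⟩ := hx
    rw [hG.len_mul, hG.len_gen]
    omega

theorem eq_one_of_len {x : G} (hx : x ∈ P) (h : len x ≤ 0) : x = 1 := by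
  rcases hG.exists_gen_mul hx with h' | ⟨a, y, hy, rfl⟩
  · exact h'
  · rw [hG.len_mul, hG.len_gen] at h
    have := hG.len_nonneg hy
    omega

theorem exists_gen_of_len {x : G} (hx : x ∈ P) (h : len x = 1) : ∃ a, x = g a := by
  rcases hG.exists_gen_mul hx with rfl | ⟨a, y, hy, rfl⟩
  · rw [hG.len_one] at h; omega
  · rw [hG.len_mul, hG.len_gen] at h
    exact ⟨a, by rw [hG.eq_one_of_len hy (by omega), mul_one]⟩

theorem exists_gen_isPrefix {x : G} (hx : x ∈ P) (h : x ≠ 1) : ∃ a, IsPrefix P (g a) x := by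
  rcases hG.exists_gen_mul hx with h' | ⟨a, y, hy, rfl⟩
  · exact absurd h' h
  · exact ⟨a, isPrefix_mul _ hy⟩

theorem len_le {x y : G} (h : IsPrefix P x y) : len x ≤ len y := by
  obtain ⟨p, hp, rfl⟩ := isPrefix_iff.1 h
  rw [hG.len_mul]
  have := hG.len_nonneg hp
  omega

theorem eq_of_isPrefix_of_len {x y : G} (h : IsPrefix P x y) (hl : len y ≤ len x) : x = y := by
  obtain ⟨p, hp, rfl⟩ := isPrefix_iff.1 h
  rw [hG.len_mul] at hl
  rw [hG.eq_one_of_len hp (by omega), mul_one]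

theorem antisymm {x y : G} (h : IsPrefix P x y) (h' : IsPrefix P y x) : x = y :=
  hG.eq_of_isPrefix_of_len h (hG.len_le h')

theorem gen_ne_one (a : Gen e n) : g a ≠ 1 := by
  intro h
  have := hG.len_gen a
  rw [h, hG.len_one] at this
  omega

theorem eq_of_gen_isPrefix {a b : Gen e n} (h : IsPrefix P (g a) (g b)) : a = b :=
  hG.injective (hG.eq_of_isPrefix_of_len h (by rw [hG.len_gen, hG.len_gen]))

/-! ### The lattice of prefixes -/

theorem exists_join_of_mem {x y : G} (hx : x ∈ P) (hy : y ∈ P) :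
    ∃ m ∈ P, IsJoin (IsPrefix P) x y m := by
  rw [← hG.closure_univ] at hx hy
  obtain ⟨m, hm, h⟩ := hG.join _ IsClosed.univ x hx y hy
  exact ⟨m, hG.closure_univ ▸ hm, h⟩

/-- Every element becomes positive when multiplied by a suitable central element. -/
theorem exists_central_mul (x : G) : ∃ z ∈ P, (∀ y, y * z = z * y) ∧ z * x ∈ P := by
  obtain ⟨z, hz, hc⟩ := hG.central
  have hx : x ∈ Subgroup.closure (Set.range g) := hG.closure_group ▸ Subgroup.mem_top x
  induction hx using Subgroup.closure_induction_left with
  | one => exact ⟨1, one_mem _, by simp, by simp⟩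
  | mul_left a ha y _ ih =>
    obtain ⟨a, rfl⟩ := ha
    obtain ⟨t, ht, htc, hty⟩ := ih
    exact ⟨t, ht, htc, by rw [← mul_assoc, ← htc, mul_assoc]; exact mul_mem (hG.gen_mem a) hty⟩
  | inv_mul_cancel a ha y _ ih =>
    obtain ⟨a, rfl⟩ := ha
    obtain ⟨t, ht, htc, hty⟩ := ih
    refine ⟨z * t, mul_mem (mem_of_isPrefix (hz a) (hG.gen_mem a)) ht, fun y => ?_, ?_⟩
    · rw [← mul_assoc, hc, mul_assoc, htc, mul_assoc]
    · have h := mul_mem (hz a) hty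
      have h3 : z * t * ((g a)⁻¹ * y) = (g a)⁻¹ * z * (t * y) := by
        rw [hc, mul_assoc, ← mul_assoc t, ← htc (g a)⁻¹]
        simp only [mul_assoc]
      rwa [h3]

theorem exists_join (x y : G) : ∃ m, IsJoin (IsPrefix P) x y m := by
  obtain ⟨z, hz, hzc, hx⟩ := hG.exists_central_mul x
  obtain ⟨t, ht, htc, hy⟩ := hG.exists_central_mul y
  obtain ⟨m, _, h1, h2, h3⟩ := hG.exists_join_of_mem (x := z * t * x) (y := z * t * y)
    (by rw [htc z, mul_assoc]; exact mul_mem ht hx)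
    (by rw [mul_assoc]; exact mul_mem hz hy)
  refine ⟨(z * t)⁻¹ * m, ?_, ?_, fun c hc hc' => ?_⟩
  · rwa [← isPrefix_mul_left_iff (c := z * t), mul_inv_cancel_left]
  · rwa [← isPrefix_mul_left_iff (c := z * t), mul_inv_cancel_left]
  · rw [← isPrefix_mul_left_iff (c := z * t), mul_inv_cancel_left]
    exact h3 _ (isPrefix_mul_left_iff.2 hc) (isPrefix_mul_left_iff.2 hc')

/-- The meet of two positive elements is a common prefix of maximal length. -/
theorem exists_meet_of_mem {x y : G} (hx : x ∈ P) (hy : y ∈ P) :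
    ∃ m ∈ P, IsMeet (IsPrefix P) x y m := by
  have hmax : ∃ m, (m ∈ P ∧ IsPrefix P m x ∧ IsPrefix P m y) ∧
      ∀ m', (m' ∈ P ∧ IsPrefix P m' x ∧ IsPrefix P m' y) → len m' ≤ len m := by
    by_contra! hcon
    have : ∀ k : ℕ, ∃ m, (m ∈ P ∧ IsPrefix P m x ∧ IsPrefix P m y) ∧ (k : ℤ) ≤ len m := by
      intro k
      induction k with
      | zero => exact ⟨1, ⟨one_mem _, one_isPrefix.2 hx, one_isPrefix.2 hy⟩, by
          rw [hG.len_one]; simp⟩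
      | succ k ih =>
        obtain ⟨m, hm, hk⟩ := ih
        obtain ⟨m', hm', hk'⟩ := hcon m hm
        exact ⟨m', hm', by push_cast; omega⟩
    obtain ⟨m, hm, hk⟩ := this ((len x).toNat + 1)
    have := hG.len_le hm.2.1
    have := hG.len_nonneg hx
    push_cast at hk
    omega
  obtain ⟨m, ⟨hm, h1, h2⟩, hmax⟩ := hmax
  refine ⟨m, hm, h1, h2, fun c hcx hcy => ?_⟩
  obtain ⟨j, hj1, hj2, hj3⟩ := hG.exists_join m c
  have := hG.eq_of_isPrefix_of_len hj1
    (hmax j ⟨mem_of_isPrefix hj1 hm, hj3 _ h1 hcx, hj3 _ h2 hcy⟩)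
  rwa [this]

theorem exists_meet (x y : G) : ∃ m, IsMeet (IsPrefix P) x y m := by
  obtain ⟨z, hz, hzc, hx⟩ := hG.exists_central_mul x
  obtain ⟨t, ht, htc, hy⟩ := hG.exists_central_mul y
  obtain ⟨m, _, h1, h2, h3⟩ := hG.exists_meet_of_mem (x := z * t * x) (y := z * t * y)
    (by rw [htc z, mul_assoc]; exact mul_mem ht hx)
    (by rw [mul_assoc]; exact mul_mem hz hy)
  refine ⟨(z * t)⁻¹ * m, ?_, ?_, fun c hc hc' => ?_⟩
  · rwa [← isPrefix_mul_left_iff (c := z * t), mul_inv_cancel_left]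
  · rwa [← isPrefix_mul_left_iff (c := z * t), mul_inv_cancel_left]
  · rw [← isPrefix_mul_left_iff (c := z * t), mul_inv_cancel_left]
    exact h3 _ (isPrefix_mul_left_iff.2 hc) (isPrefix_mul_left_iff.2 hc')

/-! ### Least common multiples of sets of generators -/

theorem exists_isLcm {Y Z : Set (Gen e n)} (hZ : IsClosed Z) (hY : Y ⊆ Z) :
    ∃ d ∈ Submonoid.closure (g '' Z), IsLcm P (g '' Y) d := by
  have := hG.finite
  induction Y, Y.toFinite using Set.Finite.induction_on with
  | empty => exact ⟨1, one_mem _, one_mem _, by simp, fun m hm _ => one_isPrefix.2 hm⟩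
  | @insert a S _ _ ih =>
    obtain ⟨d, hdZ, hd, h1, h2⟩ := ih fun x hx => hY (.inr hx)
    obtain ⟨m, hmZ, h3, h4, h5⟩ := hG.join Z hZ (g a)
      (Submonoid.subset_closure ⟨a, hY (.inl rfl), rfl⟩) d hdZ
    refine ⟨m, hmZ, hG.closure_le Z hmZ, ?_, ?_⟩
    · rintro _ ⟨b, rfl | hb, rfl⟩
      · exact h3
      · exact isPrefix_trans (h1 _ ⟨b, hb, rfl⟩) h4
    · intro c hc hcX
      exact h5 c (hcX _ ⟨a, .inl rfl, rfl⟩) (h2 c hc fun x ⟨b, hb, hx⟩ => hcX x ⟨b, .inr hb, hx⟩)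

theorem isLcm_deltaSet (Y : Set (Gen e n)) : IsLcm P (g '' Y) (deltaSet P (g '' Y)) := by
  obtain ⟨d, _, hd⟩ := hG.exists_isLcm IsClosed.univ (Set.subset_univ Y)
  have h : ∃ d, IsLcm P (g '' Y) d := ⟨d, hd⟩
  rw [deltaSet, dif_pos h]
  exact h.choose_spec

theorem deltaSet_eq {X : Set G} {d : G} (hd : IsLcm P X d) : deltaSet P X = d := by
  have h : ∃ d, IsLcm P X d := ⟨d, hd⟩
  have h' : IsLcm P X (deltaSet P X) := by
    rw [deltaSet, dif_pos h]
    exact h.choose_spec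
  exact hG.antisymm (h'.2.2 d hd.1 hd.2.1) (hd.2.2 _ h'.1 h'.2.1)

theorem delta_mem (Y : Set (Gen e n)) : deltaSet P (g '' Y) ∈ P := (hG.isLcm_deltaSet Y).1

theorem gen_isPrefix_delta {Y : Set (Gen e n)} {a : Gen e n} (ha : a ∈ Y) :
    IsPrefix P (g a) (deltaSet P (g '' Y)) := (hG.isLcm_deltaSet Y).2.1 _ ⟨a, ha, rfl⟩

theorem delta_isPrefix {Y : Set (Gen e n)} {m : G} (hm : m ∈ P)
    (h : ∀ a ∈ Y, IsPrefix P (g a) m) : IsPrefix P (deltaSet P (g '' Y)) m :=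
  (hG.isLcm_deltaSet Y).2.2 m hm (by rintro _ ⟨a, ha, rfl⟩; exact h a ha)

theorem delta_mono {Y Z : Set (Gen e n)} (h : Y ⊆ Z) :
    IsPrefix P (deltaSet P (g '' Y)) (deltaSet P (g '' Z)) :=
  hG.delta_isPrefix (hG.delta_mem Z) fun _ ha => hG.gen_isPrefix_delta (h ha)

theorem delta_mem_closure {Y : Set (Gen e n)} (hY : IsClosed Y) :
    deltaSet P (g '' Y) ∈ Submonoid.closure (g '' Y) := by
  obtain ⟨d, hd, h⟩ := hG.exists_isLcm hY subset_rfl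
  rwa [hG.deltaSet_eq h]

/-- A common multiple of two of the `t_i` is a multiple of all of them. -/
theorem level_isPrefix {a b c : Gen e n} (hab : a ≠ b) (hr : a.rk = b.rk) (hc : c.rk = a.rk)
    {m : G} (ha : IsPrefix P (g a) m) (hb : IsPrefix P (g b) m) :
    IsPrefix P (g c * g c.shift) m := by
  have := hG.comp_lcm a b m hab ha hb
  rwa [comp_of_eq _ hr, hG.satisfies.shift a c hc.symm (Gen.rk_eq_two_of_ne hab hr)] at this

theorem delta_cl (Y : Set (Gen e n)) : deltaSet P (g '' cl Y) = deltaSet P (g '' Y) := by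
  refine hG.antisymm (hG.delta_isPrefix (hG.delta_mem Y) ?_) (hG.delta_mono (subset_cl Y))
  rintro c (hc | ⟨a, ha, b, hb, hab, h1, h2⟩)
  · exact hG.gen_isPrefix_delta hc
  · exact isPrefix_trans (isPrefix_mul _ (hG.gen_mem _))
      (hG.level_isPrefix hab h1 h2 (hG.gen_isPrefix_delta ha) (hG.gen_isPrefix_delta hb))

/-- The complements in a closed set `Y` divide `Δ_Y`. -/
theorem comp_isPrefix {Y : Set (Gen e n)} (hY : IsClosed Y) {a b : Gen e n} (ha : a ∈ Y)
    (hb : b ∈ Y) (hab : a ≠ b) : IsPrefix P (comp g a b) (deltaSet P (g '' Y)) := by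
  rcases eq_or_ne a.rk b.rk with h | h
  · rw [comp_of_eq _ h]
    exact hG.gen_isPrefix_delta (hY.shift_mem ha hb hab h)
  by_cases h' : a.rk + 1 = b.rk ∨ b.rk + 1 = a.rk
  · have := hG.comp_lcm b a _ hab.symm (hG.gen_isPrefix_delta hb) (hG.gen_isPrefix_delta ha)
    rw [comp_of_adj _ h'.symm, ← mul_assoc] at this
    rw [comp_of_adj _ h']
    exact isPrefix_trans (isPrefix_mul _ (hG.gen_mem _)) this
  · rw [comp_of_far _ (by omega)]
    exact hG.gen_isPrefix_delta hb

/-- `Δ_Y` conjugates the generators in a closed set `Y` into `Y`: since all complements of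
generators in `Y` divide `Δ_Y`, so do all elements of `Y` divide `a Δ_Y`. -/
theorem exists_mul_delta {Y : Set (Gen e n)} (hY : IsClosed Y) {a : Gen e n} (ha : a ∈ Y) :
    ∃ b ∈ Y, g a * deltaSet P (g '' Y) = deltaSet P (g '' Y) * g b := by
  have h : IsPrefix P (deltaSet P (g '' Y)) (g a * deltaSet P (g '' Y)) := by
    refine hG.delta_isPrefix (mul_mem (hG.gen_mem a) (hG.delta_mem Y)) fun b hb => ?_
    by_cases hab : a = b
    · subst hab; exact isPrefix_mul _ (hG.delta_mem Y)
    · refine isPrefix_trans ?_ (isPrefix_mul_left_iff.2 (hG.comp_isPrefix hY ha hb hab))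
      rw [hG.satisfies.mul_comp hab]
      exact isPrefix_mul _ (hG.closure_le Y (hY.comp_mem g hb ha (Ne.symm hab)))
  obtain ⟨p, hp, h⟩ := isPrefix_iff.1 h
  have hl := congrArg len h
  rw [hG.len_mul, hG.len_mul, hG.len_gen] at hl
  obtain ⟨b, rfl⟩ := hG.exists_gen_of_len hp (by omega)
  refine ⟨b, hG.mem_of_gen_mem Y hY b ?_, h⟩
  refine (hG.mem_of_mul_mem Y hY _ (hG.delta_mem Y) _ (hG.gen_mem b) ?_).2
  rw [← h]
  exact mul_mem (Submonoid.subset_closure ⟨a, ha, rfl⟩) (hG.delta_mem_closure hY)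

theorem exists_delta_mul {Y : Set (Gen e n)} (hY : IsClosed Y) {b : Gen e n} (hb : b ∈ Y) :
    ∃ a ∈ Y, g a * deltaSet P (g '' Y) = deltaSet P (g '' Y) * g b := by
  have := hG.finite
  choose! φ h1 h2 using fun a (ha : a ∈ Y) => hG.exists_mul_delta hY ha
  have hinj : Set.InjOn φ Y := by
    intro a ha a' ha' h
    have h3 := (h2 a ha).trans ((congrArg (fun c => _ * g c) h).trans (h2 a' ha').symm)
    exact hG.injective (mul_right_cancel h3)
  have himg : φ '' Y = Y := Set.eq_of_subset_of_ncard_le (Set.image_subset_iff.2 h1)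
    (by rw [hinj.ncard_image]) (Set.toFinite Y)
  obtain ⟨a, ha, rfl⟩ := himg.ge hb
  exact ⟨a, ha, h2 a ha⟩

theorem delta_inv_conj_mem {Y : Set (Gen e n)} (hY : IsClosed Y) {x : G}
    (hx : x ∈ Submonoid.closure (g '' Y)) :
    (deltaSet P (g '' Y))⁻¹ * x * deltaSet P (g '' Y) ∈ Submonoid.closure (g '' Y) := by
  induction hx using Submonoid.closure_induction with
  | mem x hx =>
    obtain ⟨a, ha, rfl⟩ := hx
    obtain ⟨b, hb, h⟩ := hG.exists_mul_delta hY ha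
    rw [mul_assoc, h, inv_mul_cancel_left]
    exact Submonoid.subset_closure ⟨b, hb, rfl⟩
  | one => simp [one_mem]
  | mul x y _ _ hx hy => simpa [mul_assoc] using mul_mem hx hy

theorem delta_conj_mem {Y : Set (Gen e n)} (hY : IsClosed Y) {x : G}
    (hx : x ∈ Submonoid.closure (g '' Y)) :
    deltaSet P (g '' Y) * x * (deltaSet P (g '' Y))⁻¹ ∈ Submonoid.closure (g '' Y) := by
  induction hx using Submonoid.closure_induction with
  | mem x hx =>
    obtain ⟨a, ha, rfl⟩ := hx
    obtain ⟨b, hb, h⟩ := hG.exists_delta_mul hY ha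
    rw [← h, mul_inv_cancel_right]
    exact Submonoid.subset_closure ⟨b, hb, rfl⟩
  | one => simp [one_mem]
  | mul x y _ _ hx hy => simpa [mul_assoc] using mul_mem hx hy

theorem mem_closure_of_isPrefix {Y : Set (Gen e n)} (hY : IsClosed Y) {x y : G} (hx : x ∈ P)
    (h : IsPrefix P x y) (hy : y ∈ Submonoid.closure (g '' Y)) :
    x ∈ Submonoid.closure (g '' Y) ∧ x⁻¹ * y ∈ Submonoid.closure (g '' Y) :=
  hG.mem_of_mul_mem Y hY x hx _ h (by simpa using hy)

theorem isBalanced_delta {Y : Set (Gen e n)} (hY : IsClosed Y) :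
    IsBalanced P (deltaSet P (g '' Y)) := by
  refine ⟨hG.delta_mem Y, Set.ext fun x => ⟨fun ⟨hx, h⟩ => ⟨hx, ?_⟩, fun ⟨hx, h⟩ => ⟨hx, ?_⟩⟩⟩
  · have := hG.delta_conj_mem hY (hG.mem_closure_of_isPrefix hY hx h (hG.delta_mem_closure hY)).2
    have := hG.closure_le Y this
    unfold IsSuffix
    simpa [mul_assoc] using this
  · have h1 := (hG.mem_of_mul_mem Y hY _ h x hx (by simpa using hG.delta_mem_closure hY)).1
    have := hG.closure_le Y (hG.delta_inv_conj_mem hY h1)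
    unfold IsPrefix
    simpa [mul_assoc] using this

theorem exists_eq_mul_gen {Y : Set (Gen e n)} (hY : IsClosed Y) {a : Gen e n} (ha : a ∈ Y) :
    ∃ y ∈ P, deltaSet P (g '' Y) = y * g a := by
  have : g a ∈ SuffixDiv P (deltaSet P (g '' Y)) := by
    rw [← (hG.isBalanced_delta hY).2]
    exact ⟨hG.gen_mem a, hG.gen_isPrefix_delta ha⟩
  exact ⟨_, this.2, by simp⟩

/-! ### Standard parabolic subgroups -/

/-- An element of the subgroup generated by a closed set `Y` is a fraction of elements of the
monoid generated by `Y`. -/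
theorem exists_delta_pow_mul_mem {Y : Set (Gen e n)} (hY : IsClosed Y) {x : G}
    (hx : x ∈ Subgroup.closure (g '' Y)) :
    ∃ k : ℕ, deltaSet P (g '' Y) ^ k * x ∈ Submonoid.closure (g '' Y) := by
  have hpow : ∀ (k : ℕ) (x : G), x ∈ Submonoid.closure (g '' Y) →
      deltaSet P (g '' Y) ^ k * x * (deltaSet P (g '' Y) ^ k)⁻¹ ∈
        Submonoid.closure (g '' Y) := by
    intro k
    induction k with
    | zero => intro x hx; simpa using hx
    | succ k ih =>
      intro x hx
      have := ih _ (hG.delta_conj_mem hY hx)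
      rw [pow_succ]
      simpa [mul_assoc] using this
  induction hx using Subgroup.closure_induction_left with
  | one => exact ⟨0, by simp [one_mem]⟩
  | mul_left a ha y _ ih =>
    obtain ⟨k, hk⟩ := ih
    refine ⟨k, ?_⟩
    have := mul_mem (hpow k a (Submonoid.subset_closure ha)) hk
    simpa [mul_assoc] using this
  | inv_mul_cancel a ha y _ ih =>
    obtain ⟨k, hk⟩ := ih
    obtain ⟨a, ha, rfl⟩ := ha
    obtain ⟨q, hq, h⟩ := hG.exists_eq_mul_gen hY ha
    have hq' := (hG.mem_of_mul_mem Y hY q hq _ (hG.gen_mem a) (h ▸ hG.delta_mem_closure hY)).1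
    refine ⟨k + 1, ?_⟩
    have := mul_mem (hpow k q hq') hk
    rw [pow_succ]
    nth_rewrite 2 [h]
    simpa [mul_assoc] using this

/-- The positive elements of the subgroup generated by a closed set `Y` are products of elements of
`Y`. -/
theorem mem_closure_of_mem_group {Y : Set (Gen e n)} (hY : IsClosed Y) {x : G}
    (hx : x ∈ Subgroup.closure (g '' Y)) (hP : x ∈ P) : x ∈ Submonoid.closure (g '' Y) := by
  obtain ⟨k, hk⟩ := hG.exists_delta_pow_mul_mem hY hx
  exact (hG.mem_of_mul_mem Y hY _ (pow_mem (hG.delta_mem Y) k) x hP hk).2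

end System

end CorranPicantin

namespace CorranPicantin

open Garside

/-- The Garside element has no prefix of the form `a a` with a generator `a`. -/
def SquareFree {e n : ℕ} {G : Type*} [Group G] (P : Submonoid G) (g : Gen e n → G) : Prop :=
  ∀ a, ¬ IsPrefix P (g a * g a) (deltaSet P (g '' Set.univ))

namespace System

variable {e n : ℕ} {G : Type*} [Group G] {P : Submonoid G} {g : Gen e n → G} {len : G → ℤ}
  (hG : System P g len)
include hG

/-! ### The Garside structure -/

theorem atoms_eq : atoms P (deltaSet P (g '' Set.univ)) = Set.range g := by
  ext x
  constructor
  · rintro ⟨⟨hx, hxd⟩, h1, h2⟩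
    obtain ⟨a, ha⟩ := hG.exists_gen_isPrefix hx h1
    rcases h2 (g a) ⟨hG.gen_mem a, ha⟩ with h | h
    · exact absurd h (hG.gen_ne_one a)
    · exact ⟨a, h⟩
  · rintro ⟨a, rfl⟩
    refine ⟨⟨hG.gen_mem a, hG.gen_isPrefix_delta (Set.mem_univ a)⟩, hG.gen_ne_one a, ?_⟩
    rintro b ⟨hb, hba⟩
    have h1 := hG.len_le hba
    have h2 := hG.len_gen a
    by_cases h : len b ≤ 0
    · exact .inl (hG.eq_one_of_len hb h)
    · exact .inr (hG.eq_of_isPrefix_of_len hba (by omega))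

theorem gen_isPrefix_delta_iff {Y : Set (Gen e n)} {a : Gen e n} :
    IsPrefix P (g a) (deltaSet P (g '' Y)) ↔ a ∈ cl Y := by
  rw [← hG.delta_cl]
  refine ⟨fun h => ?_, hG.gen_isPrefix_delta⟩
  exact hG.mem_of_gen_mem _ (isClosed_cl Y) a (hG.mem_closure_of_isPrefix (isClosed_cl Y)
    (hG.gen_mem a) h (hG.delta_mem_closure (isClosed_cl Y))).1

theorem suppBalanced_eq (Y : Set (Gen e n)) :
    suppBalanced P (deltaSet P (g '' Set.univ)) (deltaSet P (g '' Y)) = g '' cl Y := by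
  rw [suppBalanced, hG.atoms_eq]
  ext x
  constructor
  · rintro ⟨⟨_, h⟩, a, rfl⟩
    exact ⟨a, hG.gen_isPrefix_delta_iff.1 h, rfl⟩
  · rintro ⟨a, ha, rfl⟩
    exact ⟨⟨hG.gen_mem a, hG.gen_isPrefix_delta_iff.2 ha⟩, a, rfl⟩

theorem satClosure_eq (Y : Set (Gen e n)) :
    satClosure P (deltaSet P (g '' Set.univ)) (g '' Y) = g '' cl Y := hG.suppBalanced_eq Y

theorem parabolic_eq (Y : Set (Gen e n)) :
    parabolic P (deltaSet P (g '' Set.univ)) (g '' Y) = Subgroup.closure (g '' cl Y) := by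
  rw [parabolic, subgroupOf, hG.suppBalanced_eq]

theorem finite_len_le (N : ℕ) : {x | x ∈ P ∧ len x ≤ N}.Finite := by
  have := hG.finite
  induction N with
  | zero =>
    refine (Set.finite_singleton (1 : G)).subset ?_
    rintro x ⟨hx, h⟩
    exact hG.eq_one_of_len hx (by simpa using h)
  | succ N ih =>
    refine ((Set.finite_singleton (1 : G)).union
      (Set.Finite.image2 (fun a y => g a * y) (Set.toFinite Set.univ) ih)).subset ?_
    rintro x ⟨hx, h⟩
    rcases hG.exists_gen_mul hx with rfl | ⟨a, y, hy, rfl⟩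
    · exact .inl rfl
    · rw [hG.len_mul, hG.len_gen] at h
      exact .inr ⟨a, trivial, y, ⟨hy, by push_cast at h; omega⟩, rfl⟩

theorem length_le_len (l : List G) (h : ∀ a ∈ l, a ∈ P ∧ a ≠ 1) : (l.length : ℤ) ≤ len l.prod := by
  induction l with
  | nil => simp [hG.len_one]
  | cons a l ih =>
    rw [List.prod_cons, hG.len_mul, List.length_cons]
    have h1 := ih fun b hb => h b (List.mem_cons_of_mem _ hb)
    obtain ⟨h2, h3⟩ := h a List.mem_cons_self
    have h4 : ¬ len a ≤ 0 := fun h => h3 (hG.eq_one_of_len h2 h)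
    push_cast
    omega

theorem isGarside : IsGarside P (deltaSet P (g '' Set.univ)) where
  eq_one_of_inv_mem a ha ha' := by
    have h1 := hG.len_nonneg ha'
    rw [hG.len_inv] at h1
    exact hG.eq_one_of_len ha (by omega)
  prefix_join := hG.exists_join
  prefix_meet := hG.exists_meet
  suffix_join a b := by
    obtain ⟨m, h1, h2, h3⟩ := hG.exists_meet a⁻¹ b⁻¹
    refine ⟨m⁻¹, ?_, ?_, fun c ha hb => ?_⟩
    · rwa [← inv_isPrefix_inv, inv_inv]
    · rwa [← inv_isPrefix_inv, inv_inv]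
    · rw [← inv_isPrefix_inv, inv_inv]
      exact h3 _ (inv_isPrefix_inv.2 ha) (inv_isPrefix_inv.2 hb)
  suffix_meet a b := by
    obtain ⟨m, h1, h2, h3⟩ := hG.exists_join a⁻¹ b⁻¹
    refine ⟨m⁻¹, ?_, ?_, fun c ha hb => ?_⟩
    · rwa [← inv_isPrefix_inv, inv_inv]
    · rwa [← inv_isPrefix_inv, inv_inv]
    · rw [← inv_isPrefix_inv, inv_inv]
      exact h3 _ (inv_isPrefix_inv.2 ha) (inv_isPrefix_inv.2 hb)
  atomic x hx := by
    refine ⟨(len x).toNat, fun l hl h => ?_⟩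
    have := hG.length_le_len l hl
    rw [h] at this
    omega
  balanced := hG.isBalanced_delta IsClosed.univ
  finite_simples := by
    refine (hG.finite_len_le (len (deltaSet P (g '' Set.univ))).toNat).subset ?_
    rintro x ⟨hx, h⟩
    have := hG.len_le h
    exact ⟨hx, by omega⟩
  simples_generate_monoid := by
    refine le_antisymm (Submonoid.closure_le.2 fun x hx => hx.1) ?_
    conv_lhs => rw [← hG.closure_eq]
    refine Submonoid.closure_mono ?_
    rintro _ ⟨a, rfl⟩
    exact ⟨hG.gen_mem a, hG.gen_isPrefix_delta trivial⟩
  simples_generate_group := by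
    rw [eq_top_iff, ← hG.closure_group]
    refine Subgroup.closure_mono ?_
    rintro _ ⟨a, rfl⟩
    exact ⟨hG.gen_mem a, hG.gen_isPrefix_delta trivial⟩

/-- As the Garside element is balanced, a square of a generator dividing it as a factor also divides
it as a prefix. -/
theorem sq_isPrefix_of_eq {a : Gen e n} {x y : G} (hx : x ∈ P) (hy : y ∈ P)
    (h : x * (g a * (g a * y)) = deltaSet P (g '' Set.univ)) :
    IsPrefix P (g a * g a) (deltaSet P (g '' Set.univ)) := by
  have hm : g a * (g a * y) ∈ P := mul_mem (hG.gen_mem a) (mul_mem (hG.gen_mem a) hy)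
  have : g a * (g a * y) ∈ SuffixDiv P (deltaSet P (g '' Set.univ)) := by
    refine ⟨hm, ?_⟩
    unfold IsSuffix
    rwa [← h, mul_inv_cancel_right]
  rw [← (hG.isBalanced_delta IsClosed.univ).2] at this
  refine isPrefix_trans ?_ this.2
  rw [← mul_assoc]
  exact isPrefix_mul _ hy

/-- No factor of a square-free Garside element is the square of a generator. -/
theorem ne_mul_sq (hsq : SquareFree P g) (a : Gen e n) {x y : G} (hx : x ∈ P) (hy : y ∈ P) :
    x * (g a * (g a * y)) ≠ deltaSet P (g '' Set.univ) :=
  fun h => hsq a (hG.sq_isPrefix_of_eq hx hy h)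

/-- A simple element of the monoid generated by a closed set `Y` divides `Δ_Y`, as otherwise a
square of a generator would divide the Garside element. -/
theorem isPrefix_delta_of_mem (hsq : SquareFree P g) {Y : Set (Gen e n)} (hY : IsClosed Y) {x : G}
    (hx : x ∈ Submonoid.closure (g '' Y)) (hd : IsPrefix P x (deltaSet P (g '' Set.univ))) :
    IsPrefix P x (deltaSet P (g '' Y)) := by
  obtain ⟨m, hm, h1, h2, h3⟩ := hG.join Y hY x hx _ (hG.delta_mem_closure hY)
  have h4 := h3 _ hd (hG.delta_mono (Set.subset_univ Y))
  obtain ⟨-, hz⟩ := hG.mem_closure_of_isPrefix hY (hG.delta_mem Y) h2 hm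
  obtain ⟨z, rfl⟩ : ∃ z, m = deltaSet P (g '' Y) * z := ⟨_, (mul_inv_cancel_left _ _).symm⟩
  rw [inv_mul_cancel_left] at hz
  rcases hG.exists_gen_mul (hG.closure_le Y hz) with rfl | ⟨a, w, hw, rfl⟩
  · rwa [mul_one] at h1
  · exfalso
    have ha := hG.mem_of_gen_mem Y hY a (hG.mem_of_mul_mem Y hY _ (hG.gen_mem a) w hw hz).1
    obtain ⟨y, hy, hya⟩ := hG.exists_eq_mul_gen hY ha
    obtain ⟨p, hp, h⟩ := isPrefix_iff.1 h4
    refine hG.ne_mul_sq hsq a hy (mul_mem hw hp) ?_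
    rw [h, hya]
    simp only [mul_assoc]

theorem isLCMGarside (hsq : SquareFree P g) : IsLCMGarside P (deltaSet P (g '' Set.univ)) := by
  have hbal : ∀ X ⊆ atoms P (deltaSet P (g '' Set.univ)), IsBalanced P (deltaSet P X) := by
    intro X hX
    rw [hG.atoms_eq] at hX
    obtain ⟨Y, rfl⟩ := Set.subset_range_iff_exists_image_eq.1 hX
    rw [← hG.delta_cl]
    exact hG.isBalanced_delta (isClosed_cl Y)
  refine ⟨hG.isGarside, by rw [hG.atoms_eq, Set.image_univ], hbal, fun X hX => ⟨hbal X hX, ?_⟩⟩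
  rw [hG.atoms_eq] at hX
  obtain ⟨Y, rfl⟩ := Set.subset_range_iff_exists_image_eq.1 hX
  refine ⟨⟨hG.delta_mem Y, hG.delta_mono (Set.subset_univ Y)⟩, ?_⟩
  rw [subgroupOf, hG.suppBalanced_eq, ← hG.delta_cl]
  ext x
  constructor
  · rintro ⟨hx, h⟩
    exact ⟨⟨hx, isPrefix_trans h (hG.delta_mono (Set.subset_univ _))⟩,
      closure_le_group g _ (hG.mem_closure_of_isPrefix (isClosed_cl Y) hx h
        (hG.delta_mem_closure (isClosed_cl Y))).1, hx⟩
  · rintro ⟨⟨hx, h⟩, h2, _⟩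
    exact ⟨hx, hG.isPrefix_delta_of_mem hsq (isClosed_cl Y)
      (hG.mem_closure_of_mem_group (isClosed_cl Y) h2 hx) h⟩

/-! ### Elements conjugating a set of generators into the generators -/

/-- Suppose that `a r = r a'` for generators `a`, `a'` with `a` not dividing `r`. If `s` is a
prefix of `r` whose join with `a` is only one letter longer than `s`, then already `s` conjugates
`a` to a generator. (For finite Coxeter groups this is an instance of Deodhar's lemma.) The first
letter `v` of `s` moves past `a`, and passes the property on to a shorter prefix; if `v` and `a`
are both among the `t_i`, then the element `r` forces `v` to be the successor of `a`. -/
theorem mul_eq_of_isJoin {a b a' : Gen e n} {s r : G} (hs : s ∈ P) (hsr : IsPrefix P s r)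
    (har : g a * r = r * g a') (hna : ¬ IsPrefix P (g a) r)
    (hj : IsJoin (IsPrefix P) (g a) s (s * g b)) : g a * s = s * g b := by
  induction hk : (len s).toNat using Nat.strong_induction_on generalizing a s r with
  | _ k ih =>
    rcases hG.exists_gen_mul hs with rfl | ⟨v, s1, hs1, rfl⟩
    · rw [one_mul] at hj ⊢
      rw [mul_one, hG.eq_of_gen_isPrefix hj.1]
    obtain ⟨p, hp, rfl⟩ := isPrefix_iff.1 hsr
    have hvr : IsPrefix P (g v) (g v * s1 * p) := by
      rw [mul_assoc]; exact isPrefix_mul _ (mul_mem hs1 hp)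
    have hva : v ≠ a := fun h => hna (h ▸ hvr)
    obtain ⟨hj1, hj2, hj3⟩ := hj
    have hvs : IsPrefix P (g v) (g v * s1 * g b) := by
      rw [mul_assoc]; exact isPrefix_mul _ (mul_mem hs1 (hG.gen_mem b))
    have hlcm := hG.comp_lcm v a _ hva hvs hj1
    have hls : len (g v * s1) = 1 + len s1 := by rw [hG.len_mul, hG.len_gen]
    have hls1 := hG.len_nonneg hs1
    simp only [mul_assoc] at har hna hj1 hj2 hj3 hlcm hvr ⊢
    rw [isPrefix_mul_left_iff] at hlcm
    have hr1 : s1 * p ∈ P := mul_mem hs1 hp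
    rcases eq_or_ne v.rk a.rk with h | h
    · -- both letters are among the `t_i`
      rw [comp_of_eq _ h] at hlcm
      have h2 := Gen.rk_eq_two_of_ne hva h
      have hτ := hG.satisfies.shift v a h h2
      have hv : v = a.shift := by
        by_contra hv
        have h3 : IsPrefix P (g a * g a.shift) (g a * (g v * (s1 * p))) := by
          refine hG.level_isPrefix hva h h.symm ?_ (isPrefix_mul _ (mul_mem (hG.gen_mem v) hr1))
          rw [har, ← mul_assoc s1]
          exact isPrefix_mul _ (mul_mem hr1 (hG.gen_mem a'))
        rw [isPrefix_mul_left_iff] at h3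
        exact hna (isPrefix_trans (isPrefix_mul _ (hG.gen_mem _))
          (hG.level_isPrefix hv (by simpa using h) h.symm hvr h3))
      subst hv
      have hτ' : ∀ x, g a.shift * (g a.shift.shift * x) = g a * (g a.shift * x) := by
        intro x
        rw [← mul_assoc, hτ, mul_assoc]
      have key := ih (len s1).toNat (by omega) (a := a.shift.shift) (s := s1) (r := s1 * p) hs1
        (isPrefix_mul _ hp)
        (mul_left_cancel (a := g a.shift) (by rw [hτ', har]; simp only [mul_assoc]))
        (fun hcon => hna (isPrefix_trans (isPrefix_mul (g a) (hG.gen_mem a.shift)) (by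
          rwa [← hτ, isPrefix_mul_left_iff])))
        ⟨hlcm, isPrefix_mul _ (hG.gen_mem b), fun c hc1 hc2 => by
          rw [← isPrefix_mul_left_iff (c := g a.shift)]
          refine hj3 _ (isPrefix_trans (isPrefix_mul (g a) (hG.gen_mem a.shift)) ?_)
            (isPrefix_mul_left_iff.2 hc2)
          rwa [← hτ, isPrefix_mul_left_iff]⟩ rfl
      rw [← key, hτ']
    by_cases h' : v.rk + 1 = a.rk ∨ a.rk + 1 = v.rk
    · -- a braid relation: both `r` and `s` begin with `v a`
      have hb := hG.satisfies.braid v a h'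
      rw [comp_of_adj _ h'] at hlcm
      have hb' : ∀ x, g v * (g a * (g v * x)) = g a * (g v * (g a * x)) := fun x => by
        simpa only [mul_assoc] using congrArg (· * x) hb
      have h1 : IsPrefix P (g a) (s1 * p) := by
        have h2 : IsPrefix P (g v * comp g v a) (g a * (g v * (s1 * p))) := by
          refine hG.comp_lcm v a _ hva ?_ (isPrefix_mul _ (mul_mem (hG.gen_mem v) hr1))
          refine isPrefix_trans (b := g v * (s1 * p)) hvr ?_
          rw [har, ← mul_assoc s1, ← mul_assoc (g v) (s1 * p)]
          exact isPrefix_mul _ (hG.gen_mem a')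
        rw [comp_of_adj _ h', hb, isPrefix_mul_left_iff, isPrefix_mul_left_iff] at h2
        exact h2
      have h2 : IsPrefix P (g a) s1 := by
        -- otherwise the join of `a` and `s` would be a prefix of `r`
        by_contra hcon
        obtain ⟨m, hm1, hm2, hm3⟩ := hG.exists_join (g a) s1
        have h3 := hm3 _ (isPrefix_trans (isPrefix_mul _ (hG.gen_mem v)) hlcm)
          (isPrefix_mul _ (hG.gen_mem b))
        have h4 : m = s1 * g b := by
          refine hG.eq_of_isPrefix_of_len h3 ?_
          rw [hG.len_mul, hG.len_gen]
          by_contra hlt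
          exact hcon (hG.eq_of_isPrefix_of_len hm2 (by omega) ▸ hm1)
        have h5 := hm3 _ h1 (isPrefix_mul _ hp)
        rw [h4, ← isPrefix_mul_left_iff (c := g v)] at h5
        exact hna (isPrefix_trans hj1 h5)
      obtain ⟨s2, hs2, rfl⟩ := isPrefix_iff.1 h2
      simp only [mul_assoc] at har hna hj1 hj2 hj3 hlcm hvr ⊢
      rw [isPrefix_mul_left_iff] at hlcm
      have hl2 := hG.len_mul (g a) s2
      rw [hG.len_gen] at hl2
      have hls2 := hG.len_nonneg hs2
      have key := ih (len s2).toNat (by omega) (a := v) (s := s2) (r := s2 * p) hs2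
        (isPrefix_mul _ hp)
        (mul_left_cancel (a := g v * g a) (by
          simp only [mul_assoc]; rw [hb', har]))
        (fun hcon => hna (isPrefix_trans (isPrefix_mul (g a)
          (mul_mem (hG.gen_mem v) (hG.gen_mem a))) (by
            rwa [← hb, isPrefix_mul_left_iff, isPrefix_mul_left_iff])))
        ⟨hlcm, isPrefix_mul _ (hG.gen_mem b), fun c hc1 hc2 => by
          rw [← isPrefix_mul_left_iff (c := g a), ← isPrefix_mul_left_iff (c := g v)]
          refine hj3 _ (isPrefix_trans (isPrefix_mul (g a)
            (mul_mem (hG.gen_mem v) (hG.gen_mem a))) ?_)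
            (isPrefix_mul_left_iff.2 (isPrefix_mul_left_iff.2 hc2))
          rwa [← hb, isPrefix_mul_left_iff, isPrefix_mul_left_iff]⟩ rfl
      rw [← key, hb']
    · -- commuting letters
      have hc := hG.satisfies.comm v a (by omega)
      rw [comp_of_far _ (by omega)] at hlcm
      have hc' : ∀ x, g v * (g a * x) = g a * (g v * x) := fun x => by
        rw [← mul_assoc, hc, mul_assoc]
      have key := ih (len s1).toNat (by omega) (a := a) (s := s1) (r := s1 * p) hs1
        (isPrefix_mul _ hp)
        (mul_left_cancel (a := g v) (by rw [hc', har]; simp only [mul_assoc]))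
        (fun hcon => hna (isPrefix_trans (isPrefix_mul (g a) (hG.gen_mem v)) (by
          rwa [← hc, isPrefix_mul_left_iff])))
        ⟨hlcm, isPrefix_mul _ (hG.gen_mem b), fun c hc1 hc2 => by
          rw [← isPrefix_mul_left_iff (c := g v)]
          refine hj3 _ (isPrefix_trans (isPrefix_mul (g a) (hG.gen_mem v)) ?_)
            (isPrefix_mul_left_iff.2 hc2)
          rwa [← hc, isPrefix_mul_left_iff]⟩ rfl
      rw [← key, hc']

/-- The situation of a positive element `r` that conjugates every generator in `Y` to a generator,
without being divisible by any generator in `Y`. -/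
structure IsConj (P : Submonoid G) (g : Gen e n → G) (Y : Set (Gen e n)) (r : G) : Prop where
  mem : r ∈ P
  conj : ∀ a ∈ Y, ∃ a', g a * r = r * g a'
  not_isPrefix : ∀ a ∈ Y, ¬ IsPrefix P (g a) r

/-- If two prefixes `s` and `d` of `r` satisfy `s ≼ a₁ ⋯ aₖ d` for generators `a₁, …, aₖ` in `Y`,
and `d` is not longer than `s`, then `s = d`, and `s` conjugates each `aᵢ` to a generator. -/
theorem eq_and_conj_of_isPrefix {Y : Set (Gen e n)} {r : G} (hr : IsConj P g Y r)
    (l : List (Gen e n)) (hl : ∀ a ∈ l, a ∈ Y) {s d : G} (hs : s ∈ P) (hsr : IsPrefix P s r)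
    (hd : d ∈ P) (hsd : IsPrefix P s ((l.map g).prod * d)) (hlen : len d ≤ len s) :
    s = d ∧ ∀ a ∈ l, ∃ b, g a * s = s * g b := by
  induction l generalizing s with
  | nil =>
    refine ⟨?_, by simp⟩
    rw [List.map_nil, List.prod_nil, one_mul] at hsd
    exact hG.eq_of_isPrefix_of_len hsd hlen
  | cons a l ih =>
    have ha := hl a List.mem_cons_self
    obtain ⟨a', har⟩ := hr.conj a ha
    have hlP : (l.map g).prod * d ∈ P := by
      refine mul_mem (Submonoid.list_prod_mem _ ?_) hd
      intro x hx
      obtain ⟨b, _, rfl⟩ := List.mem_map.1 hx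
      exact hG.gen_mem b
    rw [List.map_cons, List.prod_cons, mul_assoc] at hsd
    obtain ⟨j, hj⟩ := hG.exists_join (g a) s
    obtain ⟨hj1, hj2, hj3⟩ := hj
    have hjl := hj3 _ (isPrefix_mul _ hlP) hsd
    have hjr := hj3 _ (isPrefix_mul _ hr.mem)
      (isPrefix_trans hsr (har ▸ isPrefix_mul _ (hG.gen_mem a')))
    obtain ⟨s', hs', rfl⟩ := isPrefix_iff.1 hj1
    rw [isPrefix_mul_left_iff] at hjl hjr
    have hlt : len s < len (g a * s') := by
      by_contra hcon
      have := hG.eq_of_isPrefix_of_len hj2 (by omega)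
      exact hr.not_isPrefix a ha (isPrefix_trans (this ▸ hj1) hsr)
    have hls := hG.len_mul (g a) s'
    rw [hG.len_gen] at hls
    obtain ⟨h1, h2⟩ := ih (fun b hb => hl b (List.mem_cons_of_mem _ hb)) hs' hjr hjl (by omega)
    obtain ⟨q, hq, hqj⟩ := isPrefix_iff.1 hj2
    have hlq := hG.len_mul s q
    rw [← hqj] at hlq
    rw [← h1] at hlen
    obtain ⟨b, rfl⟩ := hG.exists_gen_of_len hq (by omega)
    have key : g a * s = s * g b :=
      hG.mul_eq_of_isJoin hs hsr har (hr.not_isPrefix a ha)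
        ⟨hqj ▸ hj1, hqj ▸ hj2, fun c h h' => hqj ▸ hj3 c h h'⟩
    have h3 : s = s' := mul_left_cancel (key.trans hqj.symm)
    subst h3
    refine ⟨h1, fun c hc => ?_⟩
    rcases List.mem_cons.1 hc with rfl | hc
    · exact ⟨b, key⟩
    · exact h2 c hc

/-- If a prefix `d` of `r` conjugates two different `t_i`, `t_j` in `Y` to generators, then it so
conjugates all of the `t_k`. -/
theorem level_conj {Y : Set (Gen e n)} (hY : IsClosed Y) {r : G} (hr : IsConj P g Y r) {d : G}
    (hd : d ∈ P) (hdr : IsPrefix P d r) {i j : Gen e n} (hi : i ∈ Y) (hj : j ∈ Y) (hij : i ≠ j)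
    (hrk : i.rk = j.rk) {b b' : Gen e n} (hb : g i * d = d * g b) (hb' : g j * d = d * g b')
    {k : Gen e n} (hk : k.rk = i.rk) : ∃ c, g k * d = d * g c := by
  have h2 := Gen.rk_eq_two_of_ne hij hrk
  have hmemY : ∀ c : Gen e n, c.rk = i.rk → c ∈ Y := fun c hc => hY i hi j hj hij hrk c hc
  have hbb : b ≠ b' := by
    rintro rfl
    exact hij (hG.injective (mul_right_cancel (hb.trans hb'.symm)))
  have hτ := hG.satisfies.shift i j hrk h2
  have hτk := hG.satisfies.shift i k hk.symm h2
  suffices H : ∃ w ∈ P, len w ≤ len d ∧ IsPrefix P d (g i * g i.shift * w) by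
    obtain ⟨w, hw, hlen, hdw⟩ := H
    have := hG.eq_and_conj_of_isPrefix hr [k, k.shift]
      (by simpa using ⟨hmemY k hk, hmemY _ (by simpa using hk)⟩) hd hdr hw
      (by simpa [← hτk] using hdw) hlen
    exact this.2 k (by simp)
  have hdd : IsPrefix P d (g i * (g j * d)) := by
    rw [hb', ← mul_assoc, hb, mul_assoc]
    exact isPrefix_mul _ (mul_mem (hG.gen_mem b) (hG.gen_mem b'))
  have hdd' : IsPrefix P d (g j * (g i * d)) := by
    rw [hb, ← mul_assoc, hb', mul_assoc]
    exact isPrefix_mul _ (mul_mem (hG.gen_mem b') (hG.gen_mem b))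
  by_cases hs1 : i.shift = j
  · exact ⟨d, hd, le_rfl, by rw [hs1, mul_assoc]; exact hdd⟩
  by_cases hs2 : j.shift = i
  · exact ⟨d, hd, le_rfl, by rw [hτ, hs2, mul_assoc]; exact hdd'⟩
  -- `m` is the join of `d`, `t_i` and `t_j`
  have hcomp := hG.satisfies.mul_comp hbb
  have hPb : comp g b b' ∈ P := hG.closure_univ ▸
    IsClosed.univ.comp_mem g (Set.mem_univ _) (Set.mem_univ _) hbb
  have hPb' : comp g b' b ∈ P := hG.closure_univ ▸
    IsClosed.univ.comp_mem g (Set.mem_univ _) (Set.mem_univ _) hbb.symm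
  have hm : IsPrefix P (g i * g i.shift) (d * (g b * comp g b b')) := by
    refine hG.level_isPrefix hij hrk rfl ?_ ?_
    · rw [← mul_assoc, ← hb, mul_assoc]
      exact isPrefix_mul _ (mul_mem hd hPb)
    · rw [hcomp, ← mul_assoc, ← hb', mul_assoc]
      exact isPrefix_mul _ (mul_mem hd hPb')
  by_cases hadj : b.rk + 1 = b'.rk ∨ b'.rk + 1 = b.rk
  · exfalso
    have e1 : d * (g b * comp g b b') = g i * (g j * (g i * d)) := by
      rw [comp_of_adj _ hadj, ← mul_assoc, ← hb, mul_assoc, ← mul_assoc d, ← hb', mul_assoc, ← hb]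
    rw [e1, isPrefix_mul_left_iff] at hm
    have hid : g i * d ∈ P := mul_mem (hG.gen_mem i) hd
    have h3 := hG.level_isPrefix (c := j) hs1 (by simpa using hrk) (by simpa using hrk.symm) hm
      (isPrefix_mul _ hid)
    rw [isPrefix_mul_left_iff] at h3
    have h4 := hG.level_isPrefix (c := i) hs2 (by simpa using hrk.symm) (by simpa using hrk) h3
      (isPrefix_mul _ hd)
    rw [isPrefix_mul_left_iff] at h4
    exact hr.not_isPrefix _ (hmemY _ (by simp)) (isPrefix_trans h4 hdr)
  · obtain ⟨w, hw, hwm⟩ := isPrefix_iff.1 hm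
    refine ⟨w, hw, ?_, ?_⟩
    · have hl := congrArg len hwm
      have hlc : len (comp g b b') = 1 := by
        unfold comp
        split_ifs
        · exact hG.len_gen _
        · exact hG.len_gen _
      simp only [hG.len_mul, hG.len_gen, hlc] at hl
      omega
    · rw [← hwm]
      exact isPrefix_mul _ (mul_mem (hG.gen_mem b) hPb)

end System

end CorranPicantin

namespace CorranPicantin

open Garside

/-! ### Ribbons and positive conjugators -/

section

variable {e n : ℕ} {G : Type*} [Group G] {P : Submonoid G} {g : Gen e n → G}

theorem subset_cl_union (Y : Set (Gen e n)) (u : Gen e n) : Y ⊆ cl (Y ∪ {u}) :=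
  Set.subset_union_left.trans (subset_cl _)

/-- A generator `u` outside `Y` is regular if it divides the complement `a \ u` for all `a` in `Y`.
This only fails for a `t_j` if `Y` contains a `t_i` with `j ≠ i + 1`. -/
def Regular (Y : Set (Gen e n)) (u : Gen e n) : Prop := ∀ a ∈ Y, a.rk = u.rk → a.shift = u

theorem prod_mem_closure {Y : Set (Gen e n)} {l : List (Gen e n)} (hl : ∀ a ∈ l, a ∈ Y) :
    (l.map g).prod ∈ Submonoid.closure (g '' Y) := by
  refine Submonoid.list_prod_mem _ fun x hx => ?_
  obtain ⟨a, ha, rfl⟩ := List.mem_map.1 hx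
  exact Submonoid.subset_closure ⟨a, hl a ha, rfl⟩

/-- The positive conjugators of an element are closed under meets. -/
theorem conj_isPrefix_meet {x c d m : G} (hc : IsPrefix P c (x * c)) (hd : IsPrefix P d (x * d))
    (hm : IsMeet (IsPrefix P) c d m) : IsPrefix P m (x * m) := by
  have : IsPrefix P (x⁻¹ * m) m := by
    refine hm.2.2 _ ?_ ?_
    · rw [← isPrefix_mul_left_iff (c := x), mul_inv_cancel_left]
      exact isPrefix_trans hm.1 hc
    · rw [← isPrefix_mul_left_iff (c := x), mul_inv_cancel_left]
      exact isPrefix_trans hm.2.1 hd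
  rwa [← isPrefix_mul_left_iff (c := x), mul_inv_cancel_left] at this

end

namespace System

variable {e n : ℕ} {G : Type*} [Group G] {P : Submonoid G} {g : Gen e n → G} {len : G → ℤ}
  (hG : System P g len)
include hG

theorem ribbon_eq (Y : Set (Gen e n)) (u : Gen e n) : ribbon P (g '' Y) (g u) =
    (deltaSet P (g '' Y))⁻¹ * deltaSet P (g '' cl (Y ∪ {u})) := by
  rw [ribbon, hG.delta_cl, Set.image_union, Set.image_singleton]

theorem delta_mul_ribbon (Y : Set (Gen e n)) (u : Gen e n) :
    deltaSet P (g '' Y) * ribbon P (g '' Y) (g u) = deltaSet P (g '' cl (Y ∪ {u})) := by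
  rw [hG.ribbon_eq, mul_inv_cancel_left]

theorem ribbon_mem (Y : Set (Gen e n)) (u : Gen e n) : ribbon P (g '' Y) (g u) ∈ P := by
  rw [hG.ribbon_eq]
  exact hG.delta_mono (subset_cl_union Y u)

/-- Conjugation by the ribbon is conjugation by `Δ_Y⁻¹`, which permutes `Y`, followed by
conjugation by `Δ_{Y ∪ {u}}`. -/
theorem exists_mul_ribbon {Y : Set (Gen e n)} (hY : IsClosed Y) {u a : Gen e n} (ha : a ∈ Y) :
    ∃ a₁ ∈ Y, ∃ b ∈ cl (Y ∪ {u}), g a * ribbon P (g '' Y) (g u) = ribbon P (g '' Y) (g u) * g b ∧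
      g a₁ * deltaSet P (g '' cl (Y ∪ {u})) = deltaSet P (g '' cl (Y ∪ {u})) * g b := by
  obtain ⟨a₁, ha₁, h1⟩ := hG.exists_delta_mul hY ha
  obtain ⟨b, hb, h2⟩ := hG.exists_mul_delta (isClosed_cl (Y ∪ {u})) (subset_cl_union Y u ha₁)
  refine ⟨a₁, ha₁, b, hb, ?_, h2⟩
  rw [hG.ribbon_eq, mul_assoc _ _ (g b), ← h2, ← mul_assoc, ← mul_assoc]
  congr 1
  rw [eq_inv_mul_iff_mul_eq, ← mul_assoc, ← h1, mul_inv_cancel_right]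

/-- The ribbon `r_{Y,u}` conjugates the letters in `Y` to letters, and is divisible by none of them
since the Garside element is square-free. -/
theorem isConj_ribbon (hsq : SquareFree P g) {Y : Set (Gen e n)} (hY : IsClosed Y)
    (u : Gen e n) : IsConj P g Y (ribbon P (g '' Y) (g u)) := by
  refine ⟨hG.ribbon_mem Y u, fun a ha => ?_, fun a ha h => ?_⟩
  · obtain ⟨_, _, b, _, h, _⟩ := hG.exists_mul_ribbon hY (u := u) ha
    exact ⟨b, h⟩
  · -- `a` is a suffix of `Δ_Y`, so the square of `a` would divide `Δ_{Y ∪ {u}}`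
    obtain ⟨y, hy, hya⟩ := hG.exists_eq_mul_gen hY ha
    obtain ⟨w, hw, h⟩ := isPrefix_iff.1 h
    obtain ⟨p, hp, h'⟩ := isPrefix_iff.1 (hG.delta_mono (Set.subset_univ (cl (Y ∪ {u}))))
    refine hG.ne_mul_sq hsq a hy (mul_mem hw hp) ?_
    rw [h', ← hG.delta_mul_ribbon, h, hya]
    simp only [mul_assoc]

theorem conj_mem_of_mem {Y : Set (Gen e n)} {r : G} (hr : IsConj P g Y r) {x : G}
    (hx : x ∈ Submonoid.closure (g '' Y)) : r⁻¹ * x * r ∈ P := by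
  induction hx using Submonoid.closure_induction with
  | mem x hx =>
    obtain ⟨a, ha, rfl⟩ := hx
    obtain ⟨b, h⟩ := hr.conj a ha
    rw [mul_assoc, h, inv_mul_cancel_left]
    exact hG.gen_mem b
  | one => simp [one_mem]
  | mul x y _ _ hx hy => simpa [mul_assoc] using mul_mem hx hy

theorem gen_isPrefix_comp {a u : Gen e n} (h : a.rk = u.rk → a.shift = u) :
    IsPrefix P (g u) (comp g a u) := by
  unfold comp
  split_ifs with h1
  · rw [h h1]; exact isPrefix_refl _
  · exact isPrefix_mul _ (hG.gen_mem a)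
  · exact isPrefix_refl _

theorem gen_isPrefix_of_mul {a u : Gen e n} (hau : a ≠ u) (h : a.rk = u.rk → a.shift = u) {c : G}
    (hc : c ∈ P) (huc : IsPrefix P (g u) (g a * c)) : IsPrefix P (g u) c := by
  have := hG.comp_lcm a u _ hau (isPrefix_mul _ hc) huc
  rw [isPrefix_mul_left_iff] at this
  exact isPrefix_trans (hG.gen_isPrefix_comp h) this

/-- A regular letter outside `Y` that divides `z c`, with `z` a product of letters in `Y`, divides
`c`. -/
theorem gen_isPrefix_of_mul_mem {Y : Set (Gen e n)} {u : Gen e n} (huY : u ∉ Y)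
    (hreg : Regular Y u) {z c : G} (hz : z ∈ Submonoid.closure (g '' Y)) (hc : c ∈ P)
    (h : IsPrefix P (g u) (z * c)) : IsPrefix P (g u) c := by
  induction hz using Submonoid.closure_induction_left with
  | one => rwa [one_mul] at h
  | mul_left x hx y hy ih =>
    obtain ⟨a, ha, rfl⟩ := hx
    rw [mul_assoc] at h
    exact ih (hG.gen_isPrefix_of_mul (by rintro rfl; exact huY ha) (hreg a ha)
      (mul_mem (hG.closure_le Y hy) hc) h)

theorem prod_mem (l : List (Gen e n)) : (l.map g).prod ∈ P :=
  hG.closure_univ ▸ prod_mem_closure (Y := Set.univ) fun _ _ => trivial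

/-- If `u` divides `Δ_Y c`, then the ribbon divides `c`. -/
theorem ribbon_isPrefix {Y : Set (Gen e n)} {u : Gen e n} {c : G} (hc : c ∈ P)
    (h : IsPrefix P (g u) (deltaSet P (g '' Y) * c)) : IsPrefix P (ribbon P (g '' Y) (g u)) c := by
  rw [← isPrefix_mul_left_iff (c := deltaSet P (g '' Y)), hG.delta_mul_ribbon, hG.delta_cl]
  refine hG.delta_isPrefix (mul_mem (hG.delta_mem Y) hc) ?_
  rintro a (ha | rfl)
  · exact isPrefix_trans (hG.gen_isPrefix_delta ha) (isPrefix_mul _ hc)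
  · exact h

/-- For a regular generator `u`, a positive conjugator `c` of an element `x` with letters generating
`Y` that is divisible by `u` is divisible by the ribbon: the meet `d` of `c` with the ribbon is
also a positive conjugator of `x`, hence conjugates all letters of `x` to generators, hence all of
`Y`, and so `u ≼ d ≼ Δ_Y d`. -/
theorem ribbon_isPrefix_of_regular (hsq : SquareFree P g) {l : List (Gen e n)} {u : Gen e n}
    (hu : u ∉ cl {a | a ∈ l}) (hreg : Regular (cl {a | a ∈ l}) u) {c : G}
    (huc : IsPrefix P (g u) c) (hxc : IsPrefix P c ((l.map g).prod * c)) :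
    IsPrefix P (ribbon P (g '' cl {a | a ∈ l}) (g u)) c := by
  set Y := cl {a | a ∈ l} with hYdef
  have hY : IsClosed Y := isClosed_cl _
  have hlY : ∀ a ∈ l, a ∈ Y := fun a ha => subset_cl _ ha
  have hr := hG.isConj_ribbon hsq hY u
  set r := ribbon P (g '' Y) (g u)
  have hur : IsPrefix P (g u) r := by
    refine hG.gen_isPrefix_of_mul_mem hu hreg (hG.delta_mem_closure hY) hr.mem ?_
    rw [hG.delta_mul_ribbon]
    exact hG.gen_isPrefix_delta (subset_cl _ (.inr rfl))
  have hrx : IsPrefix P r ((l.map g).prod * r) :=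
    conj_mem_iff.1 (hG.conj_mem_of_mem hr (prod_mem_closure hlY))
  obtain ⟨d, hd1, hd2, hd3⟩ := hG.exists_meet c r
  have hud := hd3 _ huc hur
  have hdP : d ∈ P := mem_of_isPrefix hud (hG.gen_mem u)
  have hxd : IsPrefix P d ((l.map g).prod * d) := by
    have : IsPrefix P ((l.map g).prod⁻¹ * d) d := by
      refine hd3 _ ?_ ?_
      · rw [← isPrefix_mul_left_iff (c := (l.map g).prod), mul_inv_cancel_left]
        exact isPrefix_trans hd1 hxc
      · rw [← isPrefix_mul_left_iff (c := (l.map g).prod), mul_inv_cancel_left]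
        exact isPrefix_trans hd2 hrx
    rwa [← isPrefix_mul_left_iff (c := (l.map g).prod), mul_inv_cancel_left] at this
  have hletters := (hG.eq_and_conj_of_isPrefix hr l hlY hdP hd2 hdP hxd le_rfl).2
  have hall : ∀ a ∈ Y, ∃ b, g a * d = d * g b := by
    rintro a (ha | ⟨i, hi, j, hj, hij, hrk, hk⟩)
    · exact hletters a ha
    · obtain ⟨b, hb⟩ := hletters i hi
      obtain ⟨b', hb'⟩ := hletters j hj
      exact hG.level_conj hY hr hdP hd2 (hlY i hi) (hlY j hj) hij hrk hb hb' hk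
  have hmul : ∀ z ∈ Submonoid.closure (g '' Y), IsPrefix P d (z * d) := by
    intro z hz
    induction hz using Submonoid.closure_induction_left with
    | one => rw [one_mul]; exact isPrefix_refl d
    | mul_left x hx y _ ih =>
      obtain ⟨a, ha, rfl⟩ := hx
      obtain ⟨b, hb⟩ := hall a ha
      refine isPrefix_trans (b := g a * d) ?_ ?_
      · rw [hb]; exact isPrefix_mul _ (hG.gen_mem b)
      · rw [mul_assoc, isPrefix_mul_left_iff]; exact ih
  exact isPrefix_trans (hG.ribbon_isPrefix hdP
    (isPrefix_trans hud (hmul _ (hG.delta_mem_closure hY)))) hd1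

/-- If `u` is not regular, then it is a `t_j`, and the support contains exactly one `t_i`. Then
`t_{i+1}` is regular, has the same ribbon as `u`, and also divides `c`. -/
theorem ribbon_isPrefix_of_conj (hsq : SquareFree P g) {l : List (Gen e n)} {u : Gen e n}
    (hu : u ∉ cl {a | a ∈ l}) {c : G} (hc : c ∈ P)
    (huc : IsPrefix P (g u) c) (hxc : IsPrefix P c ((l.map g).prod * c)) :
    IsPrefix P (ribbon P (g '' cl {a | a ∈ l}) (g u)) c := by
  by_cases hreg : Regular (cl {a | a ∈ l}) u
  · exact hG.ribbon_isPrefix_of_regular hsq hu hreg huc hxc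
  have hY : IsClosed (cl {a | a ∈ l}) := isClosed_cl _
  have hlY : ∀ a ∈ l, a ∈ cl {a | a ∈ l} := fun a ha => subset_cl _ ha
  unfold Regular at hreg
  push Not at hreg
  obtain ⟨i, hi, hiu, hne⟩ := hreg
  have huniq : ∀ a ∈ cl {a | a ∈ l}, a.rk = u.rk → a = i := by
    intro a ha hau
    by_contra hai
    exact hu (hY a ha i hi hai (hau.trans hiu.symm) u hau.symm)
  have hne' : i ≠ u := fun h => hu (h ▸ hi)
  have hshift := Gen.shift_ne hne' hiu
  have hs : i.shift ∉ cl {a | a ∈ l} := fun h => hshift (huniq _ h (by simpa using hiu))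
  have hreg' : Regular (cl {a | a ∈ l}) i.shift := by
    intro a ha hr
    rw [huniq a ha (by simpa [hiu] using hr)]
  have hil : i ∈ l := by
    rcases hi with hi | ⟨a, ha, b, hb, hab, h1, h2⟩
    · exact hi
    · exact absurd ((huniq a (hlY a ha) (by omega)).trans (huniq b (hlY b hb) (by omega)).symm) hab
  have hcl : cl (cl {a | a ∈ l} ∪ {i.shift}) = cl (cl {a | a ∈ l} ∪ {u}) := by
    have hcl' : ∀ v w : Gen e n, v ≠ i → v.rk = i.rk → w.rk = i.rk →
        cl (cl {a | a ∈ l} ∪ {w}) ⊆ cl (cl {a | a ∈ l} ∪ {v}) := by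
      intro v w hv hvr hwr
      refine cl_subset (isClosed_cl _) (Set.union_subset (subset_cl_union _ _) ?_)
      rintro _ rfl
      exact .inr ⟨v, .inr rfl, i, .inl hi, hv, hvr, hwr.trans hvr.symm⟩
    exact (hcl' u i.shift hne'.symm hiu.symm (by simp)).antisymm
      (hcl' i.shift u hshift (by simp) hiu.symm)
  rw [hG.ribbon_eq, ← hcl, ← hG.ribbon_eq]
  refine hG.ribbon_isPrefix_of_regular hsq hs hreg' ?_ hxc
  have main : ∀ m : List (Gen e n), (∀ a ∈ m, a ∈ cl {a | a ∈ l}) → i ∈ m →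
      IsPrefix P (g u) ((m.map g).prod * c) → IsPrefix P (g i.shift) c := by
    intro m
    induction m with
    | nil => simp
    | cons b m ih =>
      intro hm him h
      have hmP : (m.map g).prod * c ∈ P := mul_mem (hG.prod_mem m) hc
      rw [List.map_cons, List.prod_cons, mul_assoc] at h
      by_cases hbi : b = i
      · subst hbi
        have h1 := hG.level_isPrefix hne' hiu rfl (isPrefix_mul _ hmP) h
        rw [isPrefix_mul_left_iff] at h1
        exact hG.gen_isPrefix_of_mul_mem hs hreg'
          (prod_mem_closure fun a ha => hm a (List.mem_cons_of_mem _ ha)) hc h1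
      · have hb := hm b List.mem_cons_self
        refine ih (fun a ha => hm a (List.mem_cons_of_mem _ ha)) ?_
          (hG.gen_isPrefix_of_mul (by rintro rfl; exact hu hb)
            (fun hr => absurd (huniq b hb hr) hbi) hmP h)
        rcases List.mem_cons.1 him with h | h
        · exact absurd h.symm hbi
        · exact h
  exact main l hlY hil (isPrefix_trans huc hxc)

theorem ribbon_ne_one {Y : Set (Gen e n)} (hY : IsClosed Y) {u : Gen e n} (hu : u ∉ Y) :
    ribbon P (g '' Y) (g u) ≠ 1 := by
  intro h
  have h1 := hG.delta_mul_ribbon Y u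
  rw [h, mul_one] at h1
  have h2 : IsPrefix P (g u) (deltaSet P (g '' Y)) := by
    rw [h1]
    exact hG.gen_isPrefix_delta (subset_cl _ (.inr rfl))
  rw [hG.gen_isPrefix_delta_iff, hY.cl_eq] at h2
  exact hu h2

/-- The ribbon `r_{Y,u}` is a positive conjugator of every element with letters in `Y`, and it
divides every positive conjugator that is divisible by `u`. -/
theorem eq_ribbon_of_minimal (hsq : SquareFree P g) {l : List (Gen e n)} {u : Gen e n}
    (hu : u ∉ cl {a | a ∈ l}) {c : G}
    (hc : IsMinimalPositiveConjugator P (l.map g).prod c) (huc : IsPrefix P (g u) c) :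
    c = ribbon P (g '' cl {a | a ∈ l}) (g u) := by
  obtain ⟨hcP, _, hcx, hmin⟩ := hc
  by_contra hne
  refine hmin _ (hG.ribbon_mem _ u) (hG.ribbon_ne_one (isClosed_cl _) hu)
    (hG.ribbon_isPrefix_of_conj hsq hu hcP huc (conj_mem_iff.1 hcx)) (Ne.symm hne) ?_
  exact hG.conj_mem_of_mem (hG.isConj_ribbon hsq (isClosed_cl _) u)
    (prod_mem_closure fun a ha => subset_cl _ ha)

/-- The meet of a minimal positive conjugator `c` and another positive conjugator is a positive
conjugator, and thus equals `c` unless it is trivial. -/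
theorem isPrefix_of_minimal {x c d : G} {u : Gen e n} (hc : IsMinimalPositiveConjugator P x c)
    (huc : IsPrefix P (g u) c) (hud : IsPrefix P (g u) d) (hd : d⁻¹ * x * d ∈ P) :
    IsPrefix P c d := by
  obtain ⟨_, _, hcx, hmin⟩ := hc
  obtain ⟨m, hm⟩ := hG.exists_meet c d
  have hum := hm.2.2 _ huc hud
  have hmx := conj_mem_iff.2
    (conj_isPrefix_meet (conj_mem_iff.1 hcx) (conj_mem_iff.1 hd) hm)
  have hmP := mem_of_isPrefix hum (hG.gen_mem u)
  by_cases hmc : m = c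
  · exact hmc ▸ hm.2.1
  refine absurd hmx (hmin m hmP ?_ hm.1 hmc)
  rintro rfl
  have := hG.len_le hum
  rw [hG.len_gen, hG.len_one] at this
  omega

theorem isRho_of_minimal {x c : G} {u : Gen e n} (hc : IsMinimalPositiveConjugator P x c)
    (huc : IsPrefix P (g u) c) : IsRho P (g u) x c :=
  ⟨huc, hc.2.2.1, fun _ hud hd => hG.isPrefix_of_minimal hc huc hud hd⟩

end System

end CorranPicantin

namespace CorranPicantin

open Garside

/-! ### Preservation of supports -/

theorem mem_conjSubgroup {G : Type*} [Group G] {H : Subgroup G} {c x : G} :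
    x ∈ conjSubgroup H c ↔ c * x * c⁻¹ ∈ H := by
  rw [conjSubgroup, Subgroup.mem_map]
  constructor
  · rintro ⟨y, hy, rfl⟩
    simpa [mul_assoc] using hy
  · exact fun h => ⟨_, h, by simp [mul_assoc]⟩

theorem exists_word {e n : ℕ} {G : Type*} [Group G] {g : Gen e n → G} {Y : Set (Gen e n)}
    {x : G} (hx : x ∈ Submonoid.closure (g '' Y)) :
    ∃ l : List (Gen e n), (∀ a ∈ l, a ∈ Y) ∧ (l.map g).prod = x := by
  induction hx using Submonoid.closure_induction_left with
  | one => exact ⟨[], by simp, rfl⟩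
  | mul_left x hx y _ ih =>
    obtain ⟨a, ha, rfl⟩ := hx
    obtain ⟨l, hl, rfl⟩ := ih
    exact ⟨a :: l, by simpa using ⟨ha, hl⟩, rfl⟩

namespace System

variable {e n : ℕ} {G : Type*} [Group G] {P : Submonoid G} {g : Gen e n → G} {len : G → ℤ}
  (hG : System P g len)
include hG

theorem mem_of_prod_mem {Y : Set (Gen e n)} (hY : IsClosed Y) (l : List (Gen e n))
    (h : (l.map g).prod ∈ Submonoid.closure (g '' Y)) : ∀ a ∈ l, a ∈ Y := by
  induction l with
  | nil => simp
  | cons b l ih =>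
    rw [List.map_cons, List.prod_cons] at h
    obtain ⟨h1, h2⟩ := hG.mem_of_mul_mem Y hY _ (hG.gen_mem b) _ (hG.prod_mem l) h
    simpa using ⟨hG.mem_of_gen_mem Y hY b h1, ih h2⟩

/-- The closure of the set of letters of a word only depends on the positive element that the word
represents. -/
theorem cl_eq_of_prod_eq {l m : List (Gen e n)} (h : (l.map g).prod = (m.map g).prod) :
    cl {a | a ∈ l} = cl {a | a ∈ m} := by
  refine (cl_subset (isClosed_cl _) fun a ha => ?_).antisymm
    (cl_subset (isClosed_cl _) fun a ha => ?_)
  · exact hG.mem_of_prod_mem (isClosed_cl _) l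
      (h ▸ prod_mem_closure fun b hb => subset_cl _ hb) a ha
  · exact hG.mem_of_prod_mem (isClosed_cl _) m
      (h ▸ prod_mem_closure fun b hb => subset_cl _ hb) a ha

/-- The ribbon `r = r_{Y,u}` conjugates `Y` onto a closed set `Y'`. Up to the permutation of `Y`
induced by `Δ_Y`, this is conjugation by `Δ_Z` with `Z` the closure of `Y ∪ {u}`. The image is
closed since a `t_k` that divides the conjugate of an element of the monoid generated by `Y` is
itself a conjugate of a divisor of this element. -/
theorem exists_conj_ribbon {Y : Set (Gen e n)} (hY : IsClosed Y) (u : Gen e n) :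
    ∃ Y', IsClosed Y' ∧ Subgroup.closure (g '' Y') ≤
        conjSubgroup (Subgroup.closure (g '' Y)) (ribbon P (g '' Y) (g u)) ∧
      ∀ x ∈ Submonoid.closure (g '' Y), (ribbon P (g '' Y) (g u))⁻¹ * x *
        ribbon P (g '' Y) (g u) ∈ Submonoid.closure (g '' Y') := by
  set Z := cl (Y ∪ {u}) with hZdef
  have hZ : IsClosed Z := isClosed_cl _
  have hYZ : Y ⊆ Z := subset_cl_union Y u
  set D := deltaSet P (g '' Z) with hD
  refine ⟨{b | ∃ a ∈ Y, g a * D = D * g b}, ?_, ?_, ?_⟩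
  · rintro b₁ ⟨a₁, ha₁, h₁⟩ b₂ ⟨a₂, ha₂, h₂⟩ hb hrk c hc
    have ha : a₁ ≠ a₂ := by
      rintro rfl
      exact hb (hG.injective (mul_left_cancel (h₁.symm.trans h₂)))
    have hconj : ∀ x ∈ Submonoid.closure (g '' Y), ∀ a b : Gen e n, g a * D = D * g b →
        IsPrefix P (g a) x → IsPrefix P (g b) (D⁻¹ * x * D) := by
      intro x hx a b hab hax
      have hy := (hG.mem_closure_of_isPrefix hY (hG.gen_mem a) hax hx).2
      have hy' := hG.delta_inv_conj_mem hZ (Submonoid.closure_mono (Set.image_mono hYZ) hy)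
      refine isPrefix_iff.2 ⟨_, hG.closure_le Z hy', ?_⟩
      rw [← mul_left_cancel_iff (a := D), ← mul_assoc D (g b), ← hab]
      simp [mul_assoc, hD]
    have hj : g a₁ * comp g a₁ a₂ ∈ Submonoid.closure (g '' Y) :=
      mul_mem (Submonoid.subset_closure ⟨a₁, ha₁, rfl⟩) (hY.comp_mem g ha₁ ha₂ ha)
    have hj1 := hconj _ hj a₁ b₁ h₁ (isPrefix_mul _ (hG.closure_le Y (hY.comp_mem g ha₁ ha₂ ha)))
    have hj2 := hconj _ hj a₂ b₂ h₂ (by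
      rw [hG.satisfies.mul_comp ha]
      exact isPrefix_mul _ (hG.closure_le Y (hY.comp_mem g ha₂ ha₁ ha.symm)))
    have hjc := isPrefix_trans (isPrefix_mul _ (hG.gen_mem _)) (hG.level_isPrefix hb hrk hc hj1 hj2)
    have hjZ := hG.delta_inv_conj_mem hZ (Submonoid.closure_mono (Set.image_mono hYZ) hj)
    obtain ⟨hcZ, hp⟩ := hG.mem_closure_of_isPrefix hZ (hG.gen_mem c) hjc hjZ
    obtain ⟨a₃, ha₃, h₃⟩ := hG.exists_delta_mul hZ (hG.mem_of_gen_mem Z hZ c hcZ)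
    refine ⟨a₃, hG.mem_of_gen_mem Y hY a₃ (hG.mem_closure_of_isPrefix hY (hG.gen_mem a₃)
      (isPrefix_iff.2 ⟨_, hG.closure_le Z (hG.delta_conj_mem hZ hp), ?_⟩) hj).1, h₃⟩
    rw [← mul_right_cancel_iff (a := D), ← mul_assoc, ← mul_assoc, h₃]
    simp [mul_assoc, hD]
  · rw [Subgroup.closure_le]
    rintro _ ⟨b, ⟨a, ha, h⟩, rfl⟩
    rw [SetLike.mem_coe, mem_conjSubgroup, hG.ribbon_eq]
    have h1 := hG.delta_inv_conj_mem hY (Submonoid.subset_closure ⟨a, ha, rfl⟩ :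
      g a ∈ Submonoid.closure (g '' Y))
    convert closure_le_group g Y h1 using 1
    have h2 : g a = D * g b * D⁻¹ := by rw [← h, mul_inv_cancel_right]
    rw [h2]
    simp only [mul_inv_rev, inv_inv, mul_assoc, ← hZdef, ← hD]
  · intro x hx
    induction hx using Submonoid.closure_induction with
    | mem x hx =>
      obtain ⟨a, ha, rfl⟩ := hx
      obtain ⟨a₁, ha₁, b, _, h, h'⟩ := hG.exists_mul_ribbon hY (u := u) ha
      rw [mul_assoc, h, inv_mul_cancel_left]
      exact Submonoid.subset_closure ⟨b, ⟨a₁, ha₁, h'⟩, rfl⟩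
    | one => simp [one_mem]
    | mul x y _ _ hx hy => simpa [mul_assoc] using mul_mem hx hy

/-- A minimal positive conjugator either lies in the parabolic submonoid of the support or is a
ribbon. -/
theorem exists_conj_of_minimal (hsq : SquareFree P g) {l : List (Gen e n)} {c : G}
    (hc : IsMinimalPositiveConjugator P (l.map g).prod c) :
    ∃ Y', IsClosed Y' ∧ Subgroup.closure (g '' Y') ≤
        conjSubgroup (Subgroup.closure (g '' cl {a | a ∈ l})) c ∧
      c⁻¹ * (l.map g).prod * c ∈ Submonoid.closure (g '' Y') := by
  set Y := cl {a | a ∈ l} with hYdef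
  have hY : IsClosed Y := isClosed_cl _
  have hx : (l.map g).prod ∈ Submonoid.closure (g '' Y) :=
    prod_mem_closure fun a ha => subset_cl _ ha
  obtain ⟨u, hu⟩ := hG.exists_gen_isPrefix hc.1 hc.2.1
  by_cases huY : u ∈ Y
  · have hcY := (hG.mem_closure_of_isPrefix hY hc.1 (hG.isPrefix_of_minimal hc hu
      (hG.gen_isPrefix_delta huY) (hG.closure_le Y (hG.delta_inv_conj_mem hY hx)))
      (hG.delta_mem_closure hY)).1
    have hc' := closure_le_group g Y hcY
    refine ⟨Y, hY, fun y hy => ?_, ?_⟩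
    · exact mem_conjSubgroup.2 (mul_mem (mul_mem hc' hy) (inv_mem hc'))
    · exact hG.mem_closure_of_mem_group hY
        (mul_mem (mul_mem (inv_mem hc') (closure_le_group g Y hx)) hc') hc.2.2.1
  · obtain rfl := hG.eq_ribbon_of_minimal hsq huY hc hu
    obtain ⟨Y', h1, h2, h3⟩ := hG.exists_conj_ribbon hY u
    exact ⟨Y', h1, h2, h3 _ hx⟩

/-- A nontrivial positive conjugator has a minimal one as a prefix, by taking one of minimal
length. -/
theorem exists_minimal_isPrefix {x α : G} (hα : α ∈ P) (h1 : α ≠ 1) (hx : α⁻¹ * x * α ∈ P) :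
    ∃ c, IsMinimalPositiveConjugator P x c ∧ IsPrefix P c α := by
  induction hk : (len α).toNat using Nat.strong_induction_on generalizing α with
  | _ k ih =>
    by_cases hmin : ∀ h ∈ P, h ≠ 1 → IsPrefix P h α → h ≠ α → h⁻¹ * x * h ∉ P
    · exact ⟨α, ⟨hα, h1, hx, hmin⟩, isPrefix_refl α⟩
    · push Not at hmin
      obtain ⟨h, hP, hh1, hp, hne, hhx⟩ := hmin
      have h2 : len h < len α := by
        by_contra hlt
        exact hne (hG.eq_of_isPrefix_of_len hp (by omega))
      have h3 := hG.len_nonneg hP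
      obtain ⟨c, hc, hch⟩ := ih (len h).toNat (by omega) hP hh1 hhx rfl
      exact ⟨c, hc, isPrefix_trans hch hp⟩

/-- A positive conjugator is a product of minimal ones, each of which conjugates the parabolic
subgroup of the support to one that contains the support of the conjugated element. -/
theorem closure_le_conjSubgroup_of_mem (hsq : SquareFree P g) {l m : List (Gen e n)} {α : G}
    (hα : α ∈ P) (h : α⁻¹ * (l.map g).prod * α = (m.map g).prod) :
    Subgroup.closure (g '' cl {a | a ∈ m}) ≤
      conjSubgroup (Subgroup.closure (g '' cl {a | a ∈ l})) α := by
  induction hk : (len α).toNat using Nat.strong_induction_on generalizing α l with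
  | _ k ih =>
    by_cases h1 : α = 1
    · subst h1
      rw [hG.cl_eq_of_prod_eq (show (m.map g).prod = (l.map g).prod by rw [← h]; simp)]
      intro y hy
      rw [mem_conjSubgroup]
      simpa using hy
    · obtain ⟨c, hc, hcα⟩ := hG.exists_minimal_isPrefix hα h1 (h ▸ hG.prod_mem m)
      obtain ⟨β, hβ, rfl⟩ := isPrefix_iff.1 hcα
      obtain ⟨Y', hY', hconj, hmem⟩ := hG.exists_conj_of_minimal hsq hc
      obtain ⟨l', hl', hl⟩ := exists_word hmem
      have hlen := hG.len_mul c β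
      have hc1 : ¬ len c ≤ 0 := fun h => hc.2.1 (hG.eq_one_of_len hc.1 h)
      have hβ0 := hG.len_nonneg hβ
      have key := ih (len β).toNat (by omega) (l := l') (α := β) hβ (by
        rw [hl, ← h]; simp [mul_assoc]) rfl
      intro y hy
      have h2 := mem_conjSubgroup.1 (key hy)
      have h3 := mem_conjSubgroup.1 (hconj (Subgroup.closure_mono
        (Set.image_mono (cl_subset hY' hl')) h2))
      rw [mem_conjSubgroup]
      simpa [mul_assoc] using h3

/-- An arbitrary conjugator becomes positive when multiplied by a central element. -/
theorem closure_le_conjSubgroup (hsq : SquareFree P g) {l m : List (Gen e n)} {α : G}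
    (h : α⁻¹ * (l.map g).prod * α = (m.map g).prod) :
    Subgroup.closure (g '' cl {a | a ∈ m}) ≤
      conjSubgroup (Subgroup.closure (g '' cl {a | a ∈ l})) α := by
  obtain ⟨z, _, hz, hzα⟩ := hG.exists_central_mul α
  have hc : ∀ y, z * y * z⁻¹ = y := fun y => by rw [← hz, mul_inv_cancel_right]
  have h1 := hG.closure_le_conjSubgroup_of_mem hsq (l := l) (m := m) hzα (by
    rw [← h, mul_inv_rev]
    have : z⁻¹ * (l.map g).prod * z = (l.map g).prod := by
      rw [mul_assoc, hz, inv_mul_cancel_left]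
    calc α⁻¹ * z⁻¹ * (l.map g).prod * (z * α) = α⁻¹ * (z⁻¹ * (l.map g).prod * z) * α := by
          simp only [mul_assoc]
      _ = _ := by rw [this])
  intro y hy
  have h2 := mem_conjSubgroup.1 (h1 hy)
  rw [mem_conjSubgroup, ← hc (α * y * α⁻¹)]
  simpa [mul_assoc] using h2

/-- One inclusion is applied to `α`, the other to `α⁻¹`. -/
theorem conjSubgroup_closure (hsq : SquareFree P g) {l m : List (Gen e n)} {α : G}
    (h : α⁻¹ * (l.map g).prod * α = (m.map g).prod) :
    conjSubgroup (Subgroup.closure (g '' cl {a | a ∈ l})) α =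
      Subgroup.closure (g '' cl {a | a ∈ m}) := by
  refine le_antisymm (fun y hy => ?_) (hG.closure_le_conjSubgroup hsq h)
  have h1 := hG.closure_le_conjSubgroup hsq (l := m) (m := l) (α := α⁻¹) (by
    rw [← h]; simp [mul_assoc]) (mem_conjSubgroup.1 hy)
  rw [mem_conjSubgroup] at h1
  simpa [mul_assoc] using h1

/-- The numerator `b` and denominator `a` of the reduced fraction `a⁻¹ b` of a positive element `x`
are `x` and `1`. -/
theorem exists_word_of_isSupport {x : G} (hx : x ∈ P) {S : Set G}
    (hS : IsSupport P (deltaSet P (g '' Set.univ)) x S) :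
    ∃ l : List (Gen e n), (l.map g).prod = x ∧ S = g '' cl {a | a ∈ l} := by
  obtain ⟨a, ha, b, hb, rfl, hm, la, lb, hla, hlb, rfl, rfl, rfl⟩ := hS
  have h1 : la.prod = 1 := by
    have h2 := hm.2.2 la.prod (isPrefix_refl _) hx
    exact hG.eq_one_of_len ha (by simpa [hG.len_one] using hG.len_le h2)
  rw [hG.atoms_eq] at hla hlb
  have h2 : la = [] := by
    cases la with
    | nil => rfl
    | cons y la =>
      have := hG.length_le_len (y :: la) (fun z hz => by
        obtain ⟨c, rfl⟩ := hla z hz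
        exact ⟨hG.gen_mem c, hG.gen_ne_one c⟩)
      rw [h1, hG.len_one, List.length_cons] at this
      omega
  obtain ⟨l, rfl⟩ : ∃ l : List (Gen e n), l.map g = lb := by
    rw [← Set.mem_range, Set.range_list_map]
    exact hlb
  subst h2
  refine ⟨l, by simp, ?_⟩
  rw [← hG.satClosure_eq]
  congr 1
  ext y
  simp

theorem isSupportPreserving (hsq : SquareFree P g) :
    IsSupportPreserving P (deltaSet P (g '' Set.univ)) := by
  intro y hy z hz α h S T hS hT
  obtain ⟨l, rfl, rfl⟩ := hG.exists_word_of_isSupport hy hS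
  obtain ⟨m, rfl, rfl⟩ := hG.exists_word_of_isSupport hz hT
  rw [hG.parabolic_eq, hG.parabolic_eq, (isClosed_cl _).cl_eq, (isClosed_cl _).cl_eq]
  exact hG.conjSubgroup_closure hsq h

theorem isRho_and_eq_ribbon (hsq : SquareFree P g) {x : G} (hx : x ∈ P) {S : Set G}
    (hS : IsSupport P (deltaSet P (g '' Set.univ)) x S) {u : Gen e n} (hu : g u ∉ S) {c : G}
    (hc : IsMinimalPositiveConjugator P x c) (huc : IsPrefix P (g u) c) :
    IsRho P (g u) x c ∧ c = ribbon P S (g u) := by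
  obtain ⟨l, rfl, rfl⟩ := hG.exists_word_of_isSupport hx hS
  exact ⟨hG.isRho_of_minimal hc huc,
    hG.eq_ribbon_of_minimal hsq (fun h => hu ⟨u, h, rfl⟩) hc huc⟩

end System

end CorranPicantin

namespace CorranPicantin

open Garside

/-- The generators of rank at most `k`. -/
def rkLE (e n k : ℕ) : Set (Gen e n) := {a | a.rk ≤ k}

theorem isClosed_rkLE (e n k : ℕ) : IsClosed (rkLE e n k) := by
  intro a ha b _ _ _ c hc
  exact hc.trans_le ha

theorem rkLE_mono {e n k l : ℕ} (h : k ≤ l) : rkLE e n k ⊆ rkLE e n l := fun _ ha => le_trans ha h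

theorem Gen.t_zero_ne_t_one {e n : ℕ} (he : e ≠ 1) : (.t 0 : Gen e n) ≠ .t 1 := by
  intro h
  have h1 : (0 : ZMod e) = 1 := by simpa using h
  have : Fact (1 < e) ∨ e = 0 := by
    rcases Nat.lt_or_ge 1 e with h | h
    · exact .inl ⟨h⟩
    · exact .inr (by omega)
  rcases this with h' | rfl
  · exact zero_ne_one h1
  · exact absurd h1 (by decide)

section

variable {e n : ℕ} {N : Type*} [Monoid N] (g : Gen e n → N)

theorem sGen_mem_closure (k : ℕ) : sGen g k ∈ Submonoid.closure (g '' rkLE e n k) := by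
  unfold sGen
  split_ifs
  · exact Submonoid.subset_closure ⟨_, show Gen.rk (.s k _ _ : Gen e n) ≤ k from le_rfl, rfl⟩
  · exact one_mem _

theorem factor_mem_closure (k : ℕ) : factor g k ∈ Submonoid.closure (g '' rkLE e n (k + 2)) := by
  induction k with
  | zero =>
    have h : ∀ i, g (.t i) ∈ Submonoid.closure (g '' rkLE e n 2) := fun i =>
      Submonoid.subset_closure ⟨_, show Gen.rk (.t i : Gen e n) ≤ 2 from le_rfl, rfl⟩
    unfold factor
    split_ifs
    · exact h 0
    · exact mul_mem (h 0) (h 1)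
  | succ k ih =>
    have h1 := sGen_mem_closure g (k + 3)
    have h2 : factor g k ∈ Submonoid.closure (g '' rkLE e n (k + 3)) :=
      Submonoid.closure_mono (Set.image_mono (rkLE_mono (by omega))) ih
    unfold factor
    split_ifs
    · exact mul_mem (mul_mem h1 h2) (one_mem _)
    · exact mul_mem (mul_mem h1 h2) h1

theorem partialDelta_mem_closure (k : ℕ) :
    partialDelta g k ∈ Submonoid.closure (g '' rkLE e n (k + 1)) := by
  induction k with
  | zero => exact one_mem _
  | succ k ih =>
    exact mul_mem (Submonoid.closure_mono (Set.image_mono (rkLE_mono (by omega))) ih)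
      (factor_mem_closure g k)

end

namespace System

variable {e n : ℕ} {G : Type*} [Group G] {P : Submonoid G} {g : Gen e n → G} {len : G → ℤ}
  (hG : System P g len)
include hG

/-! ### The Garside element as a least common multiple -/

theorem factor_mem (k : ℕ) : factor g k ∈ P := hG.closure_le _ (factor_mem_closure g k)

theorem partialDelta_mem (k : ℕ) : partialDelta g k ∈ P :=
  hG.closure_le _ (partialDelta_mem_closure g k)

/-- A letter `u` that divides a product `z c`, where all letters of `z` have smaller rank than `u`,
divides `c`. -/
theorem isPrefix_of_rk_lt {k : ℕ} {u : Gen e n} (hu : k < u.rk) {z c : G}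
    (hz : z ∈ Submonoid.closure (g '' rkLE e n k)) (hc : c ∈ P) (h : IsPrefix P (g u) (z * c)) :
    IsPrefix P (g u) c := by
  refine hG.gen_isPrefix_of_mul_mem (Y := rkLE e n k) (fun h' => ?_) (fun a ha hr => ?_) hz hc h
  · exact absurd h' (not_le.2 hu)
  · exact absurd (hr ▸ ha : u.rk ≤ k) (not_le.2 hu)

theorem mul_isPrefix_of_adj {a b : Gen e n} (hab : a.rk + 1 = b.rk ∨ b.rk + 1 = a.rk) {m : G}
    (hm : m ∈ P) (h : IsPrefix P (g b) (g a * m)) : IsPrefix P (g b * g a) m := by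
  have hne : a ≠ b := by rintro rfl; omega
  have := hG.comp_lcm a b _ hne (isPrefix_mul _ hm) h
  rwa [comp_of_adj _ hab, isPrefix_mul_left_iff] at this

/-- If the letter `s_k` divides the product of the factor with index `k - 1` and a positive element
`m`, then the factor with index `k` divides `m`. -/
theorem factor_succ_isPrefix {k : ℕ} (hk : k + 3 ≤ n) {m : G} (hm : m ∈ P)
    (h : IsPrefix P (sGen g (k + 3)) (factor g k * m)) : IsPrefix P (factor g (k + 1)) m := by
  induction k generalizing m with
  | zero =>
    rw [sGen_of_mem le_rfl hk] at h
    by_cases he : e = 1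
    · rw [factor_succ_of_one he, sGen_of_mem le_rfl hk]
      simp only [factor, he, if_true] at h ⊢
      exact hG.mul_isPrefix_of_adj (by simp) hm h
    · rw [factor_succ_of_ne he, sGen_of_mem le_rfl hk]
      simp only [factor, he, if_false] at h ⊢
      have ht : ∀ i x, g (.t i) * (g (.t (i + 1)) * x) = g (.t 0) * (g (.t 1) * x) :=
        fun i x => by
          simpa only [mul_assoc, zero_add] using congrArg (· * x) (hG.satisfies.t_mul_t i 0)
      have hb := hG.satisfies.braid (.t 1) (.s 3 le_rfl hk) (by simp)
      rw [mul_assoc] at h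
      have h1 := hG.mul_isPrefix_of_adj (by simp) (mul_mem (hG.gen_mem _) hm) h
      have h2 := hG.mul_isPrefix_of_adj (by simp) hm
        (isPrefix_trans (isPrefix_mul _ (hG.gen_mem _)) h1)
      obtain ⟨p, hp, rfl⟩ := isPrefix_iff.1 h2
      rw [← mul_assoc, hb] at h1
      simp only [mul_assoc] at h1 ⊢
      rw [isPrefix_mul_left_iff] at h1
      have h3 := hG.level_isPrefix (c := .t 1) (Gen.t_zero_ne_t_one he) rfl rfl h1
        (isPrefix_mul _ (mul_mem (hG.gen_mem _) hp))
      rw [isPrefix_mul_left_iff] at h3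
      have h4 := hG.mul_isPrefix_of_adj (by simp [Gen.shift]) hp h3
      rw [isPrefix_mul_left_iff, ← ht 1, isPrefix_mul_left_iff]
      exact h4
  | succ k ih =>
    have ha := sGen_of_mem (g := g) (k := k + 4) (by omega) hk
    have hb := sGen_of_mem (g := g) (k := k + 3) (by omega) (by omega)
    have hfar : ∀ {z}, z ∈ P → IsPrefix P (sGen g (k + 4)) (factor g k * z) →
        IsPrefix P (sGen g (k + 4)) z := fun hz h => by
      rw [ha] at h ⊢
      exact hG.isPrefix_of_rk_lt (by simp) (factor_mem_closure g k) hz h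
    have hadj : ∀ {z}, z ∈ P → IsPrefix P (sGen g (k + 4)) (sGen g (k + 3) * z) →
        IsPrefix P (sGen g (k + 4) * sGen g (k + 3)) z := fun hz h => by
      rw [ha, hb] at h ⊢
      exact hG.mul_isPrefix_of_adj (by simp) hz h
    have haP : sGen g (k + 4) ∈ P := ha ▸ hG.gen_mem _
    have hbP : sGen g (k + 3) ∈ P := hb ▸ hG.gen_mem _
    have hF := hG.factor_mem k
    have hbr : ∀ x, sGen g (k + 3) * (sGen g (k + 4) * (sGen g (k + 3) * x)) =
        sGen g (k + 4) * (sGen g (k + 3) * (sGen g (k + 4) * x)) := fun x => by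
      simpa only [mul_assoc] using
        congrArg (· * x) (hG.satisfies.sGen_braid (k := k + 3) (by omega) (by omega))
    have hc : ∀ x, factor g k * (sGen g (k + 4) * x) = sGen g (k + 4) * (factor g k * x) :=
      fun x => by rw [← mul_assoc, ← hG.satisfies.sGen_mul_factor (by omega), mul_assoc]
    by_cases he : e = 1
    · rw [factor_succ_of_one he] at h ⊢
      rw [mul_assoc] at h
      have h1 := hadj (mul_mem hF hm) h
      obtain ⟨m', hm', rfl⟩ := isPrefix_iff.1
        (hfar hm (isPrefix_trans (isPrefix_mul _ hbP) h1))
      rw [hc, isPrefix_mul_left_iff] at h1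
      exact isPrefix_mul_left_iff.2 (ih (by omega) hm' h1)
    · rw [factor_succ_of_ne he] at h ⊢
      simp only [mul_assoc] at h
      have h1 := hadj (mul_mem hF (mul_mem hbP hm)) h
      have h2 := hadj hm (hfar (mul_mem hbP hm) (isPrefix_trans (isPrefix_mul _ hbP) h1))
      obtain ⟨m₂, hm₂, rfl⟩ := isPrefix_iff.1 h2
      rw [mul_assoc, hbr, hc, isPrefix_mul_left_iff] at h1
      have h3 := ih (by omega) (mul_mem hbP (mul_mem haP hm₂)) h1
      obtain ⟨y, hy, h4⟩ := isPrefix_iff.1 h3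
      rw [factor_succ_of_ne he, mul_assoc, mul_assoc, mul_right_inj] at h4
      have h5 := hadj hy (hfar (mul_mem hbP hy) (h4 ▸ isPrefix_mul _ hm₂))
      obtain ⟨y₃, hy₃, rfl⟩ := isPrefix_iff.1 h5
      rw [mul_assoc, hbr, hc, mul_right_inj] at h4
      rw [h4, factor_succ_of_ne he]
      simp only [← mul_assoc]
      exact isPrefix_mul _ hy₃

/-- The product of the first `k + 1` factors divides every common multiple of the letters of rank at
most `k + 2`, by induction: once the factors before the last two are cancelled, the last letter
still divides the multiple, so that `factor_succ_isPrefix` applies. -/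
theorem partialDelta_isPrefix {k : ℕ} (hk : k + 2 ≤ n) {m : G} (hm : m ∈ P)
    (h : ∀ a ∈ rkLE e n (k + 2), IsPrefix P (g a) m) : IsPrefix P (partialDelta g (k + 1)) m := by
  induction k with
  | zero =>
    simp only [partialDelta, factor, one_mul]
    split_ifs with he
    · exact h _ (show Gen.rk (.t 0 : Gen e n) ≤ 2 from le_rfl)
    · have := hG.level_isPrefix (c := .t 0) (Gen.t_zero_ne_t_one he) rfl rfl
        (h _ (show Gen.rk (.t 0 : Gen e n) ≤ 2 from le_rfl))
        (h _ (show Gen.rk (.t 1 : Gen e n) ≤ 2 from le_rfl))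
      simpa [Gen.shift] using this
  | succ k ih =>
    obtain ⟨p, hp, rfl⟩ := isPrefix_iff.1
      (ih (by omega) fun a ha => h a (rkLE_mono (by omega) ha))
    rw [partialDelta, isPrefix_mul_left_iff]
    refine hG.factor_succ_isPrefix hk hp ?_
    have h1 := h (.s (k + 3) (by omega) hk) (show k + 3 ≤ k + 1 + 2 by omega)
    rw [partialDelta, mul_assoc] at h1
    rw [sGen_of_mem (by omega) hk]
    exact hG.isPrefix_of_rk_lt (by simp) (partialDelta_mem_closure g k)
      (mul_mem (hG.factor_mem k) hp) h1

theorem gen_isPrefix_partialDelta {k : ℕ} {a : Gen e n} (ha : a ∈ rkLE e n (k + 2)) :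
    IsPrefix P (g a) (partialDelta g (k + 1)) := by
  -- divisibility is trivial in the group, so the relations are used in the monoid `P`
  have hs : Satisfies fun a => (⟨g a, hG.gen_mem a⟩ : P) :=
    ⟨fun a b h => Subtype.ext (hG.satisfies.comm a b h),
      fun a b h => Subtype.ext (hG.satisfies.braid a b h),
      fun a b h h' => Subtype.ext (hG.satisfies.shift a b h h')⟩
  have hmap : ∀ k, ((partialDelta (fun a => (⟨g a, hG.gen_mem a⟩ : P)) k : P) : G) =
      partialDelta g k := by
    have hS : ∀ k, ((sGen (fun a => (⟨g a, hG.gen_mem a⟩ : P)) k : P) : G) = sGen g k := by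
      intro k
      unfold sGen
      split_ifs <;> rfl
    have hF : ∀ k, ((factor (fun a => (⟨g a, hG.gen_mem a⟩ : P)) k : P) : G) = factor g k := by
      intro k
      induction k with
      | zero => unfold factor; split_ifs <;> rfl
      | succ k ih =>
        unfold factor
        split_ifs <;> simp [hS, ih]
    intro k
    induction k with
    | zero => rfl
    | succ k ih => simp [partialDelta, ih, hF]
  obtain ⟨q, hq⟩ := hs.dvd_partialDelta a ha
  rw [← hmap, hq]
  exact isPrefix_mul _ q.2

theorem deltaSet_rkLE {k : ℕ} (hk : k + 2 ≤ n) :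
    deltaSet P (g '' rkLE e n (k + 2)) = partialDelta g (k + 1) := by
  refine hG.deltaSet_eq ⟨hG.partialDelta_mem _, ?_, fun m hm h => ?_⟩
  · rintro _ ⟨a, ha, rfl⟩
    exact hG.gen_isPrefix_partialDelta ha
  · exact hG.partialDelta_isPrefix hk hm fun a ha => h _ ⟨a, ha, rfl⟩

theorem deltaSet_univ (hn : 2 ≤ n) : deltaSet P (g '' Set.univ) = partialDelta g (n - 1) := by
  obtain ⟨k, rfl⟩ : ∃ k, n = k + 2 := ⟨n - 2, by omega⟩
  rw [← Set.eq_univ_of_forall (s := rkLE e (k + 2) (k + 2)) fun a => a.rk_le hn]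
  exact hG.deltaSet_rkLE le_rfl

/-! ### The Garside element is square-free -/

/-- If `x` conjugates the letter `a` to the letter `b`, and `a` does not divide `x`, then `x b` is
the join of `a` and `x`. -/
theorem gen_isPrefix_of_conj {a b : Gen e n} {x y : G} (hy : y ∈ P) (h : g a * x = x * g b)
    (hx : x ∈ P) (hax : ¬ IsPrefix P (g a) x) (hay : IsPrefix P (g a) (x * y)) :
    IsPrefix P (g b) y := by
  obtain ⟨m, h1, h2, h3⟩ := hG.exists_join (g a) x
  have h4 := h3 _ (h ▸ isPrefix_mul _ hx) (isPrefix_mul x (hG.gen_mem b))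
  have h5 := h3 _ hay (isPrefix_mul _ hy)
  rw [hG.eq_of_isPrefix_of_len h4 ?_, isPrefix_mul_left_iff] at h5
  · exact h5
  · rw [hG.len_mul, hG.len_gen]
    by_contra hlt
    exact hax (hG.eq_of_isPrefix_of_len h2 (by omega) ▸ h1)

/-- If `t_i` divides `s_k F s_k`, where `F` is the preceding factor, then it divides `F s_k`. But
`F` conjugates `t_i` to some `t_j`, which does not divide `s_k`. -/
theorem not_t_isPrefix_factor (he : e ≠ 1) {k : ℕ} (hk : k + 3 ≤ n) (i : ZMod e) :
    ¬ IsPrefix P (g (.t i)) (factor g (k + 1)) := by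
  induction k generalizing i with
  | zero =>
    intro h
    have h0 := hG.satisfies.t_mul_t 0 i
    rw [zero_add] at h0
    rw [factor_succ_of_ne he, sGen_of_mem le_rfl hk] at h
    simp only [factor, he, if_false] at h
    have h1 := hG.mul_isPrefix_of_adj (by simp)
      (mul_mem (mul_mem (hG.gen_mem _) (hG.gen_mem _)) (hG.gen_mem _)) h
    rw [h0, mul_assoc, isPrefix_mul_left_iff] at h1
    have h2 := hG.len_le (hG.mul_isPrefix_of_adj (by simp) (hG.gen_mem _) h1)
    rw [hG.len_mul, hG.len_gen, hG.len_gen] at h2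
    omega
  | succ k ih =>
    intro h
    have hs := sGen_of_mem (g := g) (k := k + 4) (by omega) hk
    rw [factor_succ_of_ne he, hs] at h
    have h1 := hG.gen_isPrefix_of_mul (by simp) (fun h => by simp at h)
      (mul_mem (hG.factor_mem _) (hG.gen_mem _)) h
    obtain ⟨j, hj⟩ := hG.satisfies.t_mul_factor he (k := k + 1) (by omega) i
    have h2 := hG.gen_isPrefix_of_conj (hG.gen_mem _) hj (hG.factor_mem _) (ih (by omega) i) h1
    simpa using hG.eq_of_gen_isPrefix h2

/-- The factor `s_k ⋯ s_3 t_0` is divisible by no letter of smaller rank than `s_k`. -/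
theorem not_isPrefix_factor_of_one (he : e = 1) {k : ℕ} (hk : k + 3 ≤ n) {v : Gen e n}
    (hv : v.rk ≤ k + 2) : ¬ IsPrefix P (g v) (factor g (k + 1)) := by
  induction k generalizing v with
  | zero =>
    intro h
    obtain ⟨i, rfl⟩ := Gen.exists_t_of_rk (le_antisymm hv v.two_le_rk)
    rw [factor_succ_of_one he, sGen_of_mem le_rfl hk] at h
    simp only [factor, he, if_true] at h
    have h2 := hG.len_le (hG.mul_isPrefix_of_adj (by simp) (hG.gen_mem _) h)
    rw [hG.len_mul, hG.len_gen, hG.len_gen, hG.len_gen] at h2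
    omega
  | succ k ih =>
    intro h
    rw [factor_succ_of_one he, sGen_of_mem (by omega) hk] at h
    by_cases hv' : v.rk ≤ k + 2
    · refine ih (by omega) hv' (hG.gen_isPrefix_of_mul ?_ ?_ (hG.factor_mem _) h)
      · intro h'
        simp [← h'] at hv'
      · intro hr
        simp at hr
        omega
    · have h3 : 3 ≤ k + 3 := by omega
      have hn : k + 3 ≤ n := by omega
      obtain rfl : v = .s (k + 3) h3 hn := Gen.eq_of_rk_eq (by simp; omega) (by omega)
      have h1 := hG.mul_isPrefix_of_adj (by simp) (hG.factor_mem _) h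
      rw [factor_succ_of_one he, sGen_of_mem (by omega) (by omega), isPrefix_mul_left_iff] at h1
      have h2 := hG.mem_of_gen_mem _ (isClosed_rkLE e n (k + 2)) _
        (hG.mem_closure_of_isPrefix (isClosed_rkLE e n (k + 2)) (hG.gen_mem _) h1
          (factor_mem_closure g k)).1
      have h3 : k + 3 + 1 ≤ k + 2 := h2
      omega

/-- By induction on the number of factors. Write `D` for the product of the first factors, `F` for
the next factor, and `D = t_i E`. If `t_i²` divides `D F`, but not `D`, then the letter to which `D`
conjugates `t_i` divides `F`. -/
theorem not_t_sq_isPrefix {k : ℕ} (hk : k + 2 ≤ n) (i : ZMod e) :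
    ¬ IsPrefix P (g (.t i) * g (.t i)) (partialDelta g (k + 1)) := by
  induction k with
  | zero =>
    intro h
    simp only [partialDelta, factor, one_mul] at h
    split_ifs at h with he
    · have := hG.len_le h
      rw [hG.len_mul, hG.len_gen, hG.len_gen] at this
      omega
    · have h0 := hG.satisfies.t_mul_t 0 i
      rw [zero_add] at h0
      rw [h0, isPrefix_mul_left_iff] at h
      exact Gen.shift_ne (Gen.t_zero_ne_t_one (n := n) he) rfl
        (by simpa [Gen.shift] using hG.eq_of_gen_isPrefix h)
  | succ k ih =>
    intro h
    have ih := ih (by omega)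
    have hti : (.t i : Gen e n) ∈ rkLE e n (k + 2) := by simp [rkLE]
    obtain ⟨b, hb, hbD⟩ := hG.exists_mul_delta (isClosed_rkLE e n (k + 2)) hti
    rw [hG.deltaSet_rkLE (by omega)] at hbD
    obtain ⟨E, hE, hDE⟩ := isPrefix_iff.1 (hG.gen_isPrefix_partialDelta hti)
    rw [partialDelta, hDE, mul_assoc, isPrefix_mul_left_iff] at h
    rw [hDE, isPrefix_mul_left_iff] at ih
    have hbF : IsPrefix P (g b) (factor g (k + 1)) := by
      refine hG.gen_isPrefix_of_conj (hG.factor_mem _) ?_ hE ih h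
      rw [hDE, mul_assoc, mul_right_inj] at hbD
      exact hbD
    by_cases he : e = 1
    · exact hG.not_isPrefix_factor_of_one he hk hb hbF
    · have hconj : ∀ l, l + 1 ≤ n → ∃ j, g (.t i) * partialDelta g l =
          partialDelta g l * g (.t j) := by
        intro l
        induction l with
        | zero => exact fun _ => ⟨i, by simp [partialDelta]⟩
        | succ l ihl =>
          intro hl
          obtain ⟨j, hj⟩ := ihl (by omega)
          obtain ⟨j', hj'⟩ := hG.satisfies.t_mul_factor he (k := l) (by omega) j
          exact ⟨j', by rw [partialDelta, ← mul_assoc, hj, mul_assoc, hj', mul_assoc]⟩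
      obtain ⟨j, hj⟩ := hconj (k + 1) (by omega)
      rw [hj, mul_right_inj] at hbD
      obtain rfl := hG.injective hbD
      exact hG.not_t_isPrefix_factor he hk j hbF

/-- If `a² ≼ Δ` for braided letters `a` and `b`, then `Δ = a b a w`, and `a ≼ b a w` implies `b ≼
w`, so that `Δ = b a b b w'` has a factor `b²`. -/
theorem sq_isPrefix_of_adj {a b : Gen e n} (hab : a.rk + 1 = b.rk ∨ b.rk + 1 = a.rk)
    (h : IsPrefix P (g a * g a) (deltaSet P (g '' Set.univ))) :
    IsPrefix P (g b * g b) (deltaSet P (g '' Set.univ)) := by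
  have hne : a ≠ b := by rintro rfl; omega
  have h1 := hG.comp_lcm a b _ hne (hG.gen_isPrefix_delta (Set.mem_univ a))
    (hG.gen_isPrefix_delta (Set.mem_univ b))
  obtain ⟨w, hw, hΔ⟩ := isPrefix_iff.1 h1
  rw [comp_of_adj _ hab, mul_assoc, mul_assoc] at hΔ
  rw [hΔ, isPrefix_mul_left_iff] at h
  have h2 := hG.mul_isPrefix_of_adj hab.symm (mul_mem (hG.gen_mem a) hw) h
  rw [isPrefix_mul_left_iff] at h2
  obtain ⟨w', hw', rfl⟩ := isPrefix_iff.1 h2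
  refine hG.sq_isPrefix_of_eq (x := g b * g a) (mul_mem (hG.gen_mem b) (hG.gen_mem a)) hw' ?_
  rw [hΔ]
  have hbr := hG.satisfies.braid a b hab
  calc _ = g b * (g a * g b) * (g b * w') := by simp only [mul_assoc]
    _ = _ := by rw [← hbr]; simp only [mul_assoc]

/-- For the `s_k`, going down along the braid relations leads to the square of `t_0`. -/
theorem squareFree (hn : 2 ≤ n) : SquareFree P g := by
  intro a
  induction hk : a.rk generalizing a with
  | zero => have := a.two_le_rk; omega
  | succ k ih =>
    intro h
    cases a with
    | t i =>
      rw [hG.deltaSet_univ hn, show n - 1 = (n - 2) + 1 by omega] at h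
      exact hG.not_t_sq_isPrefix (by omega) i h
    | s l h3 hl =>
      simp only [Gen.rk_s] at hk
      rcases Nat.eq_or_lt_of_le h3 with rfl | h4
      · exact ih (.t 0) (by simp; omega) (hG.sq_isPrefix_of_adj (by simp) h)
      · exact ih (.s (l - 1) (by omega) (by omega)) (by simp; omega)
          (hG.sq_isPrefix_of_adj (by simp; omega) h)

end System

end CorranPicantin

namespace CorranPicantin

open Garside

/-! ### The braid group of `G(e,e,n)` -/

section

variable {e n : ℕ}

/-- Word length, which is well defined on the braid group as the relations are homogeneous. -/
def blenHom (e n : ℕ) : Braid e n →* Multiplicative ℤ :=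
  PresentedGroup.toGroup (f := fun _ => Multiplicative.ofAdd 1) (by
    rintro _ ⟨u, v, h, rfl⟩
    have key : ∀ x : FreeMonoid (Gen e n), FreeGroup.lift (fun _ : Gen e n =>
        Multiplicative.ofAdd (1 : ℤ)) (FreeMonoid.lift FreeGroup.of x) =
          Multiplicative.ofAdd (x.length : ℤ) := by
      intro x
      induction x using FreeMonoid.inductionOn' with
      | one => simp
      | of_mul a x ih => simp [ih, FreeMonoid.length_mul, ofAdd_add]
    rw [map_mul, map_inv, key, key, h.length_eq, mul_inv_cancel])

/-- The length of an element of the braid group. -/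
def blen (x : Braid e n) : ℤ := (blenHom e n x).toAdd

theorem isPrefix_toBraid_iff (he : e ≠ 0) (hn : 2 ≤ n) {x y : StdMonoid e n} :
    IsPrefix (pos e n) (toBraid e n x) (toBraid e n y) ↔ x ∣ y := by
  rw [isPrefix_iff]
  constructor
  · rintro ⟨_, ⟨p, rfl⟩, h⟩
    rw [← map_mul] at h
    exact ⟨p, toBraid_injective he hn h⟩
  · rintro ⟨p, rfl⟩
    exact ⟨_, ⟨p, rfl⟩, map_mul _ _ _⟩

theorem closure_gen_image (X : Set (Gen e n)) :
    Submonoid.closure (gen '' X) = (Submonoid.closure (mgen '' X)).map (toBraid e n) := by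
  rw [MonoidHom.map_mclosure, Set.image_image]
  rfl

theorem toBraid_mem_closure_iff (he : e ≠ 0) (hn : 2 ≤ n) {X : Set (Gen e n)}
    {x : StdMonoid e n} : toBraid e n x ∈ Submonoid.closure (gen '' X) ↔
      x ∈ Submonoid.closure (mgen '' X) := by
  rw [closure_gen_image]
  exact Submonoid.mem_map_iff_mem (toBraid_injective he hn)

theorem toBraid_comp (a b : Gen e n) : toBraid e n (comp mgen a b) = comp gen a b := by
  unfold comp
  split_ifs <;> simp

/-- Every element divides a power of a central element that is divisible by all generators. -/
theorem exists_common_multiple (he : e ≠ 0) (hn : 2 ≤ n) (x y : StdMonoid e n) :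
    ∃ m, x ∣ m ∧ y ∣ m := by
  obtain ⟨z, hz, hc⟩ := exists_central (n := n) he hn
  have h : ∀ k (x : StdMonoid e n), mlen x = k → x ∣ z ^ k := by
    intro k
    induction k with
    | zero => exact fun x hx => by rw [eq_one_of_mlen hx]; exact one_dvd _
    | succ k ih =>
      intro x hx
      obtain ⟨a, y, rfl⟩ := exists_mgen_mul_of_mlen (by omega : mlen x ≠ 0)
      obtain ⟨p, hp⟩ := ih y (by simp at hx; omega)
      obtain ⟨q, hq⟩ := hz a
      have hpow : ∀ x, x * z ^ k = z ^ k * x := fun x =>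
        Commute.pow_right (show Commute x z from hc x) k
      have h1 : z * z ^ k = mgen a * (q * z ^ k) := by
        nth_rewrite 1 [hq]
        rw [mul_assoc]
      exact ⟨p * q, by rw [pow_succ', h1, hpow, hp, mul_assoc, mul_assoc]⟩
  obtain ⟨p, hp⟩ := h _ x rfl
  obtain ⟨q, hq⟩ := h _ y rfl
  refine ⟨z ^ mlen x * z ^ mlen y, Dvd.dvd.mul_right (h _ x rfl) _, ?_⟩
  rw [← pow_add, add_comm, pow_add]
  exact Dvd.dvd.mul_right (h _ y rfl) _

theorem system (he : e ≠ 0) (hn : 2 ≤ n) : System (pos e n) gen (blen (e := e) (n := n)) where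
  finite := finite_gen he
  satisfies := satisfies_gen e n
  closure_eq := by
    rw [← Set.image_univ, closure_gen_image, pos, MonoidHom.mrange_eq_map]
    congr 1
    rw [eq_top_iff]
    exact fun x _ => mem_closure_univ x
  closure_group := PresentedGroup.closure_range_of _
  len_mul x y := by simp [blen]
  len_gen a := by simp [blen, blenHom, gen]
  mem_of_gen_mem X hX a h := mem_of_mgen_mem hX ((toBraid_mem_closure_iff he hn).1 h)
  mem_of_mul_mem X hX := by
    rintro _ ⟨x, rfl⟩ _ ⟨y, rfl⟩ h
    rw [← map_mul, toBraid_mem_closure_iff he hn] at h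
    rw [toBraid_mem_closure_iff he hn, toBraid_mem_closure_iff he hn]
    exact mem_closure_mgen_of_mul hX h
  comp_lcm a b m hab ha hb := by
    obtain ⟨_, ⟨x, rfl⟩, rfl⟩ := isPrefix_iff.1 ha
    obtain ⟨_, ⟨y, rfl⟩, h⟩ := isPrefix_iff.1 hb
    rw [← toBraid_mgen, ← toBraid_mgen, ← map_mul, ← map_mul] at h
    rcases compRel_of_eq (toBraid_injective he hn h) with ⟨h, _⟩ | ⟨_, z, rfl, _⟩
    · exact absurd h hab
    · rw [isPrefix_mul_left_iff, ← toBraid_comp, isPrefix_toBraid_iff he hn]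
      exact Dvd.intro _ rfl
  join X hX x hx y hy := by
    rw [closure_gen_image] at hx hy
    obtain ⟨x, hx, rfl⟩ := hx
    obtain ⟨y, hy, rfl⟩ := hy
    obtain ⟨m, hxm, hym⟩ := exists_common_multiple he hn x y
    obtain ⟨l, hl, h1, h2, h3⟩ := exists_lcm_of_common hX hx hy hxm hym
    refine ⟨toBraid e n l, (toBraid_mem_closure_iff he hn).2 hl,
      (isPrefix_toBraid_iff he hn).2 h1, (isPrefix_toBraid_iff he hn).2 h2, fun c hxc hyc => ?_⟩
    obtain ⟨c, rfl⟩ := mem_of_isPrefix hxc ⟨x, rfl⟩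
    rw [isPrefix_toBraid_iff he hn] at hxc hyc ⊢
    exact h3 c hxc hyc
  central := by
    obtain ⟨z, hz, hc⟩ := exists_central (n := n) he hn
    refine ⟨toBraid e n z, fun a => (isPrefix_toBraid_iff he hn).2 (hz a), fun x => ?_⟩
    have hx : x ∈ Subgroup.closure (Set.range (gen (e := e) (n := n))) :=
      PresentedGroup.closure_range_of (relators e n) ▸ Subgroup.mem_top x
    have hle : Subgroup.closure (Set.range (gen (e := e) (n := n))) ≤
        Subgroup.centralizer {toBraid e n z} := by
      rw [Subgroup.closure_le]
      rintro _ ⟨a, rfl⟩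
      rw [SetLike.mem_coe, Subgroup.mem_centralizer_singleton_iff]
      rw [← toBraid_mgen, ← map_mul, ← map_mul, hc]
    exact Subgroup.mem_centralizer_singleton_iff.1 (hle hx)

/-! ### Explicit form of the Garside element -/

theorem sDown_succ (k : ℕ) : sDown e n (k + 3) = sElt e n (k + 3) * sDown e n (k + 2) := by
  have h : k + 3 - 2 = k + 1 := by omega
  rw [sDown, sDown, h, List.range'_1_concat]
  simp [Nat.add_comm]

theorem sUp_succ (k : ℕ) : sUp e n (k + 3) = sUp e n (k + 2) * sElt e n (k + 3) := by
  have h : k + 3 - 2 = k + 1 := by omega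
  rw [sUp, sUp, h, List.range'_1_concat]
  simp [Nat.add_comm]

theorem factor_eq (k : ℕ) : factor (gen (e := e) (n := n)) k =
    if e = 1 then sDown e n (k + 2) * gen (.t 0) else Lam e n (k + 2) := by
  induction k with
  | zero => simp [factor, Lam, sDown, sUp]
  | succ k ih =>
    rw [factor, ih]
    have hs : sGen (gen (e := e) (n := n)) (k + 3) = sElt e n (k + 3) := rfl
    split_ifs
    · rw [sDown_succ, hs, mul_one, mul_assoc]
    · rw [Lam, Lam, sDown_succ, sUp_succ, hs]
      simp only [mul_assoc]

theorem garsideElt_eq : garsideElt e n = partialDelta gen (n - 1) := by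
  rw [garsideElt]
  induction n - 1 with
  | zero => simp [partialDelta]
  | succ m ih =>
    rw [List.range'_1_concat, List.map_append, List.prod_append, ih, partialDelta, factor_eq,
      Nat.add_comm m 2]
    simp

/-! ### Saturated sets of generators -/

theorem cl_eq_self_iff {Y : Set (Gen e n)} : cl Y = Y ↔ IsClosed Y :=
  ⟨fun h => h ▸ isClosed_cl Y, fun h => h.cl_eq⟩

theorem isClosed_iff_ncard (he : e ≠ 0) {Y : Set (Gen e n)} :
    IsClosed Y ↔ {i : ZMod e | .t i ∈ Y}.ncard ∈ ({0, 1, e} : Set ℕ) := by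
  have : NeZero e := ⟨he⟩
  constructor
  · intro hY
    by_cases h : {i : ZMod e | .t i ∈ Y}.ncard ≤ 1
    · simp only [Set.mem_insert_iff, Set.mem_singleton_iff]
      omega
    · obtain ⟨i, hi, j, hj, hij⟩ := (Set.one_lt_ncard (Set.toFinite _)).1 (not_le.1 h)
      have : {i : ZMod e | .t i ∈ Y} = Set.univ := Set.eq_univ_of_forall fun k =>
        hY _ hi _ hj (by simpa using hij) rfl (.t k) rfl
      rw [this, Set.ncard_univ, Nat.card_zmod]
      simp
  · intro h a ha b hb hab hr c hc
    have h2 := Gen.rk_eq_two_of_ne hab hr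
    obtain ⟨i, rfl⟩ := Gen.exists_t_of_rk h2
    obtain ⟨j, rfl⟩ := Gen.exists_t_of_rk (hr ▸ h2)
    obtain ⟨k, rfl⟩ := Gen.exists_t_of_rk (hc.trans h2)
    have h1 : 1 < {i : ZMod e | .t i ∈ Y}.ncard :=
      (Set.one_lt_ncard (Set.toFinite _)).2 ⟨i, ha, j, hb, fun h => hab (by rw [h])⟩
    have h3 : {i : ZMod e | .t i ∈ Y}.ncard = e := by
      simp only [Set.mem_insert_iff, Set.mem_singleton_iff] at h
      omega
    have h4 : {i : ZMod e | .t i ∈ Y} = Set.univ :=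
      Set.eq_of_subset_of_ncard_le (Set.subset_univ _) (by rw [h3, Set.ncard_univ, Nat.card_zmod])
    exact h4.ge (Set.mem_univ k)

theorem ncard_image_inter_tSet (hinj : Function.Injective (gen (e := e) (n := n)))
    (Y : Set (Gen e n)) : (gen '' Y ∩ tSet e n).ncard = {i : ZMod e | .t i ∈ Y}.ncard := by
  have h : gen '' Y ∩ tSet e n = (fun i => gen (.t i)) '' {i : ZMod e | .t i ∈ Y} := by
    ext x
    constructor
    · rintro ⟨⟨a, ha, rfl⟩, i, hi⟩
      exact ⟨i, show (.t i : Gen e n) ∈ Y from (hinj hi : .t i = a) ▸ ha, hi⟩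
    · rintro ⟨i, hi, rfl⟩
      exact ⟨⟨_, hi, rfl⟩, i, rfl⟩
  rw [h]
  exact Set.ncard_image_of_injective _ fun i j hij => by simpa using hinj hij

end

end CorranPicantin

theorem mainTheorem10 (e n : ℕ) (he : 1 ≤ e) (hn : 2 ≤ n) :
    -- the standard monoid embeds in `B`
    Function.Injective (CorranPicantin.toBraid e n) ∧
    -- `(B, B⁺, Δ)` is an LCM-Garside structure
    Garside.IsLCMGarside (CorranPicantin.pos e n) (CorranPicantin.garsideElt e n) ∧
    -- the generators are pairwise distinct, and they are the atoms
    Function.Injective (CorranPicantin.gen (e := e) (n := n)) ∧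
    Garside.atoms (CorranPicantin.pos e n) (CorranPicantin.garsideElt e n) =
      CorranPicantin.genSet e n ∧
    -- the saturated sets of atoms
    (∀ X : Set (CorranPicantin.Braid e n), X ⊆ CorranPicantin.genSet e n →
      (Garside.IsSaturated (CorranPicantin.pos e n) (CorranPicantin.garsideElt e n) X ↔
        (X ∩ CorranPicantin.tSet e n).ncard ∈ ({0, 1, e} : Set ℕ))) ∧
    -- the structure is support-preserving
    Garside.IsSupportPreserving (CorranPicantin.pos e n) (CorranPicantin.garsideElt e n) ∧
    -- a minimal positive conjugator for `x` that starts with an atom `u` outside the support `X`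
    -- of `x` is `ρ_u(x)`, and equals the ribbon `r_{X,u}`
    (∀ x ∈ CorranPicantin.pos e n, ∀ X : Set (CorranPicantin.Braid e n),
      Garside.IsSupport (CorranPicantin.pos e n) (CorranPicantin.garsideElt e n) x X →
      ∀ u ∈ CorranPicantin.genSet e n, u ∉ X →
      ∀ c : CorranPicantin.Braid e n,
        Garside.IsMinimalPositiveConjugator (CorranPicantin.pos e n) x c →
        Garside.IsPrefix (CorranPicantin.pos e n) u c →
          Garside.IsRho (CorranPicantin.pos e n) u x c ∧
          c = Garside.ribbon (CorranPicantin.pos e n) X u) := by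
  have he' : e ≠ 0 := by omega
  have hG := CorranPicantin.system he' hn
  have hsq := hG.squareFree hn
  rw [CorranPicantin.garsideElt_eq, ← hG.deltaSet_univ hn]
  refine ⟨CorranPicantin.toBraid_injective he' hn, hG.isLCMGarside hsq, hG.injective, hG.atoms_eq,
    fun X hX => ?_, hG.isSupportPreserving hsq, ?_⟩
  · obtain ⟨Y, rfl⟩ := Set.subset_range_iff_exists_image_eq.1 hX
    rw [CorranPicantin.ncard_image_inter_tSet hG.injective, ← CorranPicantin.isClosed_iff_ncard he',
      Garside.IsSaturated, hG.satClosure_eq, hG.injective.image_injective.eq_iff,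
      CorranPicantin.cl_eq_self_iff]
  · rintro x hx X hX _ ⟨u, rfl⟩ hu c hc huc
    exact hG.isRho_and_eq_ribbon hsq hx hX hu hc huc
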